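/- Let $\mathcal T$ be the universal unital $C^*$-algebra generated by an isometry $s$, with symbol map $\sigma:\mathcal T\to C(S^1)$, $s\mapsto \tilde u$ ($\tilde u(z)=z$), let $\mathbb Z_2=\{\pm1\}$, $I=[-1,1]$, $\iota(t)=t$ in $C(I)$, and let $H=C(\mathbb Z_2)$ with $u(\pm1)=\pm1$. All tensor products are algebraic. Put $\delta_1(k,t)=e^{i\pi(kt/4+k/2+3/2)}$, $\delta_2(t,k)=e^{i\pi(-kt/4-k/2+1)}$, $\sigma_1=\delta_1^*\circ\sigma:\mathcal T\to H\otimes C(I)$, $\sigma_2=\delta_2^*\circ\sigma:\mathcal T\to C(I)\otimes H$. Let $H$ coact on $\mathcal T$ by $s\mapsto s\otimes u$ and diagonally on $\mathcal T\otimes H$. Let $\Phi_{01}(h\otimes p\otimes k)=k\otimes p\otimes h$, $\Phi_{02}(h\otimes p\otimes k)=p\otimes k\otimes h$, $\Phi_{12}(p\otimes h\otimes k)=p\otimes k\otimes h$, and let $P=C(S^2_{\mathbb R\mathcal T})$ be the $H$-comodule algebra (with componentwise coaction) of all $(x_0,x_1,x_2)\in(\mathcal T\otimes H)^3$ such that $(\sigma_1\otimes\mathrm{id})(x_0)=\Phi_{01}(\sigma_1\otimes\mathrm{id})(x_1)$,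 $(\sigma_2\otimes\mathrm{id})(x_0)=\Phi_{02}(\sigma_1\otimes\mathrm{id})(x_2)$, $(\sigma_2\otimes\mathrm{id})(x_1)=\Phi_{12}(\sigma_2\otimes\mathrm{id})(x_2)$. A strong connection on a right $H$-comodule algebra $Q$ is a linear map $\ell:H\to Q\otimes Q$, $\ell(h)=h^{\langle1\rangle}\otimes h^{\langle2\rangle}$, that is unital, satisfies $h^{\langle1\rangle}h^{\langle2\rangle}=\varepsilon(h)$, and is right and left colinear: $\ell(h_{(1)})\otimes h_{(2)}=h^{\langle1\rangle}\otimes h^{\langle2\rangle}{}_{(0)}\otimes h^{\langle2\rangle}{}_{(1)}$ and $S(h_{(1)})\otimes\ell(h_{(2)})=h^{\langle1\rangle}{}_{(1)}\otimes h^{\langle1\rangle}{}_{(0)}\otimes h^{\langle2\rangle}$. Call $(\varphi_1,\varphi_2)\in\mathcal T^2$ admissible if both coact as $\varphi_i\mapsto\varphi_i\otimes u$ and $\sigma_1(\varphi_1)=u\otimes1$, $\sigma_2(\varphi_1)=\iota\otimes1$, $\sigma_2(\varphi_2)=1\otimes u$, $\sigma_1(\varphi_2)=1\otimes\iota$. Then: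 (0) There are admissible pairs for which both $(1-\varphi_2^2)(1-\varphi_1^2)$ and $(1-\varphi_1^2)(1-\varphi_2^2)$ are nonzero. There is a strong connection $\ell_{\mathcal T}$ on $\mathcal T\otimes H$ with $\ell_{\mathcal T}(u)=(1\otimes u)\otimes(1\otimes u)$. Let $(\varphi_1,\varphi_2)$ be admissible. (I) With $l_1=r_1=(\varphi_2\otimes1,\varphi_2\otimes1,1\otimes u)$, $l_2=((1-\varphi_2^2)\otimes u,(1-\varphi_2^2)\varphi_1\otimes1,0)$, $r_2=(1\otimes u,\varphi_1\otimes1,\varphi_1\otimes1)$, $l_3=(0,(1-\varphi_2^2)(1-\varphi_1^2)\otimes u,0)$, $r_3=(\varphi_1\otimes1,1\otimes u,\varphi_2\otimes1)$ (all in $P$), there is a strong connection $\ell$ on $P$ with $\ell(u)=\sum_{i=1}^3 l_i\otimes r_i$. It is obtained by applying twice the formula $$\ell(h)=(x,f_{12}(x))\otimes(y,f_{12}(y))+\bigl(0,(\varepsilon(h_{(1)})-f_{12}(x')f_{12}(y'))\,z\bigr)\otimes(f_{21}(w),w),$$ where $x\otimes y=\ell_1(h)$, $x'\otimes y'=\ell_1(h_{(1)})$,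 $z\otimes w=\ell_2(h_{(2)})$ (sums suppressed), for a strong connection on a fibre product of comodule algebras $P_1\xrightarrow{\pi_1}Q\xleftarrow{\pi_2}P_2$. Here $f_{12}=\mu\circ\pi_1$ is unital and colinear with $\mu$ a linear splitting of $\pi_2$ over the image of $\pi_1$, and likewise $f_{21}$ with the indices exchanged. First, the formula is applied to the pieces $0$ and $1$ with $\ell_1=\ell_2=\ell_{\mathcal T}$ and $f_{12}(1\otimes u)=f_{21}(1\otimes u)=\varphi_1\otimes1$; it gives on their pullback $P_{01}$ the strong connection with $\ell_{01}(u)=(1\otimes u,\varphi_1\otimes1)\otimes(1\otimes u,\varphi_1\otimes1)+(0,(1-\varphi_1^2)\otimes u)\otimes(\varphi_1\otimes1,1\otimes u)$. Second, it is applied to the piece $2$ and $P_{01}$ (the map $(x_0,x_1,x_2)\mapsto(x_2,(x_0,x_1))$ identifies $P$ with the fibre product of $\beta_1=(\Phi_{02}(\sigma_1\otimes\mathrm{id}),\Phi_{12}(\sigma_2\otimes\mathrm{id}))$ and $\beta_2(x,y)=((\sigma_2\otimes\mathrm{id})(x),(\sigma_2\otimes\mathrm{id})(y))$), with $\ell_1=\ell_{\mathcal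 T}$, $\ell_2=\ell_{01}$, $f_{12}(1\otimes u)=(\varphi_2\otimes1,\varphi_2\otimes1)$, $f_{21}(1\otimes u,\varphi_1\otimes1)=\varphi_1\otimes1$ and $f_{21}(\varphi_1\otimes1,1\otimes u)=\varphi_2\otimes1$. If $(1-\varphi_2^2)(1-\varphi_1^2)\ne0$, then $\{l_1,l_2,l_3\}$ and $\{r_1,r_2,r_3\}$ are each linearly independent. Put $B=P^{\mathrm{co}H}$. The matrix $p=(r_il_j)_{ij}$ lies in $M_3(B)$, $p^2=p$, and the left $B$-module $B^3p$ is isomorphic to that of the associated line bundle $\{x\in P: \rho(x)=x\otimes u\}$. (II) With $\gamma_0=(1\otimes u,\varphi_1\otimes1,\varphi_1\otimes1)$, $\gamma_1=(\varphi_1\otimes1,1\otimes u,\varphi_2\otimes1)$, $\gamma_2=(\varphi_2\otimes1,\varphi_2\otimes1,1\otimes u)$, there is a strong connection $\ell$ on $P$ with $$\ell(u)=\gamma_0\otimes\bigl((1-\varphi_1^2)(1-\varphi_2^2)\otimes u,0,0\bigr)+\gamma_1\otimes\bigl(\varphi_1(1-\varphi_2^2)\otimes1,(1-\varphi_2^2)\otimes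 u,0\bigr)+\gamma_2\otimes\gamma_2.$$ It is given by $\ell(h)=\sum_{i=0}^2\alpha_i(\ell_{\mathcal T}(h_{(1)})^{\langle1\rangle})\otimes\alpha_i(\ell_{\mathcal T}(h_{(1)})^{\langle2\rangle})\,T_{i+1}(h_{(2)})$, where $T_i(h)=\theta_i(h_{(1)})\cdots\theta_2(h_{(3-i)})$, $T_3=\varepsilon$, $\theta_i(h)=\varepsilon(h)-\alpha_i(\ell_{\mathcal T}(h)^{\langle1\rangle})\alpha_i(\ell_{\mathcal T}(h)^{\langle2\rangle})$, and $\alpha_i:\mathrm{span}\{1\otimes1,1\otimes u\}\to P$ are the unital colinear splittings of the $i$-th projections of $P$ with $\alpha_i(1\otimes u)=\gamma_i$. The left legs $\gamma_0,\gamma_1,\gamma_2$ are linearly independent, and so are the three right legs if $(1-\varphi_1^2)(1-\varphi_2^2)\ne0$. -/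

import Mathlib

open scoped TensorProduct ENNReal

noncomputable section

namespace QSphere

/-! ### Comodule algebras and strong connections -/

section General

universe u v w

/-- A right coaction making the `k`-algebra `P` a right `H`-comodule algebra. -/
structure Coaction (k : Type u) (H : Type v) (P : Type w) [Field k] [Ring H] [HopfAlgebra k H]
    [Ring P] [Algebra k P] where
  toAlgHom : P →ₐ[k] P ⊗[k] H
  coassoc : (TensorProduct.assoc k P H H).toLinearMap ∘ₗ toAlgHom.toLinearMap.rTensor H ∘ₗ
      toAlgHom.toLinearMap = (Coalgebra.comul (R := k) (A := H)).lTensor P ∘ₗ toAlgHom.toLinearMap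
  counit : ∀ p : P, (Coalgebra.counit (R := k) (A := H)).lTensor P (toAlgHom p) = p ⊗ₜ[k] (1 : k)

variable {k : Type u} {H : Type v} [Field k] [Ring H] [HopfAlgebra k H]
variable {P : Type w} [Ring P] [Algebra k P]

/-- `ℓ : H → P ⊗ P` is a strong connection: it is unital, `ℓ(h)⟨1⟩ ℓ(h)⟨2⟩ = ε(h)`, and it is right
and left colinear. -/
structure IsStrongConnection (ρ : Coaction k H P) (ℓ : H →ₗ[k] P ⊗[k] P) : Prop where
  unital : ℓ 1 = 1 ⊗ₜ[k] 1
  collapse : ∀ h : H, LinearMap.mul' k P (ℓ h) = algebraMap k P (Coalgebra.counit h)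
  right_colinear : ∀ h : H,
    TensorProduct.assoc k P P H (ℓ.rTensor H (Coalgebra.comul h)) =
      ρ.toAlgHom.toLinearMap.lTensor P (ℓ h)
  left_colinear : ∀ h : H,
    TensorProduct.map (HopfAlgebra.antipode k) ℓ (Coalgebra.comul h) =
      TensorProduct.assoc k H P P
        (((TensorProduct.comm k P H).toLinearMap ∘ₗ ρ.toAlgHom.toLinearMap).rTensor P (ℓ h))

/-- Right colinearity of a linear map between comodule algebras. -/
def IsColinear {P' : Type*} [Ring P'] [Algebra k P'] (ρ : Coaction k H P) (ρ' : Coaction k H P')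
    (f : P →ₗ[k] P') : Prop :=
  ∀ p : P, ρ'.toAlgHom (f p) = f.rTensor H (ρ.toAlgHom p)

/-- `V ⊆ P` is a subcomodule and the linear map `f : V → P'` is right colinear. -/
def IsColinearOn {P' : Type*} [Ring P'] [Algebra k P'] (ρ : Coaction k H P)
    (ρ' : Coaction k H P') (V : Submodule k P) (f : V →ₗ[k] P') : Prop :=
  ∀ v : V, ∃ w : V ⊗[k] H,
    V.subtype.rTensor H w = ρ.toAlgHom (v : P) ∧ ρ'.toAlgHom (f v) = f.rTensor H w

/-- The subalgebra `P^{co H}` of coaction invariant elements. -/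
def Coaction.coinvariants (ρ : Coaction k H P) : Subalgebra k P :=
  AlgHom.equalizer ρ.toAlgHom (Algebra.TensorProduct.includeLeft : P →ₐ[k] P ⊗[k] H)

/-- The left `P^{co H}`-module `{x ∈ P | ρ(x) = x ⊗ g}`: for a group-like `g` these are the sections
of the line bundle associated with the one-dimensional corepresentation `1 ↦ g ⊗ 1`. -/
def Coaction.lineBundle (ρ : Coaction k H P) (g : H) : Submodule ρ.coinvariants P where
  carrier := {x | ρ.toAlgHom x = x ⊗ₜ[k] g}
  add_mem' := by
    intro a b ha hb
    simp only [Set.mem_ofPred_eq] at *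
    rw [map_add, ha, hb, TensorProduct.add_tmul]
  zero_mem' := by simp
  smul_mem' := by
    intro c x hx
    have hc : ρ.toAlgHom (c : P) = (c : P) ⊗ₜ[k] (1 : H) := c.2
    simp only [Set.mem_ofPred_eq] at *
    rw [Subalgebra.smul_def, smul_eq_mul, map_mul, hc, hx, Algebra.TensorProduct.tmul_mul_tmul,
      one_mul]

/-- `f = μ ∘ π`, where `μ` is a unital colinear splitting of `π'` over the image of `π`. -/
structure IsGluingMap {P₁ P₂ Q : Type*} [Ring P₁] [Algebra k P₁] [Ring P₂] [Algebra k P₂]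
    [Ring Q] [Algebra k Q] (ρ₁ : Coaction k H P₁) (ρ₂ : Coaction k H P₂)
    (π : P₁ →ₐ[k] Q) (π' : P₂ →ₐ[k] Q) (f : P₁ →ₗ[k] P₂) : Prop where
  unital : f 1 = 1
  colinear : IsColinear ρ₁ ρ₂ f
  splitting : ∃ μ : π.range →ₗ[k] P₂, (∀ q, π' (μ q) = q) ∧ ∀ x, f x = μ (π.rangeRestrict x)

/-- `h ↦ ε(h) - a(h)⟨1⟩ a(h)⟨2⟩`. -/
def defect (a : H →ₗ[k] P ⊗[k] P) : H →ₗ[k] P :=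
  Algebra.linearMap k P ∘ₗ Coalgebra.counit - LinearMap.mul' k P ∘ₗ a

/-- The strong connection gluing formula for a fibre product of `P₁` and `P₂`:
`ℓ(h) = (ℓ₁(h)⟨1⟩, f₁₂(ℓ₁(h)⟨1⟩)) ⊗ (ℓ₁(h)⟨2⟩, f₁₂(ℓ₁(h)⟨2⟩))
  + (0, (ε(h₁) - f₁₂(ℓ₁(h₁)⟨1⟩) f₁₂(ℓ₁(h₁)⟨2⟩)) ℓ₂(h₂)⟨1⟩) ⊗ (f₂₁(ℓ₂(h₂)⟨2⟩), ℓ₂(h₂)⟨2⟩)`,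
with values in `(P₁ × P₂) ⊗ (P₁ × P₂)`. -/
def pullbackGlue {P₁ P₂ : Type*} [Ring P₁] [Algebra k P₁] [Ring P₂] [Algebra k P₂]
    (ℓ₁ : H →ₗ[k] P₁ ⊗[k] P₁) (ℓ₂ : H →ₗ[k] P₂ ⊗[k] P₂)
    (f₁₂ : P₁ →ₗ[k] P₂) (f₂₁ : P₂ →ₗ[k] P₁) : H →ₗ[k] (P₁ × P₂) ⊗[k] (P₁ × P₂) :=
  TensorProduct.map (LinearMap.id.prod f₁₂) (LinearMap.id.prod f₁₂) ∘ₗ ℓ₁ +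
  TensorProduct.map (LinearMap.inr k P₁ P₂) (f₂₁.prod LinearMap.id) ∘ₗ
    (LinearMap.mul' k P₂).rTensor P₂ ∘ₗ (TensorProduct.assoc k P₂ P₂ P₂).symm.toLinearMap ∘ₗ
    TensorProduct.map (defect (TensorProduct.map f₁₂ f₁₂ ∘ₗ ℓ₁)) ℓ₂ ∘ₗ Coalgebra.comul

/-- For a list `[a_i, …, a_n]` of maps `H → P ⊗ P`, the product
`T_i(h) = θ_i(h₁) θ_{i+1}(h₂) ⋯ θ_n(h_{n-i+1})` with `θ_j(h) = ε(h) - a_j(h)⟨1⟩ a_j(h)⟨2⟩`;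
the empty product is `ε`. -/
def defectProd : List (H →ₗ[k] P ⊗[k] P) → (H →ₗ[k] P)
  | [] => Algebra.linearMap k P ∘ₗ Coalgebra.counit
  | a :: L => LinearMap.mul' k P ∘ₗ TensorProduct.map (defect a) (defectProd L) ∘ₗ Coalgebra.comul

/-- For the list of the maps `a_i = (α_i ⊗ α_i) ∘ ℓ_i`, `i = 0, …, n`, the formula
`ℓ(h) = ∑ i, α_i(ℓ_i(h₁)⟨1⟩) ⊗ α_i(ℓ_i(h₁)⟨2⟩) T_{i+1}(h₂)`. -/
def piecewiseGlue : List (H →ₗ[k] P ⊗[k] P) → (H →ₗ[k] P ⊗[k] P)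
  | [] => 0
  | a :: L => (LinearMap.mul' k P).lTensor P ∘ₗ (TensorProduct.assoc k P P P).toLinearMap ∘ₗ
      TensorProduct.map a (defectProd L) ∘ₗ Coalgebra.comul + piecewiseGlue L

end General

/-! ### The Hopf algebra of functions on the two-element group -/

/-- The algebra `C(X) = C(X, ℂ)` of continuous complex functions. -/
def CFun (X : Type*) [TopologicalSpace X] : Type _ := C(X, ℂ)

namespace CFun

variable {X : Type*} [TopologicalSpace X]

instance : CommRing (CFun X) := inferInstanceAs (CommRing C(X, ℂ))

instance : Algebra ℂ (CFun X) := inferInstanceAs (Algebra ℂ C(X, ℂ))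

instance : FunLike (CFun X) X ℂ := inferInstanceAs (FunLike C(X, ℂ) X ℂ)

@[ext] lemma ext {f g : CFun X} (h : ∀ x, f x = g x) : f = g := DFunLike.ext f g h

/-- A continuous function as an element of `C(X)`. -/
def of (f : C(X, ℂ)) : CFun X := f

@[simp] lemma of_apply (f : C(X, ℂ)) (x : X) : of f x = f x := rfl

@[simp] lemma add_apply (f g : CFun X) (x : X) : (f + g) x = f x + g x := rfl

@[simp] lemma sub_apply (f g : CFun X) (x : X) : (f - g) x = f x - g x := rfl

@[simp] lemma neg_apply (f : CFun X) (x : X) : (-f) x = -f x := rfl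

@[simp] lemma mul_apply (f g : CFun X) (x : X) : (f * g) x = f x * g x := rfl

@[simp] lemma smul_apply (c : ℂ) (f : CFun X) (x : X) : (c • f) x = c * f x := rfl

@[simp] lemma one_apply (x : X) : (1 : CFun X) x = 1 := rfl

@[simp] lemma zero_apply (x : X) : (0 : CFun X) x = 0 := rfl

@[simp] lemma algebraMap_apply (c : ℂ) (x : X) : algebraMap ℂ (CFun X) c x = c := rfl

/-- Restriction of functions along a continuous map. -/
def pull {Y : Type*} [TopologicalSpace Y] (g : C(X, Y)) : CFun Y →ₐ[ℂ] CFun X :=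
  (ContinuousMap.compRightAlgHom ℂ ℂ g : C(Y, ℂ) →ₐ[ℂ] C(X, ℂ))

@[simp] lemma pull_apply {Y : Type*} [TopologicalSpace Y] (g : C(X, Y)) (f : CFun Y) (x : X) :
    pull g f x = f (g x) := rfl

end CFun

/-- The algebra `C(ℤ₂)`, where `ℤ₂ = {1, -1}`. -/
abbrev CZ2 : Type := CFun ℤˣ

/-- The generator `u(±1) = ±1`. -/
def genU : CZ2 := CFun.of ⟨fun k => ((k : ℤ) : ℂ), by fun_prop⟩

@[simp] lemma genU_apply (k : ℤˣ) : genU k = ((k : ℤ) : ℂ) := rfl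

/-- The indicator function of `{g}`. -/
def ind (g : ℤˣ) : CZ2 :=
  CFun.of ⟨fun k => if k = g then 1 else 0, continuous_of_discreteTopology⟩

@[simp] lemma ind_apply (g k : ℤˣ) : ind g k = if k = g then 1 else 0 := rfl

lemma ind_add : ind 1 + ind (-1) = 1 := by
  ext k
  rcases Int.units_eq_one_or k with rfl | rfl <;> simp

lemma ind_mul_same (g : ℤˣ) : ind g * ind g = ind g := by
  ext k; simp

lemma ind_one_mul : ind 1 * ind (-1) = 0 := by
  ext k
  rcases Int.units_eq_one_or k with rfl | rfl <;> simp

lemma ind_neg_mul : ind (-1) * ind 1 = 0 := by rw [mul_comm, ind_one_mul]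

lemma CZ2.eq_ind (f : CZ2) : f = f 1 • ind 1 + f (-1) • ind (-1) := by
  ext k
  rcases Int.units_eq_one_or k with rfl | rfl <;> simp

lemma ind_eq_half : ind 1 = (1 / 2 : ℂ) • (1 + genU) ∧ ind (-1) = (1 / 2 : ℂ) • (1 - genU) := by
  constructor <;> ext k <;> rcases Int.units_eq_one_or k with rfl | rfl <;>
    simp <;> norm_num

lemma genU_eq : genU = ind 1 - ind (-1) := by
  ext k
  rcases Int.units_eq_one_or k with rfl | rfl <;> simp

/-- For a pair of algebra maps `f₊, f₋ : A → B`, the algebra map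
`a ↦ ∑ g, f_g(a) ⊗ ind g` into `B ⊗ C(ℤ₂) = C(ℤ₂, B)`. -/
def pairHom {A B : Type*} [Ring A] [Algebra ℂ A] [Ring B] [Algebra ℂ B] (f g : A →ₐ[ℂ] B) :
    A →ₐ[ℂ] B ⊗[ℂ] CZ2 :=
  AlgHom.ofLinearMap
    ((TensorProduct.mk ℂ B CZ2).flip (ind 1) ∘ₗ f.toLinearMap +
      (TensorProduct.mk ℂ B CZ2).flip (ind (-1)) ∘ₗ g.toLinearMap)
    (by
      simp only [LinearMap.add_apply, LinearMap.comp_apply, AlgHom.toLinearMap_apply, map_one,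
        LinearMap.flip_apply, TensorProduct.mk_apply]
      rw [← TensorProduct.tmul_add, ind_add, Algebra.TensorProduct.one_def])
    (by
      intro x y
      simp [mul_add, add_mul, ind_mul_same, ind_one_mul, ind_neg_mul])

@[simp] lemma pairHom_apply {A B : Type*} [Ring A] [Algebra ℂ A] [Ring B] [Algebra ℂ B]
    (f g : A →ₐ[ℂ] B) (a : A) : pairHom f g a = f a ⊗ₜ[ℂ] ind 1 + g a ⊗ₜ[ℂ] ind (-1) := rfl

/-- The involution `f ↦ f(- ·)` of functions on a space with a continuous negation. -/
def negPull (X : Type*) [TopologicalSpace X] [Neg X] [ContinuousNeg X] : CFun X →ₐ[ℂ] CFun X :=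
  CFun.pull ⟨fun x : X => -x, continuous_neg⟩

instance : ContinuousNeg ℤˣ := ⟨continuous_of_discreteTopology⟩

@[simp] lemma negPull_apply {X : Type*} [TopologicalSpace X] [Neg X] [ContinuousNeg X]
    (f : CFun X) (x : X) : negPull X f x = f (-x) := rfl

@[simp] lemma negPull_ind_one : negPull ℤˣ (ind 1) = ind (-1) := by
  ext k
  rcases Int.units_eq_one_or k with rfl | rfl <;> simp

@[simp] lemma negPull_ind_neg : negPull ℤˣ (ind (-1)) = ind 1 := by
  ext k
  rcases Int.units_eq_one_or k with rfl | rfl <;> simp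

/-- The comultiplication `Δ(f)(g, h) = f(g h)`, written as `Δ(f) = ∑ h, f(· h) ⊗ ind h`. -/
def comulZ2 : CZ2 →ₐ[ℂ] CZ2 ⊗[ℂ] CZ2 := pairHom (AlgHom.id ℂ CZ2) (negPull ℤˣ)

/-- The counit `ε(f) = f(1)`. -/
def counitZ2 : CZ2 →ₐ[ℂ] ℂ :=
  (ContinuousMap.evalAlgHom ℂ ℂ (1 : ℤˣ) : C(ℤˣ, ℂ) →ₐ[ℂ] ℂ)

@[simp] lemma comulZ2_apply (f : CZ2) :
    comulZ2 f = f ⊗ₜ[ℂ] ind 1 + negPull ℤˣ f ⊗ₜ[ℂ] ind (-1) := rfl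

@[simp] lemma counitZ2_apply (f : CZ2) : counitZ2 f = f 1 := rfl

lemma negPull_negPull {X : Type*} [TopologicalSpace X] [InvolutiveNeg X] [ContinuousNeg X]
    (f : CFun X) : negPull X (negPull X f) = f := by ext; simp

instance instBialgebraCZ2 : Bialgebra ℂ CZ2 :=
  Bialgebra.ofAlgHom comulZ2 counitZ2
    (by
      apply AlgHom.ext
      intro f
      simp only [AlgHom.comp_apply, comulZ2_apply, map_add, Algebra.TensorProduct.map_tmul,
        negPull_negPull, TensorProduct.add_tmul, TensorProduct.tmul_add, AlgHom.coe_id, id_eq,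
        AlgEquiv.toAlgHom_apply, Algebra.TensorProduct.assoc_tmul,
        negPull_ind_one, negPull_ind_neg]
      abel)
    (by
      apply AlgHom.ext
      intro f
      simp only [AlgHom.comp_apply, comulZ2_apply, map_add, Algebra.TensorProduct.map_tmul,
        AlgHom.coe_id, id_eq, counitZ2_apply, negPull_apply, AlgEquiv.toAlgHom_apply,
        Algebra.TensorProduct.lid_symm_apply]
      conv_rhs => rw [CZ2.eq_ind f]
      rw [TensorProduct.tmul_add, TensorProduct.tmul_smul, TensorProduct.tmul_smul,
        TensorProduct.smul_tmul', TensorProduct.smul_tmul', smul_eq_mul, smul_eq_mul, mul_one,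
        mul_one])
    (by
      apply AlgHom.ext
      intro f
      simp)

/-- The antipode `S(f)(g) = f(g⁻¹)`. -/
def antipodeZ2 : CZ2 →ₐ[ℂ] CZ2 :=
  CFun.pull ⟨fun k : ℤˣ => k⁻¹, continuous_of_discreteTopology⟩

@[simp] lemma antipodeZ2_apply (f : CZ2) : antipodeZ2 f = f := by
  ext k
  change f k⁻¹ = f k
  rw [Int.units_inv_eq_self]

/-- The Hopf algebra `C(ℤ₂)`. -/
instance instHopfCZ2 : HopfAlgebra ℂ CZ2 where
  antipode := antipodeZ2.toLinearMap
  mul_antipode_rTensor_comul := by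
    ext1 f
    change LinearMap.mul' ℂ CZ2 (antipodeZ2.toLinearMap.rTensor CZ2 (comulZ2 f)) =
      algebraMap ℂ CZ2 (counitZ2 f)
    ext k
    rcases Int.units_eq_one_or k with rfl | rfl <;> simp
  mul_antipode_lTensor_comul := by
    ext1 f
    change LinearMap.mul' ℂ CZ2 (antipodeZ2.toLinearMap.lTensor CZ2 (comulZ2 f)) =
      algebraMap ℂ CZ2 (counitZ2 f)
    ext k
    rcases Int.units_eq_one_or k with rfl | rfl <;> simp

lemma comul_apply (f : CZ2) : Coalgebra.comul (R := ℂ) f =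
    f ⊗ₜ[ℂ] ind 1 + negPull ℤˣ f ⊗ₜ[ℂ] ind (-1) := rfl

lemma counit_apply (f : CZ2) : Coalgebra.counit (R := ℂ) f = f 1 := rfl

/-- The coaction of `C(ℤ₂)` given by an involutive automorphism `τ` (the action of `-1 ∈ ℤ₂`):
`ρ(p) = p ⊗ ind 1 + τ(p) ⊗ ind (-1)`, i.e. `ρ(p) = p ⊗ u` when `τ(p) = -p` and `ρ(p) = p ⊗ 1` when
`τ(p) = p`. -/
def involutionCoaction {P : Type*} [Ring P] [Algebra ℂ P] (τ : P →ₐ[ℂ] P) (hτ : ∀ p, τ (τ p) = p) :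
    Coaction ℂ CZ2 P where
  toAlgHom := pairHom (AlgHom.id ℂ P) τ
  coassoc := by
    ext1 p
    simp only [LinearMap.comp_apply, AlgHom.toLinearMap_apply, pairHom_apply, map_add,
      LinearMap.rTensor_tmul, LinearMap.lTensor_tmul, comul_apply, TensorProduct.add_tmul,
      TensorProduct.tmul_add, AlgHom.coe_id, id_eq, LinearEquiv.coe_coe, TensorProduct.assoc_tmul,
      negPull_ind_one, negPull_ind_neg, hτ]
    abel
  counit := by
    intro p
    simp [counit_apply, ind]

@[simp] lemma involutionCoaction_apply {P : Type*} [Ring P] [Algebra ℂ P] (τ : P →ₐ[ℂ] P)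
    (hτ : ∀ p, τ (τ p) = p) (p : P) : (involutionCoaction τ hτ).toAlgHom p =
      p ⊗ₜ[ℂ] ind 1 + τ p ⊗ₜ[ℂ] ind (-1) := rfl

lemma involutionCoaction_odd {P : Type*} [Ring P] [Algebra ℂ P] (τ : P →ₐ[ℂ] P)
    (hτ : ∀ p, τ (τ p) = p) (p : P) (hp : τ p = -p) :
    (involutionCoaction τ hτ).toAlgHom p = p ⊗ₜ[ℂ] genU := by
  rw [involutionCoaction_apply, hp, genU_eq, TensorProduct.tmul_sub, TensorProduct.neg_tmul,
    sub_eq_add_neg]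

/-! ### The Toeplitz algebra -/

/-- An isometry in a (nonzero) unital C*-algebra. -/
structure IsometryIn : Type 1 where
  carrier : Type
  [cstar : CStarAlgebra carrier]
  [nontriv : Nontrivial carrier]
  v : carrier
  isometry : star v * v = 1

attribute [instance] IsometryIn.cstar IsometryIn.nontriv

/-- The C*-algebra of bounded families indexed by all isometries in unital C*-algebras. -/
abbrev IsoFamilies : Type 1 := lp (fun i : IsometryIn => i.carrier) ∞

lemma IsometryIn.norm_le (i : IsometryIn) : ‖i.v‖ ≤ 1 := by
  have h := CStarRing.norm_star_mul_self (x := i.v)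
  rw [i.isometry, CStarRing.norm_one] at h
  nlinarith [norm_nonneg i.v]

instance : CStarAlgebra IsoFamilies where

/-- The family of all isometries. -/
def isoFamily : IsoFamilies :=
  ⟨fun i => i.v, memℓp_infty ⟨1, by rintro _ ⟨i, rfl⟩; exact i.norm_le⟩⟩

/-- The Toeplitz algebra, i.e. the universal C*-algebra generated by an isometry `s`: the completion
of the `*`-algebra generated by an isometry with respect to the supremum of the C*-norms given by
all isometries in unital C*-algebras, realised as the closed `*`-subalgebra generated by the family
of all isometries. Its universal property is `Toeplitz.existsUnique_lift`. -/
def Toeplitz : Type 1 := StarAlgebra.elemental ℂ isoFamily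

namespace Toeplitz

instance instCStarAlgebraElemental : CStarAlgebra (StarAlgebra.elemental ℂ isoFamily) where

instance : CStarAlgebra Toeplitz :=
  inferInstanceAs (CStarAlgebra (StarAlgebra.elemental ℂ isoFamily))

/-- The generating isometry. -/
def s : Toeplitz :=
  (⟨isoFamily, StarAlgebra.elemental.self_mem ℂ isoFamily⟩ : StarAlgebra.elemental ℂ isoFamily)

/-- The family of the values of an element of `𝒯` under all representations. -/
def toFamilies : Toeplitz →⋆ₐ[ℂ] IsoFamilies := (StarAlgebra.elemental ℂ isoFamily).subtype

lemma toFamilies_injective : Function.Injective toFamilies := Subtype.val_injective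

lemma toFamilies_mem (x : Toeplitz) : toFamilies x ∈ StarAlgebra.elemental ℂ isoFamily :=
  Subtype.property (p := fun y => y ∈ StarAlgebra.elemental ℂ isoFamily) x

@[simp] lemma toFamilies_s : toFamilies s = isoFamily := rfl

/-- The `*`-homomorphism `𝒯 → B` with `s ↦ v`, for an isometry `v ∈ B`. -/
def lift (i : IsometryIn) : Toeplitz →⋆ₐ[ℂ] i.carrier where
  toFun x := toFamilies x i
  map_one' := rfl
  map_mul' _ _ := rfl
  map_zero' := rfl
  map_add' _ _ := rfl
  commutes' _ := rfl
  map_star' _ := rfl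

@[simp] lemma lift_s (i : IsometryIn) : lift i s = i.v := rfl

lemma star_s_mul_s : star s * s = 1 := by
  apply toFamilies_injective
  apply Subtype.ext
  funext i
  exact i.isometry

lemma continuous_hom {B : Type*} [CStarAlgebra B] (f : Toeplitz →⋆ₐ[ℂ] B) : Continuous f := by
  have : ContinuousLinearMapClass (Toeplitz →⋆ₐ[ℂ] B) ℂ Toeplitz B :=
    NonUnitalStarAlgHom.instContinuousLinearMapClassComplex
  exact map_continuous f

/-- Two `*`-homomorphisms on the Toeplitz algebra that agree on `s` are equal. -/
lemma hom_ext {B : Type*} [CStarAlgebra B] {f g : Toeplitz →⋆ₐ[ℂ] B} (h : f s = g s) : f = g :=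
  StarAlgebra.elemental.starAlgHomClass_ext (F := StarAlgebra.elemental ℂ isoFamily →⋆ₐ[ℂ] B)
    ℂ (continuous_hom f) (continuous_hom g) h

/-- The universal property. -/
theorem existsUnique_lift (i : IsometryIn) : ∃! f : Toeplitz →⋆ₐ[ℂ] i.carrier, f s = i.v :=
  ⟨lift i, lift_s i, fun _ h => hom_ext h⟩

/-- The isometry `-v`. -/
def negIso (i : IsometryIn) : IsometryIn := ⟨i.carrier, -i.v, by simp [i.isometry]⟩

/-- Substitution of `-v` for `v` in families indexed by isometries. -/
def negFamilies : IsoFamilies →⋆ₐ[ℂ] IsoFamilies where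
  toFun x := ⟨fun i => x (negIso i), memℓp_infty (by
    obtain ⟨C, hC⟩ := memℓp_infty_iff.mp (lp.memℓp x)
    exact ⟨C, by rintro _ ⟨i, rfl⟩; exact hC ⟨negIso i, rfl⟩⟩)⟩
  map_one' := rfl
  map_mul' _ _ := rfl
  map_zero' := rfl
  map_add' _ _ := rfl
  commutes' _ := rfl
  map_star' _ := rfl

lemma negFamilies_isoFamily : negFamilies isoFamily = -isoFamily := rfl

open scoped CStarAlgebra in
lemma negFamilies_mem (x : IsoFamilies) (hx : x ∈ StarAlgebra.elemental ℂ isoFamily) :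
    negFamilies x ∈ StarAlgebra.elemental ℂ isoFamily := by
  have hc : IsClosed
      ((StarAlgebra.elemental ℂ isoFamily).comap negFamilies : Set IsoFamilies) :=
    (StarAlgebra.elemental.isClosed ℂ isoFamily).preimage (map_continuous negFamilies)
  refine StarAlgebra.elemental.le_of_mem hc ?_ hx
  rw [StarSubalgebra.mem_comap, negFamilies_isoFamily]
  exact neg_mem (StarAlgebra.elemental.self_mem ℂ isoFamily)

/-- The automorphism of `𝒯` with `s ↦ -s`. -/
def neg : Toeplitz →⋆ₐ[ℂ] Toeplitz :=
  StarAlgHom.codRestrict (negFamilies.comp toFamilies) (StarAlgebra.elemental ℂ isoFamily)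
    fun x => negFamilies_mem _ (toFamilies_mem x)

@[simp] lemma neg_s : neg s = -s := rfl

@[simp] lemma neg_neg_apply (x : Toeplitz) : neg (neg x) = x := by
  have h : neg.comp neg = StarAlgHom.id ℂ Toeplitz := hom_ext (by simp)
  exact DFunLike.congr_fun h x

/-- The coaction of `C(ℤ₂)` on `𝒯`, `s ↦ s ⊗ u`. -/
def coaction : Coaction ℂ CZ2 Toeplitz := involutionCoaction neg.toAlgHom neg_neg_apply

lemma coaction_s : coaction.toAlgHom s = s ⊗ₜ[ℂ] genU :=
  involutionCoaction_odd _ _ _ neg_s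

/-- The unitary `z ↦ z` generating `C(S¹)`. -/
def circleGen : C(Circle, ℂ) := ⟨fun z => (z : ℂ), by fun_prop⟩

@[simp] lemma circleGen_apply (z : Circle) : circleGen z = z := rfl

/-- The isometry `circleGen` in `C(S¹)`. -/
def circleIso : IsometryIn where
  carrier := C(Circle, ℂ)
  v := circleGen
  isometry := by
    ext z
    simp [← Complex.normSq_eq_conj_mul_self, circleGen_apply]

/-- The symbol map `σ : 𝒯 → C(S¹)`, `s ↦ (z ↦ z)`. -/
def symbolStar : Toeplitz →⋆ₐ[ℂ] C(Circle, ℂ) := lift circleIso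

@[simp] lemma symbolStar_s : symbolStar s = circleGen := rfl

/-- The symbol map as a map of algebras. -/
def symbol : Toeplitz →ₐ[ℂ] CFun Circle := symbolStar.toAlgHom

@[simp] lemma symbol_s : symbol s = CFun.of circleGen := rfl

/-- The symbol map is equivariant. -/
lemma symbol_neg (x : Toeplitz) : symbol (neg x) = negPull Circle (symbol x) := by
  let g : C(Circle, ℂ) →⋆ₐ[ℂ] C(Circle, ℂ) :=
    ContinuousMap.compStarAlgHom' ℂ ℂ ⟨fun x : Circle => -x, continuous_neg⟩
  have h : symbolStar.comp neg = g.comp symbolStar := hom_ext (by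
    ext z
    simp [g])
  exact DFunLike.congr_fun h x

end Toeplitz

/-! ### The quantum sphere -/

/-- The interval `I = [-1, 1]`. -/
abbrev UI : Type := Set.Icc (-1 : ℝ) 1

instance : InvolutiveNeg UI where
  neg t := ⟨-t, by have h1 := t.2.1; have h2 := t.2.2; constructor <;> linarith⟩
  neg_neg t := Subtype.ext (neg_neg (t : ℝ))

instance : ContinuousNeg UI := ⟨Continuous.subtype_mk (by fun_prop) _⟩

lemma UI.coe_neg (t : UI) : ((-t : UI) : ℝ) = -t := rfl

/-- The algebra `C(I)`. -/
abbrev CI : Type := CFun UI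

/-- The inclusion function `t ↦ t` on `I`. -/
def iotaI : CI := CFun.of ⟨fun t => ((t : ℝ) : ℂ), by fun_prop⟩

/-- `t ↦ δ₁(k, t) = exp(iπ(kt/4 + k/2 + 3/2))`. -/
def delta1 (k : ℤˣ) : C(UI, Circle) :=
  ⟨fun t => Circle.exp (Real.pi * ((k : ℤ) * t / 4 + (k : ℤ) / 2 + 3 / 2)), by fun_prop⟩

/-- `t ↦ δ₂(t, k) = exp(iπ(-kt/4 - k/2 + 1))`. -/
def delta2 (k : ℤˣ) : C(UI, Circle) :=
  ⟨fun t => Circle.exp (Real.pi * (-((k : ℤ) * t / 4) - (k : ℤ) / 2 + 1)), by fun_prop⟩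

/-- `δ₁* : C(S¹) → C(ℤ₂) ⊗ C(I)`. -/
def delta1Star : CFun Circle →ₐ[ℂ] CZ2 ⊗[ℂ] CI :=
  (Algebra.TensorProduct.comm ℂ CI CZ2).toAlgHom.comp
    (pairHom (CFun.pull (delta1 1))
      (CFun.pull (delta1 (-1))))

/-- `δ₂* : C(S¹) → C(I) ⊗ C(ℤ₂)`. -/
def delta2Star : CFun Circle →ₐ[ℂ] CI ⊗[ℂ] CZ2 :=
  pairHom (CFun.pull (delta2 1))
    (CFun.pull (delta2 (-1)))

/-- `σ₁ = δ₁* ∘ σ`. -/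
def sigma1 : Toeplitz →ₐ[ℂ] CZ2 ⊗[ℂ] CI := delta1Star.comp Toeplitz.symbol

/-- `σ₂ = δ₂* ∘ σ`. -/
def sigma2 : Toeplitz →ₐ[ℂ] CI ⊗[ℂ] CZ2 := delta2Star.comp Toeplitz.symbol

lemma Circle.exp_pi_mul_add_one (x : ℝ) :
    Circle.exp (Real.pi * (x + 1)) = -Circle.exp (Real.pi * x) := by
  ext
  simp [mul_add, Circle.coe_exp]

lemma delta1_neg_one (t : UI) : delta1 (-1) (-t) = -delta1 1 t := by
  have h : delta1 1 t = -delta1 (-1) (-t) := by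
    simp only [delta1, ContinuousMap.coe_mk, UI.coe_neg]
    rw [← Circle.exp_pi_mul_add_one]
    congr 1
    push_cast
    ring
  rw [h, neg_neg]

lemma delta2_neg_one (t : UI) : delta2 (-1) (-t) = -delta2 1 t := by
  simp only [delta2, ContinuousMap.coe_mk, UI.coe_neg]
  rw [← Circle.exp_pi_mul_add_one]
  congr 1
  push_cast
  ring

lemma delta1_one (t : UI) : delta1 1 (-t) = -delta1 (-1) t := by
  rw [← neg_neg t, delta1_neg_one]
  simp

lemma delta2_one (t : UI) : delta2 1 (-t) = -delta2 (-1) t := by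
  rw [← neg_neg t, delta2_neg_one]
  simp

/-- The diagonal involution of `C(ℤ₂) ⊗ C(I)`. -/
abbrev negZI : CZ2 ⊗[ℂ] CI →ₐ[ℂ] CZ2 ⊗[ℂ] CI :=
  Algebra.TensorProduct.map (negPull ℤˣ) (negPull UI)

/-- The diagonal involution of `C(I) ⊗ C(ℤ₂)`. -/
abbrev negIZ : CI ⊗[ℂ] CZ2 →ₐ[ℂ] CI ⊗[ℂ] CZ2 :=
  Algebra.TensorProduct.map (negPull UI) (negPull ℤˣ)

lemma delta1Star_apply (f : CFun Circle) :
    delta1Star f = ind 1 ⊗ₜ[ℂ] CFun.pull (delta1 1) f + ind (-1) ⊗ₜ[ℂ] CFun.pull (delta1 (-1)) f :=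
  rfl

lemma delta2Star_apply (f : CFun Circle) :
    delta2Star f = CFun.pull (delta2 1) f ⊗ₜ[ℂ] ind 1 + CFun.pull (delta2 (-1)) f ⊗ₜ[ℂ] ind (-1) := rfl

lemma sigma1_neg (x : Toeplitz) : sigma1 (Toeplitz.neg x) = negZI (sigma1 x) := by
  have h1 : ∀ f : CFun Circle, CFun.pull (delta1 1) (negPull Circle f) =
      negPull UI (CFun.pull (delta1 (-1)) f) := fun f => by ext t; simp [delta1_neg_one]
  have h2 : ∀ f : CFun Circle, CFun.pull (delta1 (-1)) (negPull Circle f) =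
      negPull UI (CFun.pull (delta1 1) f) := fun f => by ext t; simp [delta1_one]
  change delta1Star (Toeplitz.symbol (Toeplitz.neg x)) = negZI (delta1Star (Toeplitz.symbol x))
  rw [Toeplitz.symbol_neg, delta1Star_apply, delta1Star_apply, h1, h2]
  rw [map_add, Algebra.TensorProduct.map_tmul, Algebra.TensorProduct.map_tmul, negPull_ind_one,
    negPull_ind_neg]
  exact add_comm _ _

lemma sigma2_neg (x : Toeplitz) : sigma2 (Toeplitz.neg x) = negIZ (sigma2 x) := by
  have h1 : ∀ f : CFun Circle, CFun.pull (delta2 1) (negPull Circle f) =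
      negPull UI (CFun.pull (delta2 (-1)) f) := fun f => by ext t; simp [delta2_neg_one]
  have h2 : ∀ f : CFun Circle, CFun.pull (delta2 (-1)) (negPull Circle f) =
      negPull UI (CFun.pull (delta2 1) f) := fun f => by ext t; simp [delta2_one]
  change delta2Star (Toeplitz.symbol (Toeplitz.neg x)) = negIZ (delta2Star (Toeplitz.symbol x))
  rw [Toeplitz.symbol_neg, delta2Star_apply, delta2Star_apply, h1, h2]
  rw [map_add, Algebra.TensorProduct.map_tmul, Algebra.TensorProduct.map_tmul, negPull_ind_one,
    negPull_ind_neg]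
  exact add_comm _ _

/-- The algebra `𝒯 ⊗ C(ℤ₂)`. -/
abbrev TZ : Type 1 := Toeplitz ⊗[ℂ] CZ2

/-- The diagonal involution of `𝒯 ⊗ C(ℤ₂)`. -/
def negTZ : TZ →ₐ[ℂ] TZ := Algebra.TensorProduct.map Toeplitz.neg.toAlgHom (negPull ℤˣ)

lemma negTZ_tmul (x : Toeplitz) (f : CZ2) :
    negTZ (x ⊗ₜ[ℂ] f) = Toeplitz.neg x ⊗ₜ[ℂ] negPull ℤˣ f := rfl

lemma negTZ_negTZ (x : TZ) : negTZ (negTZ x) = x := by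
  induction x using TensorProduct.induction_on with
  | zero => simp
  | tmul x f => simp [negTZ_tmul, negPull_negPull]
  | add x y hx hy => rw [map_add, map_add, hx, hy]

/-- The diagonal coaction of `C(ℤ₂)` on `𝒯 ⊗ C(ℤ₂)`. -/
def coactionTZ : Coaction ℂ CZ2 TZ := involutionCoaction negTZ negTZ_negTZ

/-- `coactionTZ` is the diagonal coaction `x ⊗ f ↦ x₀ ⊗ f₁ ⊗ x₁ f₂`. -/
lemma coactionTZ_tmul (x : Toeplitz) (f : CZ2) :
    coactionTZ.toAlgHom (x ⊗ₜ[ℂ] f) = (LinearMap.mul' ℂ CZ2).lTensor TZ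
      (TensorProduct.tensorTensorTensorComm ℂ Toeplitz CZ2 CZ2 CZ2
        (Toeplitz.coaction.toAlgHom x ⊗ₜ[ℂ] Coalgebra.comul (R := ℂ) f)) := by
  simp only [coactionTZ, Toeplitz.coaction, involutionCoaction_apply, comul_apply,
    TensorProduct.add_tmul, TensorProduct.tmul_add, map_add,
    TensorProduct.tensorTensorTensorComm_tmul, LinearMap.lTensor_tmul, LinearMap.mul'_apply,
    ind_mul_same, ind_one_mul, ind_neg_mul, TensorProduct.tmul_zero, negTZ_tmul]
  simp

/-- `Φ₀₁(h ⊗ p ⊗ k) = k ⊗ p ⊗ h`. -/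
def Phi01 : (CZ2 ⊗[ℂ] CI) ⊗[ℂ] CZ2 →ₐ[ℂ] (CZ2 ⊗[ℂ] CI) ⊗[ℂ] CZ2 :=
  (Algebra.TensorProduct.assoc ℂ ℂ ℂ CZ2 CI CZ2).symm.toAlgHom.comp
    ((Algebra.TensorProduct.comm ℂ (CI ⊗[ℂ] CZ2) CZ2).toAlgHom.comp
      (Algebra.TensorProduct.map (Algebra.TensorProduct.comm ℂ CZ2 CI).toAlgHom
        (AlgHom.id ℂ CZ2)))

/-- `Φ₀₂(h ⊗ p ⊗ k) = p ⊗ k ⊗ h`. -/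
def Phi02 : (CZ2 ⊗[ℂ] CI) ⊗[ℂ] CZ2 →ₐ[ℂ] (CI ⊗[ℂ] CZ2) ⊗[ℂ] CZ2 :=
  (Algebra.TensorProduct.comm ℂ CZ2 (CI ⊗[ℂ] CZ2)).toAlgHom.comp
    (Algebra.TensorProduct.assoc ℂ ℂ ℂ CZ2 CI CZ2).toAlgHom

/-- `Φ₁₂(p ⊗ h ⊗ k) = p ⊗ k ⊗ h`. -/
def Phi12 : (CI ⊗[ℂ] CZ2) ⊗[ℂ] CZ2 →ₐ[ℂ] (CI ⊗[ℂ] CZ2) ⊗[ℂ] CZ2 :=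
  (Algebra.TensorProduct.assoc ℂ ℂ ℂ CI CZ2 CZ2).symm.toAlgHom.comp
    ((Algebra.TensorProduct.map (AlgHom.id ℂ CI)
        (Algebra.TensorProduct.comm ℂ CZ2 CZ2).toAlgHom).comp
      (Algebra.TensorProduct.assoc ℂ ℂ ℂ CI CZ2 CZ2).toAlgHom)

@[simp] lemma Phi01_tmul (h : CZ2) (p : CI) (k : CZ2) :
    Phi01 ((h ⊗ₜ[ℂ] p) ⊗ₜ[ℂ] k) = (k ⊗ₜ[ℂ] p) ⊗ₜ[ℂ] h := rfl

@[simp] lemma Phi02_tmul (h : CZ2) (p : CI) (k : CZ2) :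
    Phi02 ((h ⊗ₜ[ℂ] p) ⊗ₜ[ℂ] k) = (p ⊗ₜ[ℂ] k) ⊗ₜ[ℂ] h := rfl

@[simp] lemma Phi12_tmul (p : CI) (h k : CZ2) :
    Phi12 ((p ⊗ₜ[ℂ] h) ⊗ₜ[ℂ] k) = (p ⊗ₜ[ℂ] k) ⊗ₜ[ℂ] h := rfl

/-- `σ₁ ⊗ id`. -/
def sigma1Id : TZ →ₐ[ℂ] (CZ2 ⊗[ℂ] CI) ⊗[ℂ] CZ2 :=
  Algebra.TensorProduct.map sigma1 (AlgHom.id ℂ CZ2)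

/-- `σ₂ ⊗ id`. -/
def sigma2Id : TZ →ₐ[ℂ] (CI ⊗[ℂ] CZ2) ⊗[ℂ] CZ2 :=
  Algebra.TensorProduct.map sigma2 (AlgHom.id ℂ CZ2)

/-- The diagonal involution of `(C(ℤ₂) ⊗ C(I)) ⊗ C(ℤ₂)`. -/
abbrev negZIZ : (CZ2 ⊗[ℂ] CI) ⊗[ℂ] CZ2 →ₐ[ℂ] (CZ2 ⊗[ℂ] CI) ⊗[ℂ] CZ2 :=
  Algebra.TensorProduct.map negZI (negPull ℤˣ)

/-- The diagonal involution of `(C(I) ⊗ C(ℤ₂)) ⊗ C(ℤ₂)`. -/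
abbrev negIZZ : (CI ⊗[ℂ] CZ2) ⊗[ℂ] CZ2 →ₐ[ℂ] (CI ⊗[ℂ] CZ2) ⊗[ℂ] CZ2 :=
  Algebra.TensorProduct.map negIZ (negPull ℤˣ)

lemma sigma1Id_neg (x : TZ) : sigma1Id (negTZ x) = negZIZ (sigma1Id x) := by
  induction x using TensorProduct.induction_on with
  | zero => simp
  | tmul x f => simp [negTZ_tmul, sigma1Id, sigma1_neg]
  | add x y hx hy => simp only [map_add, hx, hy]

lemma sigma2Id_neg (x : TZ) : sigma2Id (negTZ x) = negIZZ (sigma2Id x) := by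
  induction x using TensorProduct.induction_on with
  | zero => simp
  | tmul x f => simp [negTZ_tmul, sigma2Id, sigma2_neg]
  | add x y hx hy => simp only [map_add, hx, hy]

lemma Phi01_neg (x : (CZ2 ⊗[ℂ] CI) ⊗[ℂ] CZ2) :
    Phi01 (negZIZ x) = negZIZ (Phi01 x) := by
  induction x using TensorProduct.induction_on with
  | zero => simp
  | tmul y k =>
    induction y using TensorProduct.induction_on with
    | zero => simp
    | tmul a b => simp
    | add y z hy hz => rw [TensorProduct.add_tmul, map_add, map_add, map_add, map_add, hy, hz]
  | add x y hx hy => rw [map_add, map_add, map_add, map_add, hx, hy]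

lemma Phi02_neg (x : (CZ2 ⊗[ℂ] CI) ⊗[ℂ] CZ2) :
    Phi02 (negZIZ x) = negIZZ (Phi02 x) := by
  induction x using TensorProduct.induction_on with
  | zero => simp
  | tmul y k =>
    induction y using TensorProduct.induction_on with
    | zero => simp
    | tmul a b => simp
    | add y z hy hz => rw [TensorProduct.add_tmul, map_add, map_add, map_add, map_add, hy, hz]
  | add x y hx hy => rw [map_add, map_add, map_add, map_add, hx, hy]

lemma Phi12_neg (x : (CI ⊗[ℂ] CZ2) ⊗[ℂ] CZ2) :
    Phi12 (negIZZ x) = negIZZ (Phi12 x) := by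
  induction x using TensorProduct.induction_on with
  | zero => simp
  | tmul y k =>
    induction y using TensorProduct.induction_on with
    | zero => simp
    | tmul a b => simp
    | add y z hy hz => rw [TensorProduct.add_tmul, map_add, map_add, map_add, map_add, hy, hz]
  | add x y hx hy => rw [map_add, map_add, map_add, map_add, hx, hy]

/-- The ambient algebra of the pullback of the first two pieces. -/
abbrev TZ2 : Type 1 := TZ × TZ

/-- The ambient algebra of the triple pullback. -/
abbrev TZ3 : Type 1 := TZ × TZ × TZ

/-- The pullback of the pieces `𝒯₀ ⊗ C(ℤ₂)` and `𝒯₁ ⊗ C(ℤ₂)`. -/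
def P01 : Subalgebra ℂ TZ2 :=
  AlgHom.equalizer (sigma1Id.comp (AlgHom.fst ℂ TZ TZ))
    ((Phi01.comp sigma1Id).comp (AlgHom.snd ℂ TZ TZ))

lemma mem_P01 (x : TZ2) : x ∈ P01 ↔ sigma1Id x.1 = Phi01 (sigma1Id x.2) := Iff.rfl

/-- The projections of `(𝒯 ⊗ C(ℤ₂))³`. -/
def proj : Fin 3 → (TZ3 →ₐ[ℂ] TZ) :=
  ![AlgHom.fst ℂ TZ TZ2, (AlgHom.fst ℂ TZ TZ).comp (AlgHom.snd ℂ TZ TZ2),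
    (AlgHom.snd ℂ TZ TZ).comp (AlgHom.snd ℂ TZ TZ2)]

/-- The quantum sphere `C(S²_{ℝ𝒯})`: the triple pullback
`{(x₀, x₁, x₂) | (σ₁ ⊗ id)(x₀) = Φ₀₁((σ₁ ⊗ id)(x₁)), (σ₂ ⊗ id)(x₀) = Φ₀₂((σ₁ ⊗ id)(x₂)),
(σ₂ ⊗ id)(x₁) = Φ₁₂((σ₂ ⊗ id)(x₂))}`. -/
def Sphere : Subalgebra ℂ TZ3 :=
  AlgHom.equalizer (sigma1Id.comp (proj 0)) ((Phi01.comp sigma1Id).comp (proj 1)) ⊓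
  AlgHom.equalizer (sigma2Id.comp (proj 0)) ((Phi02.comp sigma1Id).comp (proj 2)) ⊓
  AlgHom.equalizer (sigma2Id.comp (proj 1)) ((Phi12.comp sigma2Id).comp (proj 2))

lemma mem_Sphere (x : TZ3) : x ∈ Sphere ↔ sigma1Id x.1 = Phi01 (sigma1Id x.2.1) ∧
    sigma2Id x.1 = Phi02 (sigma1Id x.2.2) ∧ sigma2Id x.2.1 = Phi12 (sigma2Id x.2.2) :=
  and_assoc

/-- The componentwise involution. -/
def neg2 : TZ2 →ₐ[ℂ] TZ2 :=
  (negTZ.comp (AlgHom.fst ℂ TZ TZ)).prod (negTZ.comp (AlgHom.snd ℂ TZ TZ))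

@[simp] lemma neg2_apply (x : TZ2) : neg2 x = (negTZ x.1, negTZ x.2) := rfl

/-- The componentwise involution. -/
def neg3 : TZ3 →ₐ[ℂ] TZ3 :=
  (negTZ.comp (AlgHom.fst ℂ TZ TZ2)).prod (neg2.comp (AlgHom.snd ℂ TZ TZ2))

@[simp] lemma neg3_apply (x : TZ3) : neg3 x = (negTZ x.1, negTZ x.2.1, negTZ x.2.2) := rfl

lemma neg2_mem (x : TZ2) (hx : x ∈ P01) : neg2 x ∈ P01 := by
  rw [mem_P01] at *
  rw [neg2_apply, sigma1Id_neg, sigma1Id_neg, Phi01_neg, hx]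

lemma neg3_mem (x : TZ3) (hx : x ∈ Sphere) : neg3 x ∈ Sphere := by
  rw [mem_Sphere] at *
  obtain ⟨h1, h2, h3⟩ := hx
  rw [neg3_apply]
  simp only [sigma1Id_neg, sigma2Id_neg, Phi01_neg, Phi02_neg, Phi12_neg]
  rw [h1, h2, h3]
  exact ⟨rfl, rfl, rfl⟩

/-- The componentwise coaction on `P01`. -/
def coactionP01 : Coaction ℂ CZ2 P01 :=
  involutionCoaction ((neg2.comp P01.val).codRestrict P01 fun x => neg2_mem x x.2)
    fun p => Subtype.ext (by
      change neg2 (neg2 (p : TZ2)) = p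
      simp [negTZ_negTZ])

/-- The componentwise coaction on the quantum sphere. -/
def coactionSphere : Coaction ℂ CZ2 Sphere :=
  involutionCoaction ((neg3.comp Sphere.val).codRestrict Sphere fun x => neg3_mem x x.2)
    fun p => Subtype.ext (by
      change neg3 (neg3 (p : TZ3)) = p
      simp [negTZ_negTZ])

/-- The coaction on the sphere is componentwise: the projections on the pieces are colinear. -/
lemma isColinear_proj (i : Fin 3) : IsColinear coactionSphere coactionTZ
    ((proj i).comp Sphere.val).toLinearMap := by
  intro p
  have h : ∀ x : TZ3, negTZ (proj i x) = proj i (neg3 x) := by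
    intro x
    fin_cases i <;> rfl
  simp only [coactionSphere, coactionTZ, involutionCoaction_apply, map_add,
    LinearMap.rTensor_tmul, AlgHom.toLinearMap_apply, AlgHom.comp_apply, h]
  rfl

/-- The identification of the sphere with the iterated pullback of `𝒯₂ ⊗ C(ℤ₂)` and `P01`,
`(x₀, x₁, x₂) ↦ (x₂, (x₀, x₁))`. -/
def toIterated : Sphere →ₐ[ℂ] TZ × P01 :=
  ((proj 2).comp Sphere.val).prod
    ((((proj 0).prod (proj 1)).comp Sphere.val).codRestrict P01 fun x => ((mem_Sphere x).1 x.2).1)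

@[simp] lemma toIterated_apply (x : Sphere) :
    (toIterated x).1 = x.1.2.2 ∧ ((toIterated x).2 : TZ2) = (x.1.1, x.1.2.1) := ⟨rfl, rfl⟩

/-- The gluing map `β₁(x) = (Φ₀₂((σ₁ ⊗ id)(x)), Φ₁₂((σ₂ ⊗ id)(x)))` of the iterated pullback. -/
def beta1 : TZ →ₐ[ℂ] ((CI ⊗[ℂ] CZ2) ⊗[ℂ] CZ2) × ((CI ⊗[ℂ] CZ2) ⊗[ℂ] CZ2) :=
  (Phi02.comp sigma1Id).prod (Phi12.comp sigma2Id)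

/-- The gluing map `β₂(x, y) = ((σ₂ ⊗ id)(x), (σ₂ ⊗ id)(y))` of the iterated pullback. -/
def beta2 : P01 →ₐ[ℂ] ((CI ⊗[ℂ] CZ2) ⊗[ℂ] CZ2) × ((CI ⊗[ℂ] CZ2) ⊗[ℂ] CZ2) :=
  ((sigma2Id.comp (AlgHom.fst ℂ TZ TZ)).prod (sigma2Id.comp (AlgHom.snd ℂ TZ TZ))).comp P01.val

/-- The sphere is the fibre product of `β₁` and `β₂`. -/
lemma range_toIterated (y : TZ × P01) : (∃ x, toIterated x = y) ↔ beta1 y.1 = beta2 y.2 := by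
  constructor
  · rintro ⟨x, rfl⟩
    have h := (mem_Sphere x).1 x.2
    exact Prod.ext h.2.1.symm h.2.2.symm
  · intro h
    have h1 : Phi02 (sigma1Id y.1) = sigma2Id y.2.1.1 := congrArg Prod.fst h
    have h2 : Phi12 (sigma2Id y.1) = sigma2Id y.2.1.2 := congrArg Prod.snd h
    exact ⟨⟨(y.2.1.1, y.2.1.2, y.1), (mem_Sphere _).2 ⟨y.2.2, h1.symm, h2.symm⟩⟩, rfl⟩

/-- The elements `φ₁, φ₂ ∈ 𝒯` are odd and satisfy `σ₁(φ₁) = u ⊗ 1`, `σ₂(φ₁) = ι ⊗ 1`,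
`σ₂(φ₂) = 1 ⊗ u`, `σ₁(φ₂) = 1 ⊗ ι`. -/
structure IsPhiPair (φ₁ φ₂ : Toeplitz) : Prop where
  odd₁ : Toeplitz.coaction.toAlgHom φ₁ = φ₁ ⊗ₜ[ℂ] genU
  odd₂ : Toeplitz.coaction.toAlgHom φ₂ = φ₂ ⊗ₜ[ℂ] genU
  sigma1_fst : sigma1 φ₁ = genU ⊗ₜ[ℂ] 1
  sigma2_fst : sigma2 φ₁ = iotaI ⊗ₜ[ℂ] 1
  sigma2_snd : sigma2 φ₂ = 1 ⊗ₜ[ℂ] genU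
  sigma1_snd : sigma1 φ₂ = 1 ⊗ₜ[ℂ] iotaI

/-- `span {1 ⊗ 1, 1 ⊗ u}` in `𝒯 ⊗ C(ℤ₂)`. -/
def legSpan : Submodule ℂ TZ := Submodule.span ℂ {1, 1 ⊗ₜ[ℂ] genU}

/-- The element `1 ⊗ 1` of `legSpan`. -/
def legOne : legSpan := ⟨1, Submodule.subset_span (by simp)⟩

/-- The element `1 ⊗ u` of `legSpan`. -/
def legU : legSpan := ⟨1 ⊗ₜ[ℂ] genU, Submodule.subset_span (by simp)⟩

end QSphere

end

noncomputable section

namespace QSphere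

/-! ### Linear maps on `C(ℤ₂)` -/

/-! The Hopf algebra `C(ℤ₂)` has the basis `1`, `u` of group-like elements, and all coactions here
come from involutions. A unital `ℓ` is therefore fixed by `ℓ(u) = ∑ l_i ⊗ r_i`, and it is a strong
connection as soon as all legs are odd and `∑ l_i r_i = 1` (`isStrongConnection_of_odd`). The same
identity makes `(r_i l_j)` an idempotent representing the module of odd elements
(`exists_projector_lineBundle`).

On the sphere there are three odd elements `γ_i` whose `i`-th component is `1 ⊗ u`. As `u² = 1`, the
defect `1 - γ_i²` vanishes in that component, so a product of all three defects, in any order, is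
zero. Expanding such a product as a telescoping sum writes `1` as a sum of odd times odd elements.
Putting the defects on the left gives Method I (`telescope_left`), on the right Method II
(`telescope_right`). The gluing formulas return these sums because at `u` every comultiplication is
diagonal, and at `1` every defect vanishes.

The formulas also need colinear splittings with prescribed values. Over a field one starts from any
linear section, corrects it on the prescribed elements by a map into the kernel, and averages over
the involution (`exists_isGluingMap`). The images of the gluing maps must also be compared. The four
arcs of the circle are the sides of a square, and functions on the sides that agree at the corners
lift to `𝒯` (`exists_side_eq`), by interpolation with the coordinate elements `absc` and `ord`,
which are functional calculi of the real and imaginary parts of `s`.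

The pair `(absc, ord)` is admissible. Adding integral multiples of an odd self-adjoint element `K`
in the kernel of the symbol with `K⁴ ≠ 0` makes the product of the two defects nonzero
(`exists_perturbation_mul_ne_zero`). Linear independence of the legs is triangular in the three
components, or is tested by evaluating at the corners of the square. -/

lemma CZ2.eq_one_genU (f : CZ2) :
    f = ((f 1 + f (-1)) / 2) • (1 : CZ2) + ((f 1 - f (-1)) / 2) • genU := by
  ext k
  rcases Int.units_eq_one_or k with rfl | rfl <;> simp <;> ring

/-- The reduction used throughout: an identity between linear maps on `C(ℤ₂)` only has to be checked
on the two group-likes. -/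
lemma CZ2.linearMap_ext {M : Type*} [AddCommMonoid M] [Module ℂ M] {f g : CZ2 →ₗ[ℂ] M}
    (h1 : f 1 = g 1) (hu : f genU = g genU) : f = g := by
  ext1 h
  rw [CZ2.eq_one_genU h, map_add, map_add, map_smul, map_smul, map_smul, map_smul, h1, hu]

/-- The linear map on `C(ℤ₂)` with prescribed values at `1` and `u`. -/
def ofOneGenU {M : Type*} [AddCommGroup M] [Module ℂ M] (a b : M) : CZ2 →ₗ[ℂ] M where
  toFun f := ((f 1 + f (-1)) / 2) • a + ((f 1 - f (-1)) / 2) • b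
  map_add' f g := by simp only [CFun.add_apply]; module
  map_smul' c f := by simp only [CFun.smul_apply, RingHom.id_apply]; module

@[simp] lemma ofOneGenU_one {M : Type*} [AddCommGroup M] [Module ℂ M] (a b : M) :
    ofOneGenU a b 1 = a := by
  simp [ofOneGenU]

@[simp] lemma ofOneGenU_genU {M : Type*} [AddCommGroup M] [Module ℂ M] (a b : M) :
    ofOneGenU a b genU = b := by
  simp [ofOneGenU]

@[simp] lemma negPull_genU : negPull ℤˣ genU = -genU := by ext k; simp

@[simp] lemma genU_mul_genU : genU * genU = 1 := by
  ext k
  rcases Int.units_eq_one_or k with rfl | rfl <;> simp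

lemma comul_one : Coalgebra.comul (R := ℂ) (1 : CZ2) = 1 ⊗ₜ[ℂ] 1 := by
  rw [comul_apply, map_one, ← TensorProduct.tmul_add, ind_add]

lemma comul_genU : Coalgebra.comul (R := ℂ) genU = genU ⊗ₜ[ℂ] genU := by
  rw [comul_apply, negPull_genU, TensorProduct.neg_tmul, ← sub_eq_add_neg,
    ← TensorProduct.tmul_sub, ← genU_eq]

lemma counit_genU : Coalgebra.counit (R := ℂ) genU = 1 := by
  simp [counit_apply]

lemma antipode_eq (f : CZ2) : HopfAlgebra.antipode ℂ f = f := antipodeZ2_apply f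

/-! ### Comodule algebras given by an involution -/

section Involution

variable {P : Type*} [Ring P] [Algebra ℂ P] (τ : P →ₐ[ℂ] P) (hτ : ∀ p, τ (τ p) = p)

lemma involutionCoaction_one : (involutionCoaction τ hτ).toAlgHom 1 = 1 ⊗ₜ[ℂ] 1 := by
  rw [map_one, Algebra.TensorProduct.one_def]

lemma involutionCoaction_eq_tmul_genU_iff (p : P) :
    (involutionCoaction τ hτ).toAlgHom p = p ⊗ₜ[ℂ] genU ↔ τ p = -p := by
  refine ⟨fun h => ?_, involutionCoaction_odd τ hτ p⟩
  -- The functional with `1 ↦ 1` and `u ↦ -1` is evaluation at `-1`. Applied to the second leg it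
  -- extracts `τ p` from the coaction.
  have h2 := congrArg (fun w => TensorProduct.rid ℂ P
    ((ofOneGenU (1 : ℂ) (-1)).lTensor P w)) h
  have e1 : ofOneGenU (1 : ℂ) (-1) (ind 1) = 0 := by simp [ofOneGenU]
  have e2 : ofOneGenU (1 : ℂ) (-1) (ind (-1)) = 1 := by simp [ofOneGenU]; norm_num
  simpa [e1, e2] using h2

lemma mem_coinvariants_iff (p : P) :
    p ∈ (involutionCoaction τ hτ).coinvariants ↔ τ p = p := by
  change (involutionCoaction τ hτ).toAlgHom p = p ⊗ₜ[ℂ] 1 ↔ _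
  constructor
  · intro h
    have h2 := congrArg (fun w => TensorProduct.rid ℂ P
      ((ofOneGenU (1 : ℂ) (-1)).lTensor P w)) h
    have e1 : ofOneGenU (1 : ℂ) (-1) (ind 1) = 0 := by simp [ofOneGenU]
    have e2 : ofOneGenU (1 : ℂ) (-1) (ind (-1)) = 1 := by simp [ofOneGenU]; norm_num
    simpa [e1, e2] using h2
  · intro h
    rw [involutionCoaction_apply, h, ← TensorProduct.tmul_add, ind_add]

lemma mem_lineBundle_iff (p : P) :
    p ∈ (involutionCoaction τ hτ).lineBundle genU ↔ τ p = -p :=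
  involutionCoaction_eq_tmul_genU_iff τ hτ p

lemma map_one_sub_sq_of_odd {τ : P →ₐ[ℂ] P} {x : P} (hx : τ x = -x) :
    τ (1 - x * x) = 1 - x * x := by
  rw [map_sub, map_mul, map_one, hx, neg_mul_neg]

lemma map_mul_of_even_of_odd {τ : P →ₐ[ℂ] P} {x y : P} (hx : τ x = x) (hy : τ y = -y) :
    τ (x * y) = -(x * y) := by
  rw [map_mul, hx, hy, mul_neg]

lemma map_mul_of_odd_of_even {τ : P →ₐ[ℂ] P} {x y : P} (hx : τ x = -x) (hy : τ y = y) :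
    τ (x * y) = -(x * y) := by
  rw [map_mul, hx, hy, neg_mul]

lemma map_mul_of_even_of_even {τ : P →ₐ[ℂ] P} {x y : P} (hx : τ x = x) (hy : τ y = y) :
    τ (x * y) = x * y := by
  rw [map_mul, hx, hy]

/-- A unital map whose value at `u` is a sum of tensors of odd elements that multiplies to `1`
is a strong connection. -/
theorem isStrongConnection_of_odd {ι : Type*} [Fintype ι] {l r : ι → P}
    (hl : ∀ i, τ (l i) = -l i) (hr : ∀ i, τ (r i) = -r i) (hlr : ∑ i, l i * r i = 1)
    {ℓ : CZ2 →ₗ[ℂ] P ⊗[ℂ] P} (h1 : ℓ 1 = 1 ⊗ₜ[ℂ] 1) (hu : ℓ genU = ∑ i, l i ⊗ₜ[ℂ] r i) :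
    IsStrongConnection (involutionCoaction τ hτ) ℓ where
  unital := h1
  collapse h := by
    -- Each axiom is recast as an equality of linear maps in `h`, so that it can be tested at `1`
    -- and `u` only.
    refine DFunLike.congr_fun (f := LinearMap.mul' ℂ P ∘ₗ ℓ)
      (g := Algebra.linearMap ℂ P ∘ₗ Coalgebra.counit) (CZ2.linearMap_ext ?_ ?_) h
    · simp [h1]
    · simp [hu, hlr, counit_genU]
  right_colinear h := by
    refine DFunLike.congr_fun
      (f := (TensorProduct.assoc ℂ P P CZ2).toLinearMap ∘ₗ ℓ.rTensor CZ2 ∘ₗ Coalgebra.comul)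
      (g := (involutionCoaction τ hτ).toAlgHom.toLinearMap.lTensor P ∘ₗ ℓ)
      (CZ2.linearMap_ext ?_ ?_) h
    · simp only [LinearMap.comp_apply, comul_one, LinearMap.rTensor_tmul, h1, LinearEquiv.coe_coe,
        TensorProduct.assoc_tmul, LinearMap.lTensor_tmul, AlgHom.toLinearMap_apply,
        involutionCoaction_one]
    · simp [hu, comul_genU, TensorProduct.sum_tmul, involutionCoaction_odd τ hτ _ (hr _),
        -involutionCoaction_apply]
  left_colinear h := by
    refine DFunLike.congr_fun
      (f := TensorProduct.map (HopfAlgebra.antipode ℂ) ℓ ∘ₗ Coalgebra.comul)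
      (g := (TensorProduct.assoc ℂ CZ2 P P).toLinearMap ∘ₗ
        (((TensorProduct.comm ℂ P CZ2).toLinearMap ∘ₗ
          (involutionCoaction τ hτ).toAlgHom.toLinearMap).rTensor P) ∘ₗ ℓ)
      (CZ2.linearMap_ext ?_ ?_) h
    · simp only [LinearMap.comp_apply, comul_one, TensorProduct.map_tmul, antipode_eq, h1,
        LinearMap.rTensor_tmul, AlgHom.toLinearMap_apply, involutionCoaction_one,
        LinearEquiv.coe_coe, TensorProduct.comm_tmul, TensorProduct.assoc_tmul]
    · simp only [LinearMap.comp_apply, comul_genU, TensorProduct.map_tmul, antipode_eq, hu,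
        LinearMap.rTensor_tmul, AlgHom.toLinearMap_apply, involutionCoaction_odd τ hτ _ (hl _),
        LinearEquiv.coe_coe, TensorProduct.comm_tmul, TensorProduct.assoc_tmul, map_sum,
        TensorProduct.tmul_sum]

/-- An equivariant linear map is colinear. -/
lemma isColinear_involutionCoaction {P' : Type*} [Ring P'] [Algebra ℂ P'] (τ' : P' →ₐ[ℂ] P')
    (hτ' : ∀ p, τ' (τ' p) = p) {f : P →ₗ[ℂ] P'} (hf : ∀ p, f (τ p) = τ' (f p)) :
    IsColinear (involutionCoaction τ hτ) (involutionCoaction τ' hτ') f := by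
  intro p
  simp [hf]

/-- The projector with entries `r i * l j`, where `∑ i, l i * r i = 1` with odd `l i` and `r i`,
represents the line bundle of odd elements. -/
theorem exists_projector_lineBundle {n : ℕ} {l r : Fin n → P}
    (hl : ∀ i, τ (l i) = -l i) (hr : ∀ i, τ (r i) = -r i) (hlr : ∑ i, l i * r i = 1) :
    ∃ p : Matrix (Fin n) (Fin n) (involutionCoaction τ hτ).coinvariants,
      (∀ i j, (p i j : P) = r i * l j) ∧ p * p = p ∧
      Nonempty ((involutionCoaction τ hτ).lineBundle genU
        ≃ₗ[(involutionCoaction τ hτ).coinvariants] LinearMap.range p.vecMulLinear) := by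
  have hmem : ∀ x y : P, τ x = -x → τ y = -y → x * y ∈ (involutionCoaction τ hτ).coinvariants := by
    intro x y hx hy
    rw [mem_coinvariants_iff, map_mul, hx, hy, neg_mul_neg]
  let p : Matrix (Fin n) (Fin n) (involutionCoaction τ hτ).coinvariants :=
    Matrix.of fun i j => ⟨r i * l j, hmem _ _ (hr i) (hl j)⟩
  have hp : ∀ i j, (p i j : P) = r i * l j := fun _ _ => rfl
  -- This reconstruction formula shows that `x ↦ (x l_j)_j` is injective, that its values are fixed
  -- by `p`, and that `p` is idempotent.
  have key : ∀ x : P, ∑ j, x * l j * r j = x := fun x => by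
    simp only [mul_assoc, ← Finset.mul_sum, hlr, mul_one]
  let toB : (involutionCoaction τ hτ).lineBundle genU →ₗ[(involutionCoaction τ hτ).coinvariants]
      (Fin n → (involutionCoaction τ hτ).coinvariants) :=
    { toFun := fun x j => ⟨x * l j, hmem _ _ ((mem_lineBundle_iff τ hτ x).1 x.2) (hl j)⟩
      map_add' := fun x y => by
        ext j
        exact add_mul (x : P) y (l j)
      map_smul' := fun c x => by
        ext j
        exact mul_assoc (c : P) x (l j) }
  have htoB : ∀ x j, (toB x j : P) = x * l j := fun _ _ => rfl
  have hvec : ∀ (v : Fin n → (involutionCoaction τ hτ).coinvariants) (j : Fin n),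
      (p.vecMulLinear v j : P) = (∑ i, (v i : P) * r i) * l j := by
    intro v j
    simp [Matrix.vecMul, dotProduct, hp, Finset.sum_mul, mul_assoc]
  have hrange : LinearMap.range toB = LinearMap.range p.vecMulLinear := by
    apply le_antisymm
    · rintro _ ⟨x, rfl⟩
      refine ⟨toB x, ?_⟩
      ext j
      rw [hvec]
      simp only [htoB, key]
    -- A vector `v p` comes from the odd element `∑ v_i r_i`; it is odd since the `v_i` are
    -- coinvariant.
    · rintro _ ⟨v, rfl⟩
      refine ⟨⟨∑ i, (v i : P) * r i, ?_⟩, ?_⟩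
      · rw [mem_lineBundle_iff, map_sum, ← Finset.sum_neg_distrib]
        refine Finset.sum_congr rfl fun i _ => ?_
        rw [map_mul, (mem_coinvariants_iff τ hτ _).1 (v i).2, hr, mul_neg]
      · ext j
        rw [hvec, htoB]
  have hinj : Function.Injective toB := by
    intro x y hxy
    ext
    rw [← key x, ← key y]
    refine Finset.sum_congr rfl fun j _ => ?_
    rw [← htoB, ← htoB, hxy]
  refine ⟨p, hp, ?_, ⟨(LinearEquiv.ofInjective toB hinj).trans (LinearEquiv.ofEq _ _ hrange)⟩⟩
  ext i j
  have : ((p * p) i j : P) = ∑ k, r i * l k * (r k * l j) := by simp [Matrix.mul_apply, hp]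
  rw [this, hp]
  simp only [← mul_assoc]
  rw [← Finset.sum_mul, key]

end Involution

/-- Linear splittings over the image of `π` may be chosen colinear and with prescribed values on
a linearly independent family of homogeneous elements. -/
theorem exists_isGluingMap {P₁ P₂ Q : Type*} [Ring P₁] [Algebra ℂ P₁] [Ring P₂] [Algebra ℂ P₂]
    [Ring Q] [Algebra ℂ Q] {τ₁ : P₁ →ₐ[ℂ] P₁} (hτ₁ : ∀ p, τ₁ (τ₁ p) = p)
    {τ₂ : P₂ →ₐ[ℂ] P₂} (hτ₂ : ∀ p, τ₂ (τ₂ p) = p) (τ : Q →ₐ[ℂ] Q)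
    {π : P₁ →ₐ[ℂ] Q} {π' : P₂ →ₐ[ℂ] Q} (hπ : ∀ p, π (τ₁ p) = τ (π p))
    (hπ' : ∀ p, π' (τ₂ p) = τ (π' p)) (hrange : π.range ≤ π'.range)
    {ι : Type*} (x : ι → P₁) (y : ι → P₂) (hxy : ∀ i, π' (y i) = π (x i))
    (hx : ∀ i, τ₁ (x i) = -x i) (hy : ∀ i, τ₂ (y i) = -y i)
    (hind : LinearIndependent ℂ fun i => π (x i)) (hone : (1 : Q) ≠ 0) :
    ∃ f : P₁ →ₗ[ℂ] P₂,
      IsGluingMap (involutionCoaction τ₁ hτ₁) (involutionCoaction τ₂ hτ₂) π π' f ∧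
      ∀ i, f (x i) = y i := by
  -- Start from an arbitrary linear section of `π'`; neither its values nor its behaviour under the
  -- involution are controlled yet.
  obtain ⟨σ, hσ⟩ := π'.toLinearMap.rangeRestrict.exists_rightInverse_of_surjective
    (LinearMap.range_rangeRestrict _)
  have hσ' : ∀ q : LinearMap.range π'.toLinearMap, π' (σ q) = q := fun q =>
    congrArg Subtype.val (DFunLike.congr_fun hσ q)
  let σ₀ : π.range →ₗ[ℂ] P₂ := σ ∘ₗ
    (π.range.val.toLinearMap.codRestrict (LinearMap.range π'.toLinearMap) fun q => hrange q.2)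
  have hσ₀ : ∀ q, π' (σ₀ q) = q := fun q => hσ' _
  -- The index `none` adds the condition `1 ↦ 1` to the prescribed values.
  let z : Option ι → π.range := fun o => o.elim 1 fun i => π.rangeRestrict (x i)
  let w : Option ι → P₂ := fun o => o.elim 1 y
  have hzw : ∀ o, π' (w o) = z o := by
    rintro (_ | i)
    · exact map_one π'
    · exact hxy i
  have hz : LinearIndependent ℂ z := by
    have h0 : LinearIndependent ℂ fun i => π.rangeRestrict (x i) :=
      LinearIndependent.of_comp π.range.val.toLinearMap hind
    rw [linearIndependent_option]
    refine ⟨h0, fun hmem => hone ?_⟩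
    -- The other prescribed elements span odd elements only, while `1` is even. If `1` lay in their
    -- span, then `2 • 1 = 0`.
    have hodd : ∀ q ∈ Submodule.span ℂ (Set.range fun i => π.rangeRestrict (x i)),
        τ (q : Q) = -(q : Q) := by
      intro q hq
      induction hq using Submodule.span_induction with
      | mem q hq =>
        obtain ⟨i, rfl⟩ := hq
        change τ (π (x i)) = -π (x i)
        rw [← hπ, hx, map_neg]
      | zero => simp
      | add a b _ _ ha hb => simp [ha, hb, add_comm]
      | smul c a _ ha => simp [ha]
    have h1 : τ (1 : Q) = -1 := hodd _ hmem
    rw [map_one] at h1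
    have h2 : (2 : ℂ) • (1 : Q) = 0 := by rw [two_smul]; nth_rewrite 1 [h1]; simp
    exact (smul_eq_zero.1 h2).resolve_left two_ne_zero
  have hc : ∀ o, w o - σ₀ (z o) ∈ LinearMap.ker π'.toLinearMap := by
    intro o
    simp [hzw, hσ₀]
  -- The error of the section on the independent family lies in the kernel of `π'`. Extending it
  -- linearly with values in that kernel corrects the section without losing the splitting property.
  obtain ⟨c, hc'⟩ := LinearMap.exists_extend
    ((Module.Basis.span hz).constr ℂ fun o => (⟨w o - σ₀ (z o), hc o⟩ : LinearMap.ker π'.toLinearMap))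
  have hcz : ∀ o, (c (z o) : P₂) = w o - σ₀ (z o) := by
    intro o
    have h := DFunLike.congr_fun hc' (Module.Basis.span hz o)
    rw [LinearMap.comp_apply, Module.Basis.constr_basis, Submodule.subtype_apply,
      Module.Basis.span_apply] at h
    rw [h]
  let μ₀ : π.range →ₗ[ℂ] P₂ := σ₀ + (LinearMap.ker π'.toLinearMap).subtype ∘ₗ c
  have hμ₀z : ∀ o, μ₀ (z o) = w o := fun o => by
    change σ₀ (z o) + (c (z o) : P₂) = w o
    rw [hcz]
    abel
  have hμ₀ : ∀ q, π' (μ₀ q) = q := fun q => by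
    change π' (σ₀ q + (c q : P₂)) = q
    rw [map_add, hσ₀, show π' (c q : P₂) = 0 from (c q).2, add_zero]
  let ρ : π.range →ₗ[ℂ] π.range := (τ.comp π.range.val).toLinearMap.codRestrict
    (Subalgebra.toSubmodule π.range) (by rintro ⟨_, p, rfl⟩; exact ⟨τ₁ p, hπ p⟩)
  have hρπ : ∀ p, ρ (π.rangeRestrict p) = π.rangeRestrict (τ₁ p) := fun p =>
    Subtype.ext (hπ p).symm
  have hρ : ∀ q, ρ (ρ q) = q := by
    rintro ⟨_, p, rfl⟩
    change ρ (ρ (π.rangeRestrict p)) = π.rangeRestrict p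
    rw [hρπ, hρπ, hτ₁]
  -- Averaging over the involution gives equivariance. The prescribed values survive because each
  -- prescribed element and its target have the same parity.
  let μ : π.range →ₗ[ℂ] P₂ := (1 / 2 : ℂ) • (μ₀ + τ₂.toLinearMap ∘ₗ μ₀ ∘ₗ ρ)
  have hμ : ∀ q, μ q = (1 / 2 : ℂ) • (μ₀ q + τ₂ (μ₀ (ρ q))) := fun _ => rfl
  have half : ∀ p : P₂, (1 / 2 : ℂ) • (p + p) = p := fun p => by module
  refine ⟨μ ∘ₗ π.rangeRestrict.toLinearMap, ⟨?_, ?_, μ, ?_, fun _ => rfl⟩, fun i => ?_⟩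
  · have h1 : ρ (π.rangeRestrict 1) = π.rangeRestrict 1 := by rw [hρπ, map_one τ₁]
    change μ (π.rangeRestrict 1) = 1
    rw [hμ, h1, map_one, show (1 : π.range) = z none from rfl, hμ₀z]
    change (1 / 2 : ℂ) • ((1 : P₂) + τ₂ 1) = 1
    rw [map_one, half]
  · refine isColinear_involutionCoaction _ _ _ _ fun p => ?_
    change μ (π.rangeRestrict (τ₁ p)) = τ₂ (μ (π.rangeRestrict p))
    rw [← hρπ, hμ, hμ, hρ, map_smul, map_add, hτ₂, add_comm]
  · rintro ⟨_, p, rfl⟩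
    change π' (μ (π.rangeRestrict p)) = π p
    rw [hμ, map_smul, map_add, hμ₀, hπ', hμ₀, hρπ]
    change (1 / 2 : ℂ) • (π p + τ (π (τ₁ p))) = π p
    rw [← hπ, hτ₁]
    module
  · change μ (z (some i)) = y i
    have h1 : ρ (z (some i)) = -z (some i) := by
      change ρ (π.rangeRestrict (x i)) = -π.rangeRestrict (x i)
      rw [hρπ, hx, map_neg]
    rw [hμ, h1, map_neg, hμ₀z, map_neg]
    change (1 / 2 : ℂ) • (y i + -τ₂ (y i)) = y i
    rw [hy, neg_neg, half]

/-! ### Symbols -/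

namespace Toeplitz

lemma symbol_apply_star (x : Toeplitz) (z : Circle) : symbol (star x) z = star (symbol x z) :=
  congrArg (fun f : C(Circle, ℂ) => f z) (map_star symbolStar x)

/-- The symbol followed by evaluation at a point is a continuous `*`-homomorphism to `ℂ`, hence
commutes with functional calculus, which on `ℂ` is plain evaluation of `f`. -/
lemma symbol_cfc (f : ℂ → ℂ) (hf : Continuous f) (a : Toeplitz) [IsStarNormal a] (z : Circle) :
    symbol (cfc f a) z = f (symbol a z) := by
  let χ : Toeplitz →⋆ₐ[ℂ] ℂ := (ContinuousMap.evalStarAlgHom ℂ ℂ z).comp symbolStar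
  have h := χ.map_cfc f a hf.continuousOn (continuous_hom χ) inferInstance inferInstance
  have h2 : cfc f (χ a) = f (χ a) := cfc_algebraMap (A := ℂ) (χ a) f
  exact h.trans h2

lemma neg_cfc_of_odd (f : ℂ → ℂ) (hf : Continuous f) (hodd : ∀ z, f (-z) = -f z) (a : Toeplitz)
    [IsStarNormal a] (ha : neg a = -a) : neg (cfc f a) = -cfc f a := by
  have hn : IsStarNormal (neg a) := by rw [ha]; infer_instance
  rw [neg.map_cfc f a hf.continuousOn (continuous_hom neg) ‹IsStarNormal a› hn, ha,
    ← cfc_comp_neg (p := IsStarNormal) f a hf.continuousOn, ← cfc_neg]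
  simp only [hodd]

/-- The real part of the generating isometry. -/
def reGen : Toeplitz := (1 / 2 : ℂ) • (s + star s)

/-- The imaginary part of the generating isometry. -/
def imGen : Toeplitz := (-Complex.I / 2) • (s - star s)

lemma isSelfAdjoint_reGen : IsSelfAdjoint reGen := by
  rw [isSelfAdjoint_iff, reGen, star_smul, star_add, star_star, add_comm (star s)]
  simp

lemma isSelfAdjoint_imGen : IsSelfAdjoint imGen := by
  rw [isSelfAdjoint_iff, imGen, star_smul, star_sub, star_star, ← neg_sub s, smul_neg, ← neg_smul]
  simp [neg_div]

instance : IsStarNormal reGen := isSelfAdjoint_reGen.isStarNormal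

instance : IsStarNormal imGen := isSelfAdjoint_imGen.isStarNormal

lemma neg_reGen : neg reGen = -reGen := by
  rw [reGen, map_smul, map_add, map_star, neg_s, star_neg]
  module

lemma neg_imGen : neg imGen = -imGen := by
  rw [imGen, map_smul, map_sub, map_star, neg_s, star_neg]
  module

lemma symbol_reGen (z : Circle) : symbol reGen z = ((z : ℂ).re : ℂ) := by
  rw [reGen, map_smul, map_add, CFun.smul_apply, CFun.add_apply, symbol_apply_star, symbol_s,
    CFun.of_apply, circleGen_apply, Complex.re_eq_add_conj, Complex.star_def]
  ring

lemma symbol_imGen (z : Circle) : symbol imGen z = ((z : ℂ).im : ℂ) := by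
  rw [imGen, map_smul, map_sub, CFun.smul_apply, CFun.sub_apply, symbol_apply_star, symbol_s,
    CFun.of_apply, circleGen_apply, Complex.im_eq_sub_conj, Complex.star_def]
  field_simp
  rw [Complex.I_sq]
  ring

/-! ### A non-unitary isometry -/

/-- The Hilbert space `ℓ²`. -/
abbrev Ell2 : Type := lp (fun _ : ℕ => ℂ) 2

lemma orthonormal_single_succ :
    Orthonormal ℂ fun n : ℕ => (lp.single 2 (n + 1) (1 : ℂ) : Ell2) := by
  rw [orthonormal_iff_ite]
  intro i j
  rw [lp.inner_single_left, lp.single_apply]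
  by_cases h : i = j
  · subst h; simp
  · simp [h]

/-- The unilateral shift. -/
def shift : Ell2 →ₗᵢ[ℂ] Ell2 := orthonormal_single_succ.orthogonalFamily.linearIsometry

lemma shift_single (n : ℕ) :
    shift (lp.single 2 n (1 : ℂ)) = lp.single 2 (n + 1) (1 : ℂ) := by
  rw [shift, OrthogonalFamily.linearIsometry_apply_single]
  simp

lemma single_zero_ne_zero : (lp.single 2 0 (1 : ℂ) : Ell2) ≠ 0 := by
  intro h
  have h3 := congrArg (fun f : Ell2 => f 0) h
  simp at h3

instance : Nontrivial Ell2 := ⟨_, _, single_zero_ne_zero⟩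

/-- The unilateral shift as an isometry. -/
def shiftIso : IsometryIn where
  carrier := Ell2 →L[ℂ] Ell2
  v := shift.toContinuousLinearMap
  isometry := shift.adjoint_comp_self

lemma adjoint_shift_single_zero :
    ContinuousLinearMap.adjoint shift.toContinuousLinearMap (lp.single 2 0 (1 : ℂ)) = 0 := by
  ext n
  have h := lp.inner_single_left (𝕜 := ℂ) n (1 : ℂ)
    (ContinuousLinearMap.adjoint shift.toContinuousLinearMap (lp.single 2 0 (1 : ℂ)) : Ell2)
  rw [ContinuousLinearMap.adjoint_inner_right] at h
  have h2 : shift.toContinuousLinearMap (lp.single 2 n (1 : ℂ)) = lp.single 2 (n + 1) (1 : ℂ) :=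
    shift_single n
  rw [h2, lp.inner_single_left, lp.single_apply] at h
  simpa using h.symm

/-- The defect projection `1 - s s*`. -/
def defectProj : Toeplitz := 1 - s * star s

/-- The universal property carries `s` to the unilateral shift, whose adjoint kills the first basis
vector; there `1 - s s*` fixes that vector. -/
lemma defectProj_ne_zero : defectProj ≠ 0 := by
  intro h
  have h1 := congrArg (lift shiftIso) h
  rw [defectProj, map_sub, map_one, map_mul, map_star, lift_s, map_zero, sub_eq_zero] at h1
  have h2 : (lp.single 2 0 (1 : ℂ) : Ell2) = shift.toContinuousLinearMap
      (ContinuousLinearMap.adjoint shift.toContinuousLinearMap (lp.single 2 0 (1 : ℂ))) :=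
    DFunLike.congr_fun (F := Ell2 →L[ℂ] Ell2) h1 _
  rw [adjoint_shift_single_zero, map_zero] at h2
  exact single_zero_ne_zero h2

lemma star_s_mul_defectProj : star s * defectProj = 0 := by
  rw [defectProj, mul_sub, mul_one, ← mul_assoc, star_s_mul_s, one_mul, sub_self]

lemma star_defectProj : star defectProj = defectProj := by
  simp [defectProj]

lemma defectProj_mul_s : defectProj * s = 0 := by
  rw [← star_defectProj, ← star_star s, ← star_mul, star_s_mul_defectProj, star_zero]

lemma defectProj_mul_self : defectProj * defectProj = defectProj := by
  nth_rewrite 1 [defectProj]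
  rw [sub_mul, one_mul, mul_assoc, star_s_mul_defectProj, mul_zero, sub_zero]

/-- The compact operator `s e + e s*`, where `e = 1 - s s*`. -/
def oddCompact : Toeplitz := s * defectProj + defectProj * star s

lemma star_oddCompact : star oddCompact = oddCompact := by
  rw [oddCompact, star_add, star_mul, star_mul, star_star, star_defectProj, add_comm]

lemma neg_defectProj : neg defectProj = defectProj := by
  rw [defectProj, map_sub, map_mul, map_star, neg_s, map_one, star_neg, neg_mul_neg]

lemma neg_oddCompact : neg oddCompact = -oddCompact := by
  rw [oddCompact, map_add, map_mul, map_mul, map_star, neg_s, neg_defectProj, star_neg, neg_mul,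
    mul_neg, neg_add]

lemma symbol_defectProj : symbol defectProj = 0 := by
  ext z
  rw [defectProj, map_sub, map_mul, map_one, CFun.sub_apply, CFun.mul_apply, symbol_apply_star,
    symbol_s, CFun.of_apply, circleGen_apply, Complex.star_def, Complex.mul_conj,
    Circle.normSq_coe]
  simp

lemma symbol_oddCompact : symbol oddCompact = 0 := by
  rw [oddCompact, map_add, map_mul, map_mul, symbol_defectProj, mul_zero, zero_mul, add_zero]

/-- In the shift representation this element exchanges the first two basis vectors and kills the
others, so its square is the projection onto their span. -/
lemma oddCompact_mul_self :
    oddCompact * oddCompact = s * defectProj * star s + defectProj := by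
  have e1 : defectProj * (s * defectProj) = 0 := by rw [← mul_assoc, defectProj_mul_s, zero_mul]
  have e2 : star s * (defectProj * star s) = 0 := by
    rw [← mul_assoc, star_s_mul_defectProj, zero_mul]
  have e3 : defectProj * (defectProj * star s) = defectProj * star s := by
    rw [← mul_assoc, defectProj_mul_self]
  have e4 : star s * (s * defectProj) = defectProj := by rw [← mul_assoc, star_s_mul_s, one_mul]
  simp only [oddCompact, add_mul, mul_add, mul_assoc, e1, e2, e3, e4, mul_zero, zero_add, add_zero,
    defectProj_mul_self]
  exact add_comm _ _

lemma oddCompact_pow_four_ne_zero :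
    oddCompact * oddCompact * (oddCompact * oddCompact) ≠ 0 := by
  -- The square acts as the identity on the range of `1 - s s*`, and so does the fourth power, which
  -- therefore cannot vanish.
  have h1 : oddCompact * oddCompact * defectProj = defectProj := by
    rw [oddCompact_mul_self, add_mul, mul_assoc _ (star s), star_s_mul_defectProj, mul_zero,
      zero_add, defectProj_mul_self]
  intro h
  apply defectProj_ne_zero
  calc defectProj = oddCompact * oddCompact * (oddCompact * oddCompact) * defectProj := by
        rw [mul_assoc, h1, h1]
    _ = 0 := by rw [h, zero_mul]

end Toeplitz

/-! ### Coordinates on the square -/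

/-- For `x = cos θ`, the abscissa of the point of the boundary of the square `[-1, 1]²` with
parameter `θ`. -/
def squareCoord (x : ℝ) : ℝ := max (-1) (min 1 (4 / Real.pi * Real.arcsin x))

lemma continuous_squareCoord : Continuous squareCoord := by
  unfold squareCoord
  fun_prop

lemma squareCoord_neg (x : ℝ) : squareCoord (-x) = -squareCoord x := by
  rw [squareCoord, squareCoord, Real.arcsin_neg, mul_neg, ← min_neg_neg, ← max_neg_neg, neg_neg,
    max_min_distrib_left]
  simp

/-- The angle is at most `π/4` in absolute value, so `arcsin` inverts the sine and the truncation is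
inactive. -/
lemma squareCoord_sin (t : UI) : squareCoord (Real.sin (Real.pi * t / 4)) = t := by
  have h1 := t.2.1
  have h2 := t.2.2
  have hp := Real.pi_pos
  rw [squareCoord, Real.arcsin_sin (by nlinarith) (by nlinarith)]
  have : 4 / Real.pi * (Real.pi * (t : ℝ) / 4) = t := by field_simp
  rw [this, min_eq_right h2, max_eq_right h1]

/-- For angles up to `π/4` in absolute value the cosine is at least `sin (π/4)`, so the rescaled
`arcsin` is at least `1` and is truncated to `1`. -/
lemma squareCoord_cos (t : UI) : squareCoord (Real.cos (Real.pi * t / 4)) = 1 := by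
  have h1 := t.2.1
  have h2 := t.2.2
  have hp := Real.pi_pos
  have : (1 : ℝ) ≤ 4 / Real.pi * Real.arcsin (Real.cos (Real.pi * t / 4)) := by
    have h3 : Real.pi / 4 ≤ Real.arcsin (Real.cos (Real.pi * t / 4)) := by
      rw [Real.le_arcsin_iff_sin_le' ⟨by linarith, by linarith⟩, Real.sin_pi_div_four,
        ← Real.cos_pi_div_four, ← Real.cos_abs (Real.pi * t / 4)]
      refine Real.cos_le_cos_of_nonneg_of_le_pi (abs_nonneg _) (by linarith) ?_
      rw [abs_le]
      constructor <;> nlinarith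
    calc (1 : ℝ) = 4 / Real.pi * (Real.pi / 4) := by field_simp
      _ ≤ _ := by gcongr
  rw [squareCoord, min_eq_left this]
  norm_num

/-- After removing full and half turns the angle is `πt/4` for `k = 1` and `π - πt/4` for `k = -1`:
the right and left quarter arcs, which play the role of the vertical sides. -/
lemma delta1_coe (k : ℤˣ) (t : UI) : (delta1 k t : ℂ).re = (k : ℤ) * Real.cos (Real.pi * t / 4) ∧
    (delta1 k t : ℂ).im = Real.sin (Real.pi * t / 4) := by
  have h : (delta1 k t : ℂ) = Complex.exp
      ((Real.pi * ((k : ℤ) * t / 4 + (k : ℤ) / 2 + 3 / 2) : ℝ) * Complex.I) := by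
    rw [← Circle.coe_exp]; rfl
  rw [h, Complex.exp_ofReal_mul_I_re, Complex.exp_ofReal_mul_I_im]
  rcases Int.units_eq_one_or k with rfl | rfl
  · have : Real.pi * (((1 : ℤˣ) : ℤ) * (t : ℝ) / 4 + ((1 : ℤˣ) : ℤ) / 2 + 3 / 2) =
        Real.pi * t / 4 + 2 * Real.pi := by push_cast; ring
    rw [this, Real.cos_add_two_pi, Real.sin_add_two_pi]
    simp
  · have : Real.pi * (((-1 : ℤˣ) : ℤ) * (t : ℝ) / 4 + ((-1 : ℤˣ) : ℤ) / 2 + 3 / 2) =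
        Real.pi - Real.pi * t / 4 := by push_cast; ring
    rw [this, Real.cos_pi_sub, Real.sin_pi_sub]
    simp

lemma delta2_coe (k : ℤˣ) (t : UI) : (delta2 k t : ℂ).re = Real.sin (Real.pi * t / 4) ∧
    (delta2 k t : ℂ).im = (k : ℤ) * Real.cos (Real.pi * t / 4) := by
  have h : (delta2 k t : ℂ) = Complex.exp
      ((Real.pi * (-((k : ℤ) * t / 4) - (k : ℤ) / 2 + 1) : ℝ) * Complex.I) := by
    rw [← Circle.coe_exp]; rfl
  rw [h, Complex.exp_ofReal_mul_I_re, Complex.exp_ofReal_mul_I_im]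
  rcases Int.units_eq_one_or k with rfl | rfl
  · have : Real.pi * (-(((1 : ℤˣ) : ℤ) * (t : ℝ) / 4) - ((1 : ℤˣ) : ℤ) / 2 + 1) =
        Real.pi / 2 - Real.pi * t / 4 := by push_cast; ring
    rw [this, Real.cos_pi_div_two_sub, Real.sin_pi_div_two_sub]
    simp
  · have : Real.pi * (-(((-1 : ℤˣ) : ℤ) * (t : ℝ) / 4) - ((-1 : ℤˣ) : ℤ) / 2 + 1) =
        Real.pi * t / 4 + Real.pi / 2 + Real.pi := by push_cast; ring
    rw [this, Real.cos_add_pi, Real.sin_add_pi, Real.cos_add_pi_div_two, Real.sin_add_pi_div_two]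
    simp

/-- The restriction of the symbol to the sides `{k} × I`. -/
def side1 (k : ℤˣ) : Toeplitz →ₐ[ℂ] CI := (CFun.pull (delta1 k)).comp Toeplitz.symbol

/-- The restriction of the symbol to the sides `I × {k}`. -/
def side2 (k : ℤˣ) : Toeplitz →ₐ[ℂ] CI := (CFun.pull (delta2 k)).comp Toeplitz.symbol

lemma side1_apply (k : ℤˣ) (x : Toeplitz) (t : UI) :
    side1 k x t = Toeplitz.symbol x (delta1 k t) := rfl

lemma side2_apply (k : ℤˣ) (x : Toeplitz) (t : UI) :
    side2 k x t = Toeplitz.symbol x (delta2 k t) := rfl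

lemma sigma1_apply (x : Toeplitz) :
    sigma1 x = ind 1 ⊗ₜ[ℂ] side1 1 x + ind (-1) ⊗ₜ[ℂ] side1 (-1) x := rfl

lemma sigma2_apply (x : Toeplitz) :
    sigma2 x = side2 1 x ⊗ₜ[ℂ] ind 1 + side2 (-1) x ⊗ₜ[ℂ] ind (-1) := rfl

namespace Toeplitz

/-- An element of `𝒯` whose symbol is the abscissa on the boundary of the square. -/
def absc : Toeplitz := cfc (fun z : ℂ => (squareCoord z.re : ℂ)) reGen

/-- An element of `𝒯` whose symbol is the ordinate on the boundary of the square. -/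
def ord : Toeplitz := cfc (fun z : ℂ => (squareCoord z.re : ℂ)) imGen

lemma continuous_squareCoord_re : Continuous fun z : ℂ => (squareCoord z.re : ℂ) := by
  have := continuous_squareCoord
  fun_prop

lemma isSelfAdjoint_absc : IsSelfAdjoint absc := by
  rw [isSelfAdjoint_iff, absc, ← cfc_star]
  simp

lemma isSelfAdjoint_ord : IsSelfAdjoint ord := by
  rw [isSelfAdjoint_iff, ord, ← cfc_star]
  simp

instance : IsStarNormal absc := isSelfAdjoint_absc.isStarNormal

instance : IsStarNormal ord := isSelfAdjoint_ord.isStarNormal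

lemma neg_absc : neg absc = -absc :=
  neg_cfc_of_odd _ continuous_squareCoord_re (fun z => by simp [squareCoord_neg]) _ neg_reGen

lemma neg_ord : neg ord = -ord :=
  neg_cfc_of_odd _ continuous_squareCoord_re (fun z => by simp [squareCoord_neg]) _ neg_imGen

lemma symbol_absc (z : Circle) : symbol absc z = (squareCoord (z : ℂ).re : ℂ) := by
  rw [absc, symbol_cfc _ continuous_squareCoord_re, symbol_reGen, Complex.ofReal_re]

lemma symbol_ord (z : Circle) : symbol ord z = (squareCoord (z : ℂ).im : ℂ) := by
  rw [ord, symbol_cfc _ continuous_squareCoord_re, symbol_imGen, Complex.ofReal_re]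

end Toeplitz

lemma squareCoord_mul_cos (k : ℤˣ) (t : UI) :
    squareCoord ((k : ℤ) * Real.cos (Real.pi * t / 4)) = (k : ℤ) := by
  rcases Int.units_eq_one_or k with rfl | rfl
  · simp [squareCoord_cos]
  · simp [squareCoord_neg, squareCoord_cos]

lemma side1_absc (k : ℤˣ) (t : UI) : side1 k Toeplitz.absc t = (k : ℤ) := by
  rw [side1_apply, Toeplitz.symbol_absc, (delta1_coe k t).1, squareCoord_mul_cos]
  simp

lemma side2_absc (k : ℤˣ) (t : UI) : side2 k Toeplitz.absc t = (t : ℝ) := by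
  rw [side2_apply, Toeplitz.symbol_absc, (delta2_coe k t).1, squareCoord_sin]

lemma side1_ord (k : ℤˣ) (t : UI) : side1 k Toeplitz.ord t = (t : ℝ) := by
  rw [side1_apply, Toeplitz.symbol_ord, (delta1_coe k t).2, squareCoord_sin]

lemma side2_ord (k : ℤˣ) (t : UI) : side2 k Toeplitz.ord t = (k : ℤ) := by
  rw [side2_apply, Toeplitz.symbol_ord, (delta2_coe k t).2, squareCoord_mul_cos]
  simp

lemma sigma1_eq_genU_tmul {x : Toeplitz} {f : CI} (h : ∀ k t, side1 k x t = (k : ℤ) * f t) :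
    sigma1 x = genU ⊗ₜ[ℂ] f := by
  have h1 : side1 1 x = f := by ext t; simp [h]
  have h2 : side1 (-1) x = -f := by ext t; simp [h]
  rw [sigma1_apply, h1, h2, TensorProduct.tmul_neg, ← sub_eq_add_neg, ← TensorProduct.sub_tmul,
    ← genU_eq]

lemma sigma1_eq_one_tmul {x : Toeplitz} {f : CI} (h : ∀ k t, side1 k x t = f t) :
    sigma1 x = 1 ⊗ₜ[ℂ] f := by
  have h1 : ∀ k, side1 k x = f := fun k => by ext t; simp [h]
  rw [sigma1_apply, h1, h1, ← TensorProduct.add_tmul, ind_add]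

lemma sigma2_eq_tmul_genU {x : Toeplitz} {f : CI} (h : ∀ k t, side2 k x t = (k : ℤ) * f t) :
    sigma2 x = f ⊗ₜ[ℂ] genU := by
  have h1 : side2 1 x = f := by ext t; simp [h]
  have h2 : side2 (-1) x = -f := by ext t; simp [h]
  rw [sigma2_apply, h1, h2, TensorProduct.neg_tmul, ← sub_eq_add_neg, ← TensorProduct.tmul_sub,
    ← genU_eq]

lemma sigma2_eq_tmul_one {x : Toeplitz} {f : CI} (h : ∀ k t, side2 k x t = f t) :
    sigma2 x = f ⊗ₜ[ℂ] 1 := by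
  have h1 : ∀ k, side2 k x = f := fun k => by ext t; simp [h]
  rw [sigma2_apply, h1, h1, ← TensorProduct.tmul_add, ind_add]

theorem isPhiPair_absc_ord : IsPhiPair Toeplitz.absc Toeplitz.ord where
  odd₁ := involutionCoaction_odd _ _ _ Toeplitz.neg_absc
  odd₂ := involutionCoaction_odd _ _ _ Toeplitz.neg_ord
  sigma1_fst := sigma1_eq_genU_tmul fun k t => by simp [side1_absc]
  sigma2_fst := sigma2_eq_tmul_one fun k t => side2_absc k t
  sigma2_snd := sigma2_eq_tmul_genU fun k t => by simp [side2_ord]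
  sigma1_snd := sigma1_eq_one_tmul fun k t => side1_ord k t

/-! ### Perturbations in the kernel of the symbol map and nonvanishing products of defects. -/

lemma sigma1_eq_zero {x : Toeplitz} (h : Toeplitz.symbol x = 0) : sigma1 x = 0 := by
  rw [sigma1, AlgHom.comp_apply, h, map_zero]

lemma sigma2_eq_zero {x : Toeplitz} (h : Toeplitz.symbol x = 0) : sigma2 x = 0 := by
  rw [sigma2, AlgHom.comp_apply, h, map_zero]

/-- Admissible pairs may be perturbed by odd elements in the kernel of the symbol map. -/
lemma IsPhiPair.add {φ₁ φ₂ K L : Toeplitz} (h : IsPhiPair φ₁ φ₂) (hK : Toeplitz.neg K = -K)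
    (hL : Toeplitz.neg L = -L) (hK0 : Toeplitz.symbol K = 0) (hL0 : Toeplitz.symbol L = 0) :
    IsPhiPair (φ₁ + K) (φ₂ + L) where
  odd₁ := by
    rw [map_add, h.odd₁, TensorProduct.add_tmul]
    exact congrArg _ (involutionCoaction_odd _ _ _ hK)
  odd₂ := by
    rw [map_add, h.odd₂, TensorProduct.add_tmul]
    exact congrArg _ (involutionCoaction_odd _ _ _ hL)
  sigma1_fst := by rw [map_add, h.sigma1_fst, sigma1_eq_zero hK0, add_zero]
  sigma2_fst := by rw [map_add, h.sigma2_fst, sigma2_eq_zero hK0, add_zero]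
  sigma2_snd := by rw [map_add, h.sigma2_snd, sigma2_eq_zero hL0, add_zero]
  sigma1_snd := by rw [map_add, h.sigma1_snd, sigma1_eq_zero hL0, add_zero]

/-- If `K ^ 4 ≠ 0`, some integral perturbation of `a` and `b` by `K` has
`(1 - a ^ 2) (1 - b ^ 2) ≠ 0`. -/
lemma exists_perturbation_mul_ne_zero {R : Type*} [Ring R] [Algebra ℂ R] (a b K : R)
    (hK : K * K * (K * K) ≠ 0) :
    ∃ z w : ℤ, (1 - (a + z • K) ^ 2) * (1 - (b + w • K) ^ 2) ≠ 0 := by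
  by_contra! h
  apply hK
  -- The defect is quadratic in the integer parameter, and its second difference at `1`, `-1`, `0`
  -- leaves only the coefficient of `K²`.
  have second (c : R) : (1 - (c + (1 : ℤ) • K) ^ 2) + (1 - (c + (-1 : ℤ) • K) ^ 2) -
      (2 : ℂ) • (1 - (c + (0 : ℤ) • K) ^ 2) = (-2 : ℂ) • (K * K) := by
    simp only [pow_two, one_smul, zero_smul, neg_smul, add_mul, mul_add, add_zero, neg_mul, mul_neg]
    module
  -- If all products vanished, taking second differences in one factor and then in the other would
  -- give `4 K⁴ = 0`.
  have h3 (w : ℤ) : ((-2 : ℂ) • (K * K)) * (1 - (b + w • K) ^ 2) = 0 := by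
    rw [← second a, sub_mul, add_mul, smul_mul_assoc, h, h, h, smul_zero, add_zero, sub_zero]
  have h4 : ((-2 : ℂ) • (K * K)) * ((-2 : ℂ) • (K * K)) = 0 := by
    nth_rewrite 2 [← second b]
    rw [mul_sub, mul_add, mul_smul_comm, h3, h3, h3, smul_zero, add_zero, sub_zero]
  rw [smul_mul_smul_comm] at h4
  exact (smul_eq_zero.1 h4).resolve_left (by norm_num)

lemma isSelfAdjoint_one_sub_perturbation_sq {R : Type*} [Ring R] [StarRing R] {a K : R}
    (ha : IsSelfAdjoint a) (hK : IsSelfAdjoint K) (z : ℤ) :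
    IsSelfAdjoint (1 - (a + z • K) ^ 2) := by
  have h : IsSelfAdjoint (z • K) := by rw [isSelfAdjoint_iff, star_zsmul, hK.star_eq]
  exact (IsSelfAdjoint.one R).sub ((ha.add h).pow 2)

theorem exists_isPhiPair_mul_ne_zero : ∃ φ₁ φ₂ : Toeplitz, IsPhiPair φ₁ φ₂ ∧
    (1 - φ₂ ^ 2) * (1 - φ₁ ^ 2) ≠ 0 ∧ (1 - φ₁ ^ 2) * (1 - φ₂ ^ 2) ≠ 0 := by
  obtain ⟨z, w, hzw⟩ := exists_perturbation_mul_ne_zero Toeplitz.ord Toeplitz.absc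
    Toeplitz.oddCompact Toeplitz.oddCompact_pow_four_ne_zero
  have hodd : ∀ z : ℤ, Toeplitz.neg (z • Toeplitz.oddCompact) = -(z • Toeplitz.oddCompact) :=
    fun z => by rw [map_zsmul, Toeplitz.neg_oddCompact, smul_neg]
  have hsym : ∀ z : ℤ, Toeplitz.symbol (z • Toeplitz.oddCompact) = 0 := fun z => by
    rw [map_zsmul, Toeplitz.symbol_oddCompact, smul_zero]
  have hA := isSelfAdjoint_one_sub_perturbation_sq Toeplitz.isSelfAdjoint_ord
    Toeplitz.star_oddCompact z
  have hB := isSelfAdjoint_one_sub_perturbation_sq Toeplitz.isSelfAdjoint_absc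
    Toeplitz.star_oddCompact w
  -- Both defects are self-adjoint, so the product in the opposite order is the adjoint of the first
  -- one and is nonzero as well.
  refine ⟨_, _, isPhiPair_absc_ord.add (hodd w) (hodd z) (hsym w) (hsym z), hzw, fun h => hzw ?_⟩
  rw [← hA.star_eq, ← hB.star_eq, ← star_mul, h, star_zero]

/-! ### Functions on the boundary of the square -/

/-- The end points of `I`. -/
def endPt (k : ℤˣ) : UI :=
  ⟨(k : ℤ), by rcases Int.units_eq_one_or k with rfl | rfl <;> constructor <;> norm_num⟩

@[simp] lemma coe_endPt (k : ℤˣ) : ((endPt k : UI) : ℝ) = (k : ℤ) := rfl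

/-- The function `f(a)` of an element `a` of `𝒯`, for `f ∈ C(I)`. -/
def Toeplitz.applyCI (f : CI) (a : Toeplitz) : Toeplitz :=
  cfc (fun z : ℂ => f (Set.projIcc (-1) 1 (by norm_num) z.re)) a

lemma Toeplitz.symbol_applyCI (f : CI) (a : Toeplitz) [IsStarNormal a] (z : Circle) (t : UI)
    (h : symbol a z = (t : ℝ)) : symbol (applyCI f a) z = f t := by
  have hf : Continuous fun z : ℂ => f (Set.projIcc (-1) 1 (by norm_num) z.re) :=
    (show C(UI, ℂ) from f).continuous.comp (continuous_projIcc.comp Complex.continuous_re)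
  rw [applyCI, symbol_cfc _ hf, h, Complex.ofReal_re, Set.projIcc_val]

/-- Functions on the sides of the square that agree at the corners are the restrictions of the
symbol of an element of `𝒯`. -/
theorem exists_side_eq (A B : ℤˣ → CI) (h : ∀ k l, A k (endPt l) = B l (endPt k)) :
    ∃ x, (∀ k, side1 k x = A k) ∧ ∀ k, side2 k x = B k := by
  let X := Toeplitz.absc
  let Y := Toeplitz.ord
  let F (k : ℤˣ) : Toeplitz := Toeplitz.applyCI (A k) Y
  let G (k : ℤˣ) : Toeplitz := Toeplitz.applyCI (B k) X
  -- Interpolation from the boundary: blend the data of opposite sides linearly in each coordinate,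
  -- then subtract the bilinear interpolant of the corner values, which has been counted twice. The
  -- order of factors is immaterial since symbols commute.
  let x : Toeplitz := (1 / 2 : ℂ) • ((1 + X) * F 1 + (1 - X) * F (-1) + (1 + Y) * G 1 +
      (1 - Y) * G (-1)) -
    (1 / 4 : ℂ) • (A 1 (endPt 1) • ((1 + X) * (1 + Y)) + A 1 (endPt (-1)) • ((1 + X) * (1 - Y)) +
      A (-1) (endPt 1) • ((1 - X) * (1 + Y)) + A (-1) (endPt (-1)) • ((1 - X) * (1 - Y)))
  have hF1 : ∀ k l t, side1 l (F k) t = A k t := fun k l t =>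
    Toeplitz.symbol_applyCI _ _ _ _ (side1_ord l t)
  have hF2 : ∀ k l t, side2 l (F k) t = A k (endPt l) := fun k l t =>
    Toeplitz.symbol_applyCI _ _ _ _ (by
      rw [← side2_apply, side2_ord]
      simp)
  have hG1 : ∀ k l t, side1 l (G k) t = B k (endPt l) := fun k l t =>
    Toeplitz.symbol_applyCI _ _ _ _ (by
      rw [← side1_apply, side1_absc]
      simp)
  have hG2 : ∀ k l t, side2 l (G k) t = B k t := fun k l t =>
    Toeplitz.symbol_applyCI _ _ _ _ (side2_absc l t)
  refine ⟨x, fun k => ?_, fun k => ?_⟩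
  · ext t
    simp only [x, map_sub, map_smul, map_add, map_mul, map_one, CFun.sub_apply, CFun.smul_apply,
      CFun.add_apply, CFun.mul_apply, CFun.one_apply, hF1, hG1, X, Y, side1_absc, side1_ord, ← h]
    rcases Int.units_eq_one_or k with rfl | rfl
    · push_cast; ring
    · push_cast; ring
  · ext t
    simp only [x, map_sub, map_smul, map_add, map_mul, map_one, CFun.sub_apply, CFun.smul_apply,
      CFun.add_apply, CFun.mul_apply, CFun.one_apply, hF2, hG2, X, Y, side2_absc, side2_ord]
    rcases Int.units_eq_one_or k with rfl | rfl
    · push_cast; ring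
    · push_cast; ring

/-- The affine function on `I` with prescribed values at the end points. -/
def affineI (c : ℤˣ → ℂ) : CI :=
  CFun.of ⟨fun t => (1 + ((t : ℝ) : ℂ)) / 2 * c 1 + (1 - ((t : ℝ) : ℂ)) / 2 * c (-1), by fun_prop⟩

@[simp] lemma affineI_endPt (c : ℤˣ → ℂ) (k : ℤˣ) : affineI c (endPt k) = c k := by
  change (1 + (((endPt k : UI) : ℝ) : ℂ)) / 2 * c 1 +
    (1 - (((endPt k : UI) : ℝ) : ℂ)) / 2 * c (-1) = c k
  rcases Int.units_eq_one_or k with rfl | rfl <;> simp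

/-- At the end points the angle is `±π/4`, where sine and cosine coincide up to sign; hence adjacent
arcs share their corners. -/
lemma delta1_endPt (k l : ℤˣ) : delta1 k (endPt l) = delta2 l (endPt k) := by
  have h1 := delta1_coe k (endPt l)
  have h2 := delta2_coe l (endPt k)
  have hs : ∀ m : ℤˣ, Real.sin (Real.pi * (endPt m : UI) / 4) =
      (m : ℤ) * Real.sin (Real.pi / 4) := by
    intro m
    rcases Int.units_eq_one_or m with rfl | rfl <;> simp [neg_div]
  have hc : ∀ m : ℤˣ, Real.cos (Real.pi * (endPt m : UI) / 4) = Real.sin (Real.pi / 4) := by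
    intro m
    rw [Real.sin_pi_div_four, ← Real.cos_pi_div_four]
    rcases Int.units_eq_one_or m with rfl | rfl <;> simp [neg_div]
  rw [hs, hc] at h1 h2
  exact Circle.ext (Complex.ext (h1.1.trans h2.1.symm) (h1.2.trans h2.2.symm))

lemma side1_endPt (k l : ℤˣ) (x : Toeplitz) : side1 k x (endPt l) = side2 l x (endPt k) := by
  rw [side1_apply, side2_apply, delta1_endPt]

/-! ### Images of the gluing maps -/

lemma exists_tmul_ind {M : Type*} [AddCommGroup M] [Module ℂ M] (x : M ⊗[ℂ] CZ2) :
    ∃ y : ℤˣ → M, x = y 1 ⊗ₜ[ℂ] ind 1 + y (-1) ⊗ₜ[ℂ] ind (-1) := by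
  induction x using TensorProduct.induction_on with
  | zero => exact ⟨0, by simp⟩
  | tmul m f =>
    refine ⟨fun k => f k • m, ?_⟩
    rw [TensorProduct.smul_tmul, TensorProduct.smul_tmul, ← TensorProduct.tmul_add,
      ← CZ2.eq_ind f]
  | add a b ha hb =>
    obtain ⟨y, rfl⟩ := ha
    obtain ⟨z, rfl⟩ := hb
    refine ⟨y + z, ?_⟩
    simp only [Pi.add_apply, TensorProduct.add_tmul]
    abel

/-- Only two opposite sides are prescribed, so no corner condition arises; the other two sides are
filled by affine functions through the corner values. -/
lemma sigma1_surjective : Function.Surjective sigma1 := by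
  intro w
  obtain ⟨A, hA⟩ := exists_tmul_ind (TensorProduct.comm ℂ CZ2 CI w)
  obtain ⟨x, hx, -⟩ := exists_side_eq A (fun l => affineI fun k => A k (endPt l))
    fun k l => by simp
  refine ⟨x, ?_⟩
  rw [sigma1_apply, hx, hx]
  apply (TensorProduct.comm ℂ CZ2 CI).injective
  rw [hA]
  simp

lemma sigma1Id_surjective : Function.Surjective sigma1Id :=
  TensorProduct.map_surjective sigma1_surjective Function.surjective_id

lemma Phi01_Phi01 (x : (CZ2 ⊗[ℂ] CI) ⊗[ℂ] CZ2) : Phi01 (Phi01 x) = x := by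
  have h : Phi01.comp Phi01 = AlgHom.id ℂ _ := by
    ext <;> rfl
  exact DFunLike.congr_fun h x

lemma Phi01_sigma1Id_surjective : Function.Surjective (Phi01.comp sigma1Id) := fun x => by
  obtain ⟨y, hy⟩ := sigma1Id_surjective (Phi01 x)
  exact ⟨y, by rw [AlgHom.comp_apply, hy, Phi01_Phi01]⟩

lemma sigma1Id_tmul (x : Toeplitz) (f : CZ2) : sigma1Id (x ⊗ₜ[ℂ] f) =
    (ind 1 ⊗ₜ[ℂ] side1 1 x) ⊗ₜ[ℂ] f + (ind (-1) ⊗ₜ[ℂ] side1 (-1) x) ⊗ₜ[ℂ] f := by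
  rw [← TensorProduct.add_tmul, ← sigma1_apply]; rfl

lemma sigma2Id_tmul (x : Toeplitz) (f : CZ2) : sigma2Id (x ⊗ₜ[ℂ] f) =
    (side2 1 x ⊗ₜ[ℂ] ind 1) ⊗ₜ[ℂ] f + (side2 (-1) x ⊗ₜ[ℂ] ind (-1)) ⊗ₜ[ℂ] f := by
  rw [← TensorProduct.add_tmul, ← sigma2_apply]; rfl

/-- `Φ₀₁` exchanges the label of the side with the label of the sheet, which accounts for the
swapped indices. -/
lemma mem_P01_iff_side (a b : ℤˣ → Toeplitz) :
    ((a 1 ⊗ₜ[ℂ] ind 1 + a (-1) ⊗ₜ[ℂ] ind (-1),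
      b 1 ⊗ₜ[ℂ] ind 1 + b (-1) ⊗ₜ[ℂ] ind (-1)) : TZ2) ∈ P01 ↔
    ∀ k h, side1 k (a h) = side1 h (b k) := by
  rw [mem_P01]
  simp only [map_add, sigma1Id_tmul, Phi01_tmul]
  constructor
  · intro heq k h
    -- Evaluating the two copies of `C(ℤ₂)` at `k` and `h` isolates one of the four components.
    let ev (m : ℤˣ) : CZ2 →ₐ[ℂ] ℂ := (ContinuousMap.evalAlgHom ℂ ℂ m : C(ℤˣ, ℂ) →ₐ[ℂ] ℂ)
    have hev : ∀ m n, ev m (ind n) = if m = n then 1 else 0 := fun m n => rfl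
    have h1 := congrArg (fun w => TensorProduct.lid ℂ CI ((ev k).toLinearMap.rTensor CI
      (TensorProduct.rid ℂ _ ((ev h).toLinearMap.lTensor _ w)))) heq
    rcases Int.units_eq_one_or k with rfl | rfl <;> rcases Int.units_eq_one_or h with rfl | rfl <;>
      simpa [hev] using h1
  · intro heq
    rw [heq, heq, heq, heq]
    abel

lemma beta1_tmul_ind (x : ℤˣ → Toeplitz) :
    beta1 (x 1 ⊗ₜ[ℂ] ind 1 + x (-1) ⊗ₜ[ℂ] ind (-1)) =
    ((side1 1 (x 1) ⊗ₜ[ℂ] ind 1) ⊗ₜ[ℂ] ind 1 + (side1 (-1) (x 1) ⊗ₜ[ℂ] ind 1) ⊗ₜ[ℂ] ind (-1) +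
      ((side1 1 (x (-1)) ⊗ₜ[ℂ] ind (-1)) ⊗ₜ[ℂ] ind 1 +
        (side1 (-1) (x (-1)) ⊗ₜ[ℂ] ind (-1)) ⊗ₜ[ℂ] ind (-1)),
    (side2 1 (x 1) ⊗ₜ[ℂ] ind 1) ⊗ₜ[ℂ] ind 1 + (side2 (-1) (x 1) ⊗ₜ[ℂ] ind 1) ⊗ₜ[ℂ] ind (-1) +
      ((side2 1 (x (-1)) ⊗ₜ[ℂ] ind (-1)) ⊗ₜ[ℂ] ind 1 +
        (side2 (-1) (x (-1)) ⊗ₜ[ℂ] ind (-1)) ⊗ₜ[ℂ] ind (-1))) := by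
  change (Phi02 (sigma1Id _), Phi12 (sigma2Id _)) = _
  simp only [map_add, sigma1Id_tmul, sigma2Id_tmul, Phi02_tmul, Phi12_tmul]

lemma beta1_eq_beta2 {x a b : ℤˣ → Toeplitz} (h1 : ∀ k h, side1 h (x k) = side2 k (a h))
    (h2 : ∀ k h, side2 h (x k) = side2 k (b h)) {y : P01}
    (hy : (y : TZ2) = (a 1 ⊗ₜ[ℂ] ind 1 + a (-1) ⊗ₜ[ℂ] ind (-1),
      b 1 ⊗ₜ[ℂ] ind 1 + b (-1) ⊗ₜ[ℂ] ind (-1))) :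
    beta1 (x 1 ⊗ₜ[ℂ] ind 1 + x (-1) ⊗ₜ[ℂ] ind (-1)) = beta2 y := by
  rw [beta1_tmul_ind]
  change _ = (sigma2Id (y : TZ2).1, sigma2Id (y : TZ2).2)
  simp only [hy, map_add, sigma2Id_tmul, h1, h2]
  refine Prod.ext ?_ ?_ <;> exact add_add_add_comm _ _ _ _

/-- An element of piece 2 prescribes two sides of each sheet of pieces 0 and 1. The remaining sides
are filled affinely, and they match across pieces 0 and 1 because their end values are the same
corner values of the given element. -/
lemma range_beta1_le : beta1.range ≤ beta2.range := by
  rintro _ ⟨x, rfl⟩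
  obtain ⟨x, rfl⟩ := exists_tmul_ind x
  choose a ha1 ha2 using fun h : ℤˣ => exists_side_eq
    (fun k => affineI fun l => side1 h (x l) (endPt k)) (fun k => side1 h (x k))
    fun k l => by simp
  choose b hb1 hb2 using fun h : ℤˣ => exists_side_eq
    (fun k => affineI fun l => side2 h (x l) (endPt k)) (fun k => side2 h (x k))
    fun k l => by simp
  refine ⟨⟨_, (mem_P01_iff_side a b).2 fun k h => ?_⟩, (beta1_eq_beta2 ?_ ?_ rfl).symm⟩
  · rw [ha1, hb1]
    congr 1
    ext l
    exact side1_endPt _ _ _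
  · exact fun k h => (ha2 h k).symm
  · exact fun k h => (hb2 h k).symm

/-- Here all four sides of each sheet of piece 2 are prescribed. Their compatibility at the corners
is the gluing condition that defines `P01`. -/
lemma range_beta2_le : beta2.range ≤ beta1.range := by
  rintro _ ⟨y, rfl⟩
  obtain ⟨a, ha⟩ := exists_tmul_ind (y : TZ2).1
  obtain ⟨b, hb⟩ := exists_tmul_ind (y : TZ2).2
  have hy : (y : TZ2) = (a 1 ⊗ₜ[ℂ] ind 1 + a (-1) ⊗ₜ[ℂ] ind (-1),
      b 1 ⊗ₜ[ℂ] ind 1 + b (-1) ⊗ₜ[ℂ] ind (-1)) := Prod.ext ha hb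
  have hab := (mem_P01_iff_side a b).1 (hy ▸ y.2)
  choose x hx1 hx2 using fun k : ℤˣ => exists_side_eq (fun h => side2 k (a h))
    (fun h => side2 k (b h)) fun h l => by
      rw [← side1_endPt, ← side1_endPt, hab]
  exact ⟨_, beta1_eq_beta2 (fun k h => hx1 k h) (fun k h => hx2 k h) hy⟩

/-! ### The gluing formulas on group-like elements -/

section Glue

variable {P : Type*} [Ring P] [Algebra ℂ P]

lemma defect_one {a : CZ2 →ₗ[ℂ] P ⊗[ℂ] P} (ha : a 1 = 1 ⊗ₜ[ℂ] 1) : defect a 1 = 0 := by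
  simp [defect, ha]

lemma defect_genU {a : CZ2 →ₗ[ℂ] P ⊗[ℂ] P} {g : P} (ha : a genU = g ⊗ₜ[ℂ] g) :
    defect a genU = 1 - g * g := by
  simp [defect, ha, counit_genU]

/-- Evaluates the gluing formula without writing `ℓ₂(u)` as a sum of simple tensors. -/
lemma rTensor_mul'_assoc_symm (d : P) (w : P ⊗[ℂ] P) :
    (LinearMap.mul' ℂ P).rTensor P ((TensorProduct.assoc ℂ P P P).symm (d ⊗ₜ[ℂ] w)) =
      (LinearMap.mulLeft ℂ d).rTensor P w := by
  induction w using TensorProduct.induction_on with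
  | zero => simp
  | tmul x y => simp
  | add x y hx hy => rw [TensorProduct.tmul_add, map_add, map_add, map_add, hx, hy]

lemma lTensor_mul'_assoc (d : P) (w : P ⊗[ℂ] P) :
    (LinearMap.mul' ℂ P).lTensor P (TensorProduct.assoc ℂ P P P (w ⊗ₜ[ℂ] d)) =
      (LinearMap.mulRight ℂ d).lTensor P w := by
  induction w using TensorProduct.induction_on with
  | zero => simp
  | tmul x y => simp
  | add x y hx hy => rw [TensorProduct.add_tmul, map_add, map_add, map_add, hx, hy]

variable {P₁ P₂ : Type*} [Ring P₁] [Algebra ℂ P₁] [Ring P₂] [Algebra ℂ P₂]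

lemma pullbackGlue_one {ℓ₁ : CZ2 →ₗ[ℂ] P₁ ⊗[ℂ] P₁} {ℓ₂ : CZ2 →ₗ[ℂ] P₂ ⊗[ℂ] P₂}
    {f₁₂ : P₁ →ₗ[ℂ] P₂} {f₂₁ : P₂ →ₗ[ℂ] P₁} (h₁ : ℓ₁ 1 = 1 ⊗ₜ[ℂ] 1) (hf : f₁₂ 1 = 1) :
    pullbackGlue ℓ₁ ℓ₂ f₁₂ f₂₁ 1 = 1 ⊗ₜ[ℂ] 1 := by
  have hd : defect (TensorProduct.map f₁₂ f₁₂ ∘ₗ ℓ₁) 1 = 0 :=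
    defect_one (by simp [h₁, hf])
  simp only [pullbackGlue, LinearMap.add_apply, LinearMap.comp_apply, comul_one, h₁,
    TensorProduct.map_tmul, hd, TensorProduct.zero_tmul, map_zero, add_zero]
  simp [hf, Prod.one_eq_mk]

lemma pullbackGlue_genU {ℓ₁ : CZ2 →ₗ[ℂ] P₁ ⊗[ℂ] P₁} {ℓ₂ : CZ2 →ₗ[ℂ] P₂ ⊗[ℂ] P₂}
    {f₁₂ : P₁ →ₗ[ℂ] P₂} {f₂₁ : P₂ →ₗ[ℂ] P₁} {g : P₁} {g' : P₂} (h₁ : ℓ₁ genU = g ⊗ₜ[ℂ] g)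
    (hg : f₁₂ g = g') :
    pullbackGlue ℓ₁ ℓ₂ f₁₂ f₂₁ genU = (g, g') ⊗ₜ[ℂ] (g, g') +
      TensorProduct.map (LinearMap.inr ℂ P₁ P₂) (f₂₁.prod LinearMap.id)
        ((LinearMap.mulLeft ℂ (1 - g' * g')).rTensor P₂ (ℓ₂ genU)) := by
  have hd : defect (TensorProduct.map f₁₂ f₁₂ ∘ₗ ℓ₁) genU = 1 - g' * g' :=
    defect_genU (by simp [h₁, hg])
  simp only [pullbackGlue, LinearMap.add_apply, LinearMap.comp_apply, comul_genU, h₁,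
    TensorProduct.map_tmul, hd, LinearEquiv.coe_coe, rTensor_mul'_assoc_symm]
  simp [hg]

lemma pullbackGlue_genU_of_add {ℓ₁ : CZ2 →ₗ[ℂ] P₁ ⊗[ℂ] P₁} {ℓ₂ : CZ2 →ₗ[ℂ] P₂ ⊗[ℂ] P₂}
    {f₁₂ : P₁ →ₗ[ℂ] P₂} {f₂₁ : P₂ →ₗ[ℂ] P₁} {g : P₁} {g' l₀ r₀ l₁ r₁ : P₂}
    (h₁ : ℓ₁ genU = g ⊗ₜ[ℂ] g) (hg : f₁₂ g = g')
    (h₂ : ℓ₂ genU = l₀ ⊗ₜ[ℂ] r₀ + l₁ ⊗ₜ[ℂ] r₁) :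
    pullbackGlue ℓ₁ ℓ₂ f₁₂ f₂₁ genU = (g, g') ⊗ₜ[ℂ] (g, g') +
      ((0, (1 - g' * g') * l₀) ⊗ₜ[ℂ] (f₂₁ r₀, r₀) +
        (0, (1 - g' * g') * l₁) ⊗ₜ[ℂ] (f₂₁ r₁, r₁)) := by
  rw [pullbackGlue_genU h₁ hg, h₂, map_add, map_add]
  rfl

lemma defectProd_cons_one {a : CZ2 →ₗ[ℂ] P ⊗[ℂ] P} (L : List (CZ2 →ₗ[ℂ] P ⊗[ℂ] P))
    (ha : a 1 = 1 ⊗ₜ[ℂ] 1) : defectProd (a :: L) 1 = 0 := by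
  simp only [defectProd, LinearMap.comp_apply, comul_one, TensorProduct.map_tmul, defect_one ha,
    TensorProduct.zero_tmul, map_zero]

lemma defectProd_cons_genU {a : CZ2 →ₗ[ℂ] P ⊗[ℂ] P} (L : List (CZ2 →ₗ[ℂ] P ⊗[ℂ] P)) {g : P}
    (ha : a genU = g ⊗ₜ[ℂ] g) : defectProd (a :: L) genU = (1 - g * g) * defectProd L genU := by
  simp only [defectProd, LinearMap.comp_apply, comul_genU, TensorProduct.map_tmul, defect_genU ha,
    LinearMap.mul'_apply]

lemma defectProd_nil_one : defectProd ([] : List (CZ2 →ₗ[ℂ] P ⊗[ℂ] P)) 1 = 1 := by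
  simp [defectProd]

lemma defectProd_nil_genU : defectProd ([] : List (CZ2 →ₗ[ℂ] P ⊗[ℂ] P)) genU = 1 := by
  simp [defectProd, counit_genU]

lemma piecewiseGlue_cons_one {a : CZ2 →ₗ[ℂ] P ⊗[ℂ] P} (L : List (CZ2 →ₗ[ℂ] P ⊗[ℂ] P))
    (ha : a 1 = 1 ⊗ₜ[ℂ] 1) :
    piecewiseGlue (a :: L) 1 = 1 ⊗ₜ[ℂ] defectProd L 1 + piecewiseGlue L 1 := by
  simp only [piecewiseGlue, LinearMap.add_apply, LinearMap.comp_apply, comul_one,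
    TensorProduct.map_tmul, LinearEquiv.coe_coe, lTensor_mul'_assoc, ha]
  simp

lemma piecewiseGlue_cons_genU {a : CZ2 →ₗ[ℂ] P ⊗[ℂ] P} (L : List (CZ2 →ₗ[ℂ] P ⊗[ℂ] P)) {g : P}
    (ha : a genU = g ⊗ₜ[ℂ] g) :
    piecewiseGlue (a :: L) genU =
      g ⊗ₜ[ℂ] (g * defectProd L genU) + piecewiseGlue L genU := by
  simp only [piecewiseGlue, LinearMap.add_apply, LinearMap.comp_apply, comul_genU,
    TensorProduct.map_tmul, LinearEquiv.coe_coe, lTensor_mul'_assoc, ha]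
  simp

end Glue

/-! ### The pieces -/

/-- The element `1 ⊗ u` of `𝒯 ⊗ C(ℤ₂)`. -/
def uTZ : TZ := 1 ⊗ₜ[ℂ] genU

lemma uTZ_mul_uTZ : uTZ * uTZ = 1 := by
  rw [uTZ, Algebra.TensorProduct.tmul_mul_tmul, one_mul, genU_mul_genU,
    Algebra.TensorProduct.one_def]

lemma negTZ_uTZ : negTZ uTZ = -uTZ := by
  rw [uTZ, negTZ_tmul, map_one, negPull_genU, TensorProduct.tmul_neg]

/-- The strong connection on `𝒯 ⊗ C(ℤ₂)` with `u ↦ (1 ⊗ u) ⊗ (1 ⊗ u)`. -/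
def connTZ : CZ2 →ₗ[ℂ] TZ ⊗[ℂ] TZ := ofOneGenU (1 ⊗ₜ[ℂ] 1) (uTZ ⊗ₜ[ℂ] uTZ)

lemma connTZ_one : connTZ 1 = 1 ⊗ₜ[ℂ] 1 := ofOneGenU_one _ _

lemma connTZ_genU : connTZ genU = uTZ ⊗ₜ[ℂ] uTZ := ofOneGenU_genU _ _

theorem isStrongConnection_connTZ : IsStrongConnection coactionTZ connTZ :=
  isStrongConnection_of_odd negTZ negTZ_negTZ (ι := Unit) (l := fun _ => uTZ) (r := fun _ => uTZ)
    (fun _ => negTZ_uTZ) (fun _ => negTZ_uTZ) (by simp [uTZ_mul_uTZ]) connTZ_one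
    (by simp [connTZ_genU])

/-- Evaluation at a point. -/
def CFun.evalHom {X : Type*} [TopologicalSpace X] (x : X) : CFun X →ₐ[ℂ] ℂ :=
  (ContinuousMap.evalAlgHom ℂ ℂ x : C(X, ℂ) →ₐ[ℂ] ℂ)

@[simp] lemma CFun.evalHom_apply {X : Type*} [TopologicalSpace X] (x : X) (f : CFun X) :
    CFun.evalHom x f = f x := rfl

/-- The character of `𝒯 ⊗ C(ℤ₂)` given by a point of the circle and a point of `ℤ₂`. -/
def charTZ (z : Circle) (k : ℤˣ) : TZ →ₐ[ℂ] ℂ :=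
  Algebra.TensorProduct.productMap
    ((CFun.evalHom z).comp Toeplitz.symbol)
    (CFun.evalHom k)

lemma charTZ_tmul (z : Circle) (k : ℤˣ) (x : Toeplitz) (f : CZ2) :
    charTZ z k (x ⊗ₜ[ℂ] f) = Toeplitz.symbol x z * f k := rfl

lemma charTZ_uTZ (z : Circle) (k : ℤˣ) : charTZ z k uTZ = (k : ℤ) := by
  rw [uTZ, charTZ_tmul, map_one, CFun.one_apply, one_mul, genU_apply]

lemma uTZ_ne_zero : uTZ ≠ 0 := fun h => by
  simpa [charTZ_uTZ] using congrArg (charTZ 1 1) h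

lemma tmul_genU_eq_zero {x : Toeplitz} (h : x ⊗ₜ[ℂ] genU = (0 : TZ)) : x = 0 := by
  -- The functional `ofOneGenU 0 1` reads off the coefficient of `u`.
  have h1 := congrArg (fun w => TensorProduct.rid ℂ Toeplitz
    ((ofOneGenU (0 : ℂ) 1).lTensor Toeplitz w)) h
  simpa using h1

/-! ### Admissible pairs -/

lemma charZI_sigma1 (k : ℤˣ) (t : UI) (x : Toeplitz) :
    Algebra.TensorProduct.productMap (CFun.evalHom k) (CFun.evalHom t) (sigma1 x) =
      Toeplitz.symbol x (delta1 k t) := by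
  rw [sigma1_apply, map_add, Algebra.TensorProduct.productMap_apply_tmul,
    Algebra.TensorProduct.productMap_apply_tmul]
  rcases Int.units_eq_one_or k with rfl | rfl <;> simp [side1_apply]

/-- The character of `C(I) ⊗ C(ℤ₂) ⊗ C(ℤ₂)` given by a point. -/
def charIZZ (t : UI) (k h : ℤˣ) : (CI ⊗[ℂ] CZ2) ⊗[ℂ] CZ2 →ₐ[ℂ] ℂ :=
  Algebra.TensorProduct.productMap
    (Algebra.TensorProduct.productMap (CFun.evalHom t) (CFun.evalHom k)) (CFun.evalHom h)

lemma charIZZ_tmul (t : UI) (k h : ℤˣ) (f : CI) (a b : CZ2) :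
    charIZZ t k h ((f ⊗ₜ[ℂ] a) ⊗ₜ[ℂ] b) = f t * a k * b h := rfl

lemma one_ne_zero_IZZ : (1 : (CI ⊗[ℂ] CZ2) ⊗[ℂ] CZ2) ≠ 0 := fun h => by
  simpa using congrArg (charIZZ (endPt 1) 1 1) h

lemma one_ne_zero_ZIZ : (1 : (CZ2 ⊗[ℂ] CI) ⊗[ℂ] CZ2) ≠ 0 := fun h => by
  apply one_ne_zero_IZZ
  rw [← map_one Phi02, h, map_zero]

lemma algHom_uTZ_ne_zero {Q : Type*} [Ring Q] [Algebra ℂ Q] (hQ : (1 : Q) ≠ 0) (f : TZ →ₐ[ℂ] Q) :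
    f uTZ ≠ 0 := fun h => hQ (by rw [← map_one f, ← uTZ_mul_uTZ, map_mul, h, zero_mul])

lemma one_sub_sq_mul_tmul (a b : Toeplitz) (f : CZ2) :
    (1 - (a ⊗ₜ[ℂ] (1 : CZ2)) * a ⊗ₜ[ℂ] (1 : CZ2)) * b ⊗ₜ[ℂ] f = ((1 - a ^ 2) * b) ⊗ₜ[ℂ] f := by
  rw [Algebra.TensorProduct.tmul_mul_tmul, Algebra.TensorProduct.one_def, one_mul,
    ← TensorProduct.sub_tmul, Algebra.TensorProduct.tmul_mul_tmul, one_mul, pow_two]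

lemma one_sub_sq_mul_uTZ (a : Toeplitz) :
    (1 - (a ⊗ₜ[ℂ] (1 : CZ2)) * a ⊗ₜ[ℂ] (1 : CZ2)) * uTZ = (1 - a ^ 2) ⊗ₜ[ℂ] genU := by
  rw [uTZ, one_sub_sq_mul_tmul, mul_one]

lemma tmul_mul_one_sub_sq (a b : Toeplitz) (f : CZ2) :
    b ⊗ₜ[ℂ] f * (1 - (a ⊗ₜ[ℂ] (1 : CZ2)) * a ⊗ₜ[ℂ] (1 : CZ2)) = (b * (1 - a ^ 2)) ⊗ₜ[ℂ] f := by
  rw [Algebra.TensorProduct.tmul_mul_tmul, Algebra.TensorProduct.one_def, mul_one,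
    ← TensorProduct.sub_tmul, Algebra.TensorProduct.tmul_mul_tmul, mul_one, pow_two]

lemma sigma1Id_tmul' (x : Toeplitz) (f : CZ2) : sigma1Id (x ⊗ₜ[ℂ] f) = sigma1 x ⊗ₜ[ℂ] f := rfl

lemma sigma2Id_tmul' (x : Toeplitz) (f : CZ2) : sigma2Id (x ⊗ₜ[ℂ] f) = sigma2 x ⊗ₜ[ℂ] f := rfl

lemma sigma1Id_uTZ : sigma1Id uTZ = (1 ⊗ₜ[ℂ] 1) ⊗ₜ[ℂ] genU := by
  rw [uTZ, sigma1Id_tmul', map_one, Algebra.TensorProduct.one_def]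

lemma sigma2Id_uTZ : sigma2Id uTZ = (1 ⊗ₜ[ℂ] 1) ⊗ₜ[ℂ] genU := by
  rw [uTZ, sigma2Id_tmul', map_one, Algebra.TensorProduct.one_def]

namespace IsPhiPair

variable {φ₁ φ₂ : Toeplitz}

lemma negTZ_fst (h : IsPhiPair φ₁ φ₂) : negTZ (φ₁ ⊗ₜ[ℂ] 1) = -(φ₁ ⊗ₜ[ℂ] 1) := by
  have h1 : Toeplitz.neg φ₁ = -φ₁ := (involutionCoaction_eq_tmul_genU_iff _ _ _).1 h.odd₁
  rw [negTZ_tmul, h1, map_one, TensorProduct.neg_tmul]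

lemma negTZ_snd (h : IsPhiPair φ₁ φ₂) : negTZ (φ₂ ⊗ₜ[ℂ] 1) = -(φ₂ ⊗ₜ[ℂ] 1) := by
  have h1 : Toeplitz.neg φ₂ = -φ₂ := (involutionCoaction_eq_tmul_genU_iff _ _ _).1 h.odd₂
  rw [negTZ_tmul, h1, map_one, TensorProduct.neg_tmul]

lemma symbol_fst (h : IsPhiPair φ₁ φ₂) (k : ℤˣ) (t : UI) :
    Toeplitz.symbol φ₁ (delta1 k t) = (k : ℤ) := by
  rw [← charZI_sigma1, h.sigma1_fst, Algebra.TensorProduct.productMap_apply_tmul]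
  simp

lemma symbol_snd (h : IsPhiPair φ₁ φ₂) (k : ℤˣ) (t : UI) :
    Toeplitz.symbol φ₂ (delta1 k t) = (t : ℝ) := by
  rw [← charZI_sigma1, h.sigma1_snd, Algebra.TensorProduct.productMap_apply_tmul]
  simp [iotaI]

/-- `1 ⊗ u`, `φ₁ ⊗ 1` and `φ₂ ⊗ 1` are linearly independent. -/
lemma eq_zero_of_combination (h : IsPhiPair φ₁ φ₂) {a b c : ℂ}
    (habc : a • uTZ + b • φ₁ ⊗ₜ[ℂ] (1 : CZ2) + c • φ₂ ⊗ₜ[ℂ] (1 : CZ2) = 0) :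
    a = 0 ∧ b = 0 ∧ c = 0 := by
  -- At the corner `(k, l)` and the point `m` of `ℤ₂` the three elements take the values `m`, `k`,
  -- `l`, and these signs can be chosen independently.
  have key (k l m : ℤˣ) : a * (m : ℤ) + b * (k : ℤ) + c * (l : ℤ) = 0 := by
    have h1 := congrArg (charTZ (delta1 k (endPt l)) m) habc
    rw [map_add, map_add, map_smul, map_smul, map_smul, charTZ_uTZ, charTZ_tmul, charTZ_tmul,
      h.symbol_fst, h.symbol_snd] at h1
    simpa using h1
  have h1 := key 1 1 1
  have h2 := key 1 1 (-1)
  have h3 := key 1 (-1) 1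
  have h4 := key (-1) 1 1
  push_cast at h1 h2 h3 h4
  exact ⟨by linear_combination (h1 - h2) / 2, by linear_combination (h1 - h4) / 2,
    by linear_combination (h1 - h3) / 2⟩

/-- The element `(1 ⊗ u, φ₁ ⊗ 1, φ₁ ⊗ 1)` of the sphere. -/
def gamma0 (h : IsPhiPair φ₁ φ₂) : Sphere :=
  ⟨(uTZ, φ₁ ⊗ₜ[ℂ] 1, φ₁ ⊗ₜ[ℂ] 1), by
    simp [mem_Sphere, sigma1Id_tmul', sigma2Id_tmul', sigma1Id_uTZ, sigma2Id_uTZ, h.sigma1_fst,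
      h.sigma2_fst]⟩

/-- The element `(φ₁ ⊗ 1, 1 ⊗ u, φ₂ ⊗ 1)` of the sphere. -/
def gamma1 (h : IsPhiPair φ₁ φ₂) : Sphere :=
  ⟨(φ₁ ⊗ₜ[ℂ] 1, uTZ, φ₂ ⊗ₜ[ℂ] 1), by
    simp [mem_Sphere, sigma1Id_tmul', sigma2Id_tmul', sigma1Id_uTZ, sigma2Id_uTZ, h.sigma1_fst,
      h.sigma2_fst, h.sigma1_snd, h.sigma2_snd]⟩

/-- The element `(φ₂ ⊗ 1, φ₂ ⊗ 1, 1 ⊗ u)` of the sphere. -/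
def gamma2 (h : IsPhiPair φ₁ φ₂) : Sphere :=
  ⟨(φ₂ ⊗ₜ[ℂ] 1, φ₂ ⊗ₜ[ℂ] 1, uTZ), by
    simp [mem_Sphere, sigma1Id_tmul', sigma2Id_tmul', sigma1Id_uTZ, sigma2Id_uTZ, h.sigma1_snd,
      h.sigma2_snd]⟩

lemma coe_gamma0 (h : IsPhiPair φ₁ φ₂) :
    (h.gamma0 : TZ3) = (uTZ, φ₁ ⊗ₜ[ℂ] 1, φ₁ ⊗ₜ[ℂ] 1) := rfl

lemma coe_gamma1 (h : IsPhiPair φ₁ φ₂) :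
    (h.gamma1 : TZ3) = (φ₁ ⊗ₜ[ℂ] 1, uTZ, φ₂ ⊗ₜ[ℂ] 1) := rfl

lemma coe_gamma2 (h : IsPhiPair φ₁ φ₂) :
    (h.gamma2 : TZ3) = (φ₂ ⊗ₜ[ℂ] 1, φ₂ ⊗ₜ[ℂ] 1, uTZ) := rfl

/-- The element `(1 ⊗ u, φ₁ ⊗ 1)` of `P01`. -/
def leg0 (h : IsPhiPair φ₁ φ₂) : P01 :=
  ⟨(uTZ, φ₁ ⊗ₜ[ℂ] 1), by simp [mem_P01, sigma1Id_tmul', sigma1Id_uTZ, h.sigma1_fst]⟩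

/-- The element `(φ₁ ⊗ 1, 1 ⊗ u)` of `P01`. -/
def leg1 (h : IsPhiPair φ₁ φ₂) : P01 :=
  ⟨(φ₁ ⊗ₜ[ℂ] 1, uTZ), by simp [mem_P01, sigma1Id_tmul', sigma1Id_uTZ, h.sigma1_fst]⟩

/-- The element `(φ₂ ⊗ 1, φ₂ ⊗ 1)` of `P01`. -/
def leg2 (h : IsPhiPair φ₁ φ₂) : P01 :=
  ⟨(φ₂ ⊗ₜ[ℂ] 1, φ₂ ⊗ₜ[ℂ] 1), by simp [mem_P01, sigma1Id_tmul', h.sigma1_snd]⟩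

lemma coe_leg0 (h : IsPhiPair φ₁ φ₂) : (h.leg0 : TZ2) = (uTZ, φ₁ ⊗ₜ[ℂ] 1) := rfl

lemma coe_leg1 (h : IsPhiPair φ₁ φ₂) : (h.leg1 : TZ2) = (φ₁ ⊗ₜ[ℂ] 1, uTZ) := rfl

lemma coe_leg2 (h : IsPhiPair φ₁ φ₂) : (h.leg2 : TZ2) = (φ₂ ⊗ₜ[ℂ] 1, φ₂ ⊗ₜ[ℂ] 1) := rfl

end IsPhiPair

/-- The involution of `P01`. -/
abbrev negP01 : P01 →ₐ[ℂ] P01 := (neg2.comp P01.val).codRestrict P01 fun x => neg2_mem x x.2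

lemma negP01_negP01 (x : P01) : negP01 (negP01 x) = x := Subtype.ext (by
  change neg2 (neg2 (x : TZ2)) = x
  simp [negTZ_negTZ])

/-- The involution of the quantum sphere. -/
abbrev negSphere : Sphere →ₐ[ℂ] Sphere :=
  (neg3.comp Sphere.val).codRestrict Sphere fun x => neg3_mem x x.2

lemma negSphere_negSphere (x : Sphere) : negSphere (negSphere x) = x := Subtype.ext (by
  change neg3 (neg3 (x : TZ3)) = x
  simp [negTZ_negTZ])

/-! ### Oddness of the legs, and the iterated gluing. -/

namespace IsPhiPair

variable {φ₁ φ₂ : Toeplitz}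

lemma negSphere_gamma0 (h : IsPhiPair φ₁ φ₂) : negSphere h.gamma0 = -h.gamma0 :=
  Subtype.ext (Prod.ext negTZ_uTZ (Prod.ext h.negTZ_fst h.negTZ_fst))

lemma negSphere_gamma1 (h : IsPhiPair φ₁ φ₂) : negSphere h.gamma1 = -h.gamma1 :=
  Subtype.ext (Prod.ext h.negTZ_fst (Prod.ext negTZ_uTZ h.negTZ_snd))

lemma negSphere_gamma2 (h : IsPhiPair φ₁ φ₂) : negSphere h.gamma2 = -h.gamma2 :=
  Subtype.ext (Prod.ext h.negTZ_snd (Prod.ext h.negTZ_snd negTZ_uTZ))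

lemma negP01_leg0 (h : IsPhiPair φ₁ φ₂) : negP01 h.leg0 = -h.leg0 :=
  Subtype.ext (Prod.ext negTZ_uTZ h.negTZ_fst)

lemma negP01_leg1 (h : IsPhiPair φ₁ φ₂) : negP01 h.leg1 = -h.leg1 :=
  Subtype.ext (Prod.ext h.negTZ_fst negTZ_uTZ)

lemma negP01_leg2 (h : IsPhiPair φ₁ φ₂) : negP01 h.leg2 = -h.leg2 :=
  Subtype.ext (Prod.ext h.negTZ_snd h.negTZ_snd)

/-! ### Gluing along the first two pieces -/

/-- Both maps into the common quotient are surjective, so the range condition is free. The condition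
`σ₁(φ₁) = u ⊗ 1` says that `φ₁ ⊗ 1` is an admissible value at `1 ⊗ u` in both directions. -/
lemma exists_isGluingMap_pieces (h : IsPhiPair φ₁ φ₂) : ∃ f₀₁ f₁₀ : TZ →ₗ[ℂ] TZ,
    IsGluingMap coactionTZ coactionTZ sigma1Id (Phi01.comp sigma1Id) f₀₁ ∧
    IsGluingMap coactionTZ coactionTZ (Phi01.comp sigma1Id) sigma1Id f₁₀ ∧
    f₀₁ uTZ = φ₁ ⊗ₜ[ℂ] 1 ∧ f₁₀ uTZ = φ₁ ⊗ₜ[ℂ] 1 := by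
  have e1 : (Phi01.comp sigma1Id) (φ₁ ⊗ₜ[ℂ] 1) = sigma1Id uTZ := by
    simp [sigma1Id_tmul', sigma1Id_uTZ, h.sigma1_fst]
  have e2 : sigma1Id (φ₁ ⊗ₜ[ℂ] 1) = (Phi01.comp sigma1Id) uTZ := by
    simp [sigma1Id_tmul', sigma1Id_uTZ, h.sigma1_fst]
  have hneg : ∀ p, (Phi01.comp sigma1Id) (negTZ p) = negZIZ ((Phi01.comp sigma1Id) p) := fun p => by
    rw [AlgHom.comp_apply, sigma1Id_neg, Phi01_neg]; rfl
  obtain ⟨f, hf, hfu⟩ := exists_isGluingMap negTZ_negTZ negTZ_negTZ negZIZ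
    (π := sigma1Id) (π' := Phi01.comp sigma1Id) sigma1Id_neg hneg
    (fun q _ => Phi01_sigma1Id_surjective q) (fun _ : Unit => uTZ) (fun _ => φ₁ ⊗ₜ[ℂ] 1)
    (fun _ => e1) (fun _ => negTZ_uTZ) (fun _ => h.negTZ_fst)
    (linearIndependent_unique_iff.2 (algHom_uTZ_ne_zero one_ne_zero_ZIZ _)) one_ne_zero_ZIZ
  obtain ⟨g, hg, hgu⟩ := exists_isGluingMap negTZ_negTZ negTZ_negTZ negZIZ
    (π := Phi01.comp sigma1Id) (π' := sigma1Id) hneg sigma1Id_neg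
    (fun q _ => sigma1Id_surjective q) (fun _ : Unit => uTZ) (fun _ => φ₁ ⊗ₜ[ℂ] 1)
    (fun _ => e2) (fun _ => negTZ_uTZ) (fun _ => h.negTZ_fst)
    (linearIndependent_unique_iff.2 (algHom_uTZ_ne_zero one_ne_zero_ZIZ _)) one_ne_zero_ZIZ
  exact ⟨f, g, hf, hg, hfu (), hgu ()⟩

/-- The strong connection on `P01` with
`u ↦ (1 ⊗ u, φ₁ ⊗ 1) ⊗ (1 ⊗ u, φ₁ ⊗ 1) + (0, (1 - φ₁²) ⊗ u) ⊗ (φ₁ ⊗ 1, 1 ⊗ u)`. -/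
def connP01 (h : IsPhiPair φ₁ φ₂) : CZ2 →ₗ[ℂ] P01 ⊗[ℂ] P01 :=
  ofOneGenU (1 ⊗ₜ[ℂ] 1)
    (h.leg0 ⊗ₜ[ℂ] h.leg0 + ((1 - h.leg0 * h.leg0) * h.leg1) ⊗ₜ[ℂ] h.leg1)

lemma connP01_one (h : IsPhiPair φ₁ φ₂) : h.connP01 1 = 1 ⊗ₜ[ℂ] 1 := ofOneGenU_one _ _

lemma connP01_genU (h : IsPhiPair φ₁ φ₂) : h.connP01 genU =
    h.leg0 ⊗ₜ[ℂ] h.leg0 + ((1 - h.leg0 * h.leg0) * h.leg1) ⊗ₜ[ℂ] h.leg1 := ofOneGenU_genU _ _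

lemma coe_one_sub_leg0_sq_mul_leg1 (h : IsPhiPair φ₁ φ₂) :
    (((1 - h.leg0 * h.leg0) * h.leg1 : P01) : TZ2) = (0, (1 - φ₁ ^ 2) ⊗ₜ[ℂ] genU) := by
  simp only [Subalgebra.coe_mul, Subalgebra.coe_sub, Subalgebra.coe_one, coe_leg0, coe_leg1,
    Prod.mk_mul_mk, Prod.one_eq_mk, Prod.mk_sub_mk, uTZ_mul_uTZ, sub_self, zero_mul]
  rw [one_sub_sq_mul_uTZ]

lemma isStrongConnection_connP01 (h : IsPhiPair φ₁ φ₂) :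
    IsStrongConnection coactionP01 h.connP01 := by
  -- Each factor vanishes in the component where its leg is `1 ⊗ u`.
  have hz : (1 - h.leg0 * h.leg0) * (1 - h.leg1 * h.leg1) = 0 := by
    apply Subtype.ext
    simp only [Subalgebra.coe_mul, Subalgebra.coe_sub, Subalgebra.coe_one, Subalgebra.coe_zero,
      coe_leg0, coe_leg1, Prod.mk_mul_mk, Prod.one_eq_mk, Prod.mk_sub_mk, uTZ_mul_uTZ, sub_self,
      zero_mul, mul_zero, Prod.mk_zero_zero]
  refine isStrongConnection_of_odd negP01 negP01_negP01
    (l := ![h.leg0, (1 - h.leg0 * h.leg0) * h.leg1]) (r := ![h.leg0, h.leg1]) ?_ ?_ ?_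
    h.connP01_one ?_
  · simp only [Fin.forall_fin_two, Matrix.cons_val_zero, Matrix.cons_val_one]
    exact ⟨h.negP01_leg0, map_mul_of_even_of_odd (map_one_sub_sq_of_odd h.negP01_leg0) h.negP01_leg1⟩
  · simp only [Fin.forall_fin_two, Matrix.cons_val_zero, Matrix.cons_val_one]
    exact ⟨h.negP01_leg0, h.negP01_leg1⟩
  · rw [Fin.sum_univ_two]
    simp only [Matrix.cons_val_zero, Matrix.cons_val_one]
    rw [mul_assoc]
    rw [mul_sub, mul_one, sub_eq_zero] at hz
    rw [← hz]
    abel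
  · rw [Fin.sum_univ_two]
    exact h.connP01_genU

lemma map_val_connP01_genU (h : IsPhiPair φ₁ φ₂) :
    TensorProduct.map P01.val.toLinearMap P01.val.toLinearMap (h.connP01 genU) =
      ((uTZ, φ₁ ⊗ₜ[ℂ] 1) : TZ2) ⊗ₜ[ℂ] ((uTZ, φ₁ ⊗ₜ[ℂ] 1) : TZ2) +
      ((0, (1 - φ₁ ^ 2) ⊗ₜ[ℂ] genU) : TZ2) ⊗ₜ[ℂ] ((φ₁ ⊗ₜ[ℂ] 1, uTZ) : TZ2) := by
  rw [connP01_genU, map_add, TensorProduct.map_tmul, TensorProduct.map_tmul,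
    ← coe_one_sub_leg0_sq_mul_leg1 h]
  rfl

/-- The formula sees the gluing maps only through their values at `1` and `1 ⊗ u`, so it gives the
same connection for every choice with these values. -/
lemma map_val_comp_connP01 (h : IsPhiPair φ₁ φ₂) {f₀₁ f₁₀ : TZ →ₗ[ℂ] TZ} (h1 : f₀₁ 1 = 1)
    (hf : f₀₁ uTZ = φ₁ ⊗ₜ[ℂ] 1) (hg : f₁₀ uTZ = φ₁ ⊗ₜ[ℂ] 1) :
    TensorProduct.map P01.val.toLinearMap P01.val.toLinearMap ∘ₗ h.connP01 =
      pullbackGlue connTZ connTZ f₀₁ f₁₀ := by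
  apply CZ2.linearMap_ext
  · rw [pullbackGlue_one connTZ_one h1, LinearMap.comp_apply, connP01_one, TensorProduct.map_tmul]
    rfl
  · have e : (f₁₀.prod LinearMap.id) uTZ = (φ₁ ⊗ₜ[ℂ] 1, uTZ) := Prod.ext hg rfl
    rw [pullbackGlue_genU connTZ_genU hf, LinearMap.comp_apply, map_val_connP01_genU, connTZ_genU,
      LinearMap.rTensor_tmul, TensorProduct.map_tmul, LinearMap.mulLeft_apply,
      one_sub_sq_mul_uTZ, LinearMap.inr_apply, e]

/-! ### Gluing along the iterated pullback -/

lemma exists_isGluingMap_iterated (h : IsPhiPair φ₁ φ₂) :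
    ∃ (f₂ : TZ →ₗ[ℂ] P01) (g₂ : P01 →ₗ[ℂ] TZ),
      IsGluingMap coactionTZ coactionP01 beta1 beta2 f₂ ∧
      IsGluingMap coactionP01 coactionTZ beta2 beta1 g₂ ∧
      f₂ uTZ = h.leg2 ∧ g₂ h.leg0 = φ₁ ⊗ₜ[ℂ] 1 ∧ g₂ h.leg1 = φ₂ ⊗ₜ[ℂ] 1 := by
  have hone : (1 : ((CI ⊗[ℂ] CZ2) ⊗[ℂ] CZ2) × ((CI ⊗[ℂ] CZ2) ⊗[ℂ] CZ2)) ≠ 0 := fun h =>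
    one_ne_zero_IZZ (congrArg Prod.fst h)
  let τ : ((CI ⊗[ℂ] CZ2) ⊗[ℂ] CZ2) × ((CI ⊗[ℂ] CZ2) ⊗[ℂ] CZ2) →ₐ[ℂ]
      ((CI ⊗[ℂ] CZ2) ⊗[ℂ] CZ2) × ((CI ⊗[ℂ] CZ2) ⊗[ℂ] CZ2) :=
    (negIZZ.comp (AlgHom.fst ℂ _ _)).prod (negIZZ.comp (AlgHom.snd ℂ _ _))
  have h1 : ∀ p, beta1 (negTZ p) = τ (beta1 p) := fun p => by
    change (Phi02 (sigma1Id (negTZ p)), Phi12 (sigma2Id (negTZ p))) =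
      (negIZZ (Phi02 (sigma1Id p)), negIZZ (Phi12 (sigma2Id p)))
    rw [sigma1Id_neg, sigma2Id_neg, Phi02_neg, Phi12_neg]
  have h2 : ∀ p, beta2 (negP01 p) = τ (beta2 p) := fun p => by
    change (sigma2Id (negTZ (p : TZ2).1), sigma2Id (negTZ (p : TZ2).2)) =
      (negIZZ (sigma2Id (p : TZ2).1), negIZZ (sigma2Id (p : TZ2).2))
    rw [sigma2Id_neg, sigma2Id_neg]
  have b1 : ∀ x : TZ, beta1 x = (Phi02 (sigma1Id x), Phi12 (sigma2Id x)) := fun _ => rfl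
  have b2 : ∀ x : P01, beta2 x = (sigma2Id (x : TZ2).1, sigma2Id (x : TZ2).2) := fun _ => rfl
  have e2 : beta2 h.leg2 = beta1 uTZ := by
    simp [b1, b2, coe_leg2, sigma2Id_tmul', sigma1Id_uTZ, sigma2Id_uTZ, h.sigma2_snd]
  have e0 : beta1 (φ₁ ⊗ₜ[ℂ] 1) = beta2 h.leg0 := by
    simp [b1, b2, coe_leg0, sigma1Id_tmul', sigma2Id_tmul', sigma2Id_uTZ, h.sigma1_fst,
      h.sigma2_fst]
  have e1 : beta1 (φ₂ ⊗ₜ[ℂ] 1) = beta2 h.leg1 := by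
    simp [b1, b2, coe_leg1, sigma1Id_tmul', sigma2Id_tmul', sigma2Id_uTZ, h.sigma1_snd,
      h.sigma2_snd, h.sigma2_fst]
  -- Two values of the second gluing map are prescribed, so their symbols must be independent. Over
  -- a fixed corner the first takes the values `±1` on the two points of `ℤ₂`, and the second is
  -- constantly `1`.
  have hind : LinearIndependent ℂ fun i => beta2 (![h.leg0, h.leg1] i) := by
    rw [Fintype.linearIndependent_iff]
    intro c hc
    rw [Fin.sum_univ_two] at hc
    have key (k : ℤˣ) : c 0 * (k : ℤ) + c 1 = 0 := by
      have h3 := congrArg (fun q => charIZZ (endPt 1) 1 k q.1) hc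
      simpa [b2, coe_leg0, coe_leg1, sigma2Id_tmul', sigma2Id_uTZ, h.sigma2_fst, charIZZ_tmul,
        iotaI] using h3
    have k1 := key 1
    have k2 := key (-1)
    push_cast at k1 k2
    rw [Fin.forall_fin_two]
    exact ⟨by linear_combination (k1 - k2) / 2, by linear_combination (k1 + k2) / 2⟩
  obtain ⟨f, hf, hfu⟩ := exists_isGluingMap negTZ_negTZ negP01_negP01 τ h1 h2 range_beta1_le
    (fun _ : Unit => uTZ) (fun _ => h.leg2) (fun _ => e2) (fun _ => negTZ_uTZ)
    (fun _ => h.negP01_leg2) (linearIndependent_unique_iff.2 (algHom_uTZ_ne_zero hone _)) hone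
  obtain ⟨g, hg, hgu⟩ := exists_isGluingMap negP01_negP01 negTZ_negTZ τ h2 h1 range_beta2_le
    ![h.leg0, h.leg1] ![φ₁ ⊗ₜ[ℂ] 1, φ₂ ⊗ₜ[ℂ] 1]
    (by rw [Fin.forall_fin_two]; exact ⟨e0, e1⟩)
    (by rw [Fin.forall_fin_two]; exact ⟨h.negP01_leg0, h.negP01_leg1⟩)
    (by rw [Fin.forall_fin_two]; exact ⟨h.negTZ_fst, h.negTZ_snd⟩) hind hone
  exact ⟨f, g, hf, hg, hfu (), hgu 0, hgu 1⟩

end IsPhiPair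

/-! ### The legs on the sphere -/

namespace IsPhiPair

variable {φ₁ φ₂ : Toeplitz}

lemma one_sub_sq_mul_eq_zero (h : IsPhiPair φ₁ φ₂) :
    (1 - h.gamma2 * h.gamma2) *
      ((1 - h.gamma0 * h.gamma0) * (1 - h.gamma1 * h.gamma1)) = 0 := by
  apply Subtype.ext
  simp only [Subalgebra.coe_mul, Subalgebra.coe_sub, Subalgebra.coe_one, Subalgebra.coe_zero,
    coe_gamma0, coe_gamma1, coe_gamma2, Prod.mk_mul_mk, Prod.one_eq_mk, Prod.mk_sub_mk,
    uTZ_mul_uTZ, sub_self, zero_mul, mul_zero, Prod.mk_zero_zero]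

lemma one_sub_sq_mul_eq_zero' (h : IsPhiPair φ₁ φ₂) :
    (1 - h.gamma0 * h.gamma0) *
      ((1 - h.gamma1 * h.gamma1) * (1 - h.gamma2 * h.gamma2)) = 0 := by
  apply Subtype.ext
  simp only [Subalgebra.coe_mul, Subalgebra.coe_sub, Subalgebra.coe_one, Subalgebra.coe_zero,
    coe_gamma0, coe_gamma1, coe_gamma2, Prod.mk_mul_mk, Prod.one_eq_mk, Prod.mk_sub_mk,
    uTZ_mul_uTZ, sub_self, zero_mul, mul_zero, Prod.mk_zero_zero]

/-- The left legs of the strong connection obtained by gluing iteratively. -/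
def leftLegs (h : IsPhiPair φ₁ φ₂) : Fin 3 → Sphere :=
  ![h.gamma2, (1 - h.gamma2 * h.gamma2) * h.gamma0,
    (1 - h.gamma2 * h.gamma2) * ((1 - h.gamma0 * h.gamma0) * h.gamma1)]

/-- The right legs of the strong connection obtained by gluing iteratively. -/
def rightLegs (h : IsPhiPair φ₁ φ₂) : Fin 3 → Sphere := ![h.gamma2, h.gamma0, h.gamma1]

/-- The left legs of the strong connection obtained from the splittings of the projections. -/
def leftLegs' (h : IsPhiPair φ₁ φ₂) : Fin 3 → Sphere := ![h.gamma0, h.gamma1, h.gamma2]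

/-- The right legs of the strong connection obtained from the splittings of the projections. -/
def rightLegs' (h : IsPhiPair φ₁ φ₂) : Fin 3 → Sphere :=
  ![h.gamma0 * ((1 - h.gamma1 * h.gamma1) * (1 - h.gamma2 * h.gamma2)),
    h.gamma1 * (1 - h.gamma2 * h.gamma2), h.gamma2]

lemma coe_leftLegs_one (h : IsPhiPair φ₁ φ₂) : (h.leftLegs 1 : TZ3) =
    ((1 - φ₂ ^ 2) ⊗ₜ[ℂ] genU, ((1 - φ₂ ^ 2) * φ₁) ⊗ₜ[ℂ] 1, 0) := by
  change (((1 - h.gamma2 * h.gamma2) * h.gamma0 : Sphere) : TZ3) = _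
  simp only [Subalgebra.coe_mul, Subalgebra.coe_sub, Subalgebra.coe_one, coe_gamma0, coe_gamma2,
    Prod.mk_mul_mk, Prod.one_eq_mk, Prod.mk_sub_mk, uTZ_mul_uTZ, sub_self, zero_mul,
    one_sub_sq_mul_uTZ, one_sub_sq_mul_tmul]

lemma coe_leftLegs_two (h : IsPhiPair φ₁ φ₂) : (h.leftLegs 2 : TZ3) =
    (0, ((1 - φ₂ ^ 2) * (1 - φ₁ ^ 2)) ⊗ₜ[ℂ] genU, 0) := by
  change (((1 - h.gamma2 * h.gamma2) * ((1 - h.gamma0 * h.gamma0) * h.gamma1) : Sphere) : TZ3) = _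
  simp only [Subalgebra.coe_mul, Subalgebra.coe_sub, Subalgebra.coe_one, coe_gamma0, coe_gamma1,
    coe_gamma2, Prod.mk_mul_mk, Prod.one_eq_mk, Prod.mk_sub_mk, uTZ_mul_uTZ, sub_self, zero_mul,
    mul_zero, one_sub_sq_mul_uTZ, one_sub_sq_mul_tmul]

lemma coe_rightLegs'_zero (h : IsPhiPair φ₁ φ₂) : (h.rightLegs' 0 : TZ3) =
    (((1 - φ₁ ^ 2) * (1 - φ₂ ^ 2)) ⊗ₜ[ℂ] genU, 0, 0) := by
  change ((h.gamma0 * ((1 - h.gamma1 * h.gamma1) * (1 - h.gamma2 * h.gamma2)) : Sphere) : TZ3) = _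
  simp only [Subalgebra.coe_mul, Subalgebra.coe_sub, Subalgebra.coe_one, coe_gamma0, coe_gamma1,
    coe_gamma2, Prod.mk_mul_mk, Prod.one_eq_mk, Prod.mk_sub_mk, uTZ_mul_uTZ, sub_self, zero_mul,
    mul_zero]
  rw [uTZ, ← mul_assoc, tmul_mul_one_sub_sq, tmul_mul_one_sub_sq, one_mul]

lemma coe_rightLegs'_one (h : IsPhiPair φ₁ φ₂) : (h.rightLegs' 1 : TZ3) =
    ((φ₁ * (1 - φ₂ ^ 2)) ⊗ₜ[ℂ] 1, (1 - φ₂ ^ 2) ⊗ₜ[ℂ] genU, 0) := by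
  change ((h.gamma1 * (1 - h.gamma2 * h.gamma2) : Sphere) : TZ3) = _
  simp only [Subalgebra.coe_mul, Subalgebra.coe_sub, Subalgebra.coe_one, coe_gamma1,
    coe_gamma2, Prod.mk_mul_mk, Prod.one_eq_mk, Prod.mk_sub_mk, uTZ_mul_uTZ, sub_self, mul_zero,
    tmul_mul_one_sub_sq]
  rw [uTZ, tmul_mul_one_sub_sq, one_mul]

lemma negSphere_leftLegs (h : IsPhiPair φ₁ φ₂) (i : Fin 3) :
    negSphere (h.leftLegs i) = -h.leftLegs i := by
  have e2 := map_one_sub_sq_of_odd h.negSphere_gamma2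
  have e0 := map_one_sub_sq_of_odd h.negSphere_gamma0
  fin_cases i
  · exact h.negSphere_gamma2
  · exact map_mul_of_even_of_odd e2 h.negSphere_gamma0
  · exact map_mul_of_even_of_odd e2 (map_mul_of_even_of_odd e0 h.negSphere_gamma1)

lemma negSphere_rightLegs (h : IsPhiPair φ₁ φ₂) (i : Fin 3) :
    negSphere (h.rightLegs i) = -h.rightLegs i := by
  fin_cases i
  · exact h.negSphere_gamma2
  · exact h.negSphere_gamma0
  · exact h.negSphere_gamma1

lemma negSphere_leftLegs' (h : IsPhiPair φ₁ φ₂) (i : Fin 3) :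
    negSphere (h.leftLegs' i) = -h.leftLegs' i := by
  fin_cases i
  · exact h.negSphere_gamma0
  · exact h.negSphere_gamma1
  · exact h.negSphere_gamma2

lemma negSphere_rightLegs' (h : IsPhiPair φ₁ φ₂) (i : Fin 3) :
    negSphere (h.rightLegs' i) = -h.rightLegs' i := by
  have e2 := map_one_sub_sq_of_odd h.negSphere_gamma2
  have e1 := map_one_sub_sq_of_odd h.negSphere_gamma1
  fin_cases i
  · exact map_mul_of_odd_of_even h.negSphere_gamma0 (map_mul_of_even_of_even e1 e2)
  · exact map_mul_of_odd_of_even h.negSphere_gamma1 e2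
  · exact h.negSphere_gamma2

end IsPhiPair

/-- The sum telescopes to `1` minus the product in the hypothesis. Each square is preceded by the
defects of the earlier elements, as in the iterated gluing formula. -/
lemma telescope_left {R : Type*} [Ring R] {a b c : R}
    (h : (1 - a * a) * ((1 - b * b) * (1 - c * c)) = 0) :
    a * a + (1 - a * a) * b * b + (1 - a * a) * ((1 - b * b) * c) * c = 1 := by
  rw [← sub_eq_zero, ← neg_eq_zero, ← h]
  noncomm_ring

/-- The mirror image: each square is followed by the defects of the later elements, which is the
shape of `T_{i+1}`. -/
lemma telescope_right {R : Type*} [Ring R] {a b c : R}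
    (h : (1 - a * a) * ((1 - b * b) * (1 - c * c)) = 0) :
    a * (a * ((1 - b * b) * (1 - c * c))) + b * (b * (1 - c * c)) + c * c = 1 := by
  rw [← sub_eq_zero, ← neg_eq_zero, ← h]
  noncomm_ring

namespace IsPhiPair

variable {φ₁ φ₂ : Toeplitz}

lemma sum_leftLegs_mul_rightLegs (h : IsPhiPair φ₁ φ₂) :
    ∑ i, h.leftLegs i * h.rightLegs i = 1 := by
  rw [Fin.sum_univ_three]
  exact telescope_left h.one_sub_sq_mul_eq_zero

lemma sum_leftLegs'_mul_rightLegs' (h : IsPhiPair φ₁ φ₂) :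
    ∑ i, h.leftLegs' i * h.rightLegs' i = 1 := by
  rw [Fin.sum_univ_three]
  exact telescope_right h.one_sub_sq_mul_eq_zero'

/-- The strong connection on the sphere obtained by gluing iteratively. -/
def connSphere (h : IsPhiPair φ₁ φ₂) : CZ2 →ₗ[ℂ] Sphere ⊗[ℂ] Sphere :=
  ofOneGenU (1 ⊗ₜ[ℂ] 1) (∑ i, h.leftLegs i ⊗ₜ[ℂ] h.rightLegs i)

lemma connSphere_one (h : IsPhiPair φ₁ φ₂) : h.connSphere 1 = 1 ⊗ₜ[ℂ] 1 := ofOneGenU_one _ _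

lemma connSphere_genU (h : IsPhiPair φ₁ φ₂) :
    h.connSphere genU = ∑ i, h.leftLegs i ⊗ₜ[ℂ] h.rightLegs i := ofOneGenU_genU _ _

lemma isStrongConnection_connSphere (h : IsPhiPair φ₁ φ₂) :
    IsStrongConnection coactionSphere h.connSphere :=
  isStrongConnection_of_odd negSphere negSphere_negSphere h.negSphere_leftLegs
    h.negSphere_rightLegs h.sum_leftLegs_mul_rightLegs h.connSphere_one h.connSphere_genU

lemma toIterated_gamma2 (h : IsPhiPair φ₁ φ₂) : toIterated h.gamma2 = (uTZ, h.leg2) := rfl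

lemma toIterated_one_sub_sq_mul (h : IsPhiPair φ₁ φ₂) (x : Sphere) :
    toIterated ((1 - h.gamma2 * h.gamma2) * x) =
      (0, (1 - h.leg2 * h.leg2) * (toIterated x).2) := by
  rw [map_mul, map_sub, map_mul, map_one, toIterated_gamma2]
  refine Prod.ext ?_ rfl
  change (1 - uTZ * uTZ) * _ = 0
  rw [uTZ_mul_uTZ, sub_self, zero_mul]

lemma map_toIterated_comp_connSphere (h : IsPhiPair φ₁ φ₂) {f₂ : TZ →ₗ[ℂ] P01}
    {g₂ : P01 →ₗ[ℂ] TZ} (h1 : f₂ 1 = 1) (hf : f₂ uTZ = h.leg2)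
    (hg0 : g₂ h.leg0 = φ₁ ⊗ₜ[ℂ] 1) (hg1 : g₂ h.leg1 = φ₂ ⊗ₜ[ℂ] 1) :
    TensorProduct.map toIterated.toLinearMap toIterated.toLinearMap ∘ₗ h.connSphere =
      pullbackGlue connTZ h.connP01 f₂ g₂ := by
  apply CZ2.linearMap_ext
  · rw [pullbackGlue_one connTZ_one h1, LinearMap.comp_apply, connSphere_one,
      TensorProduct.map_tmul, AlgHom.toLinearMap_apply, map_one]
  · have t1 : toIterated (h.leftLegs 1) ⊗ₜ[ℂ] toIterated (h.rightLegs 1) =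
        ((0, (1 - h.leg2 * h.leg2) * h.leg0) : TZ × P01) ⊗ₜ[ℂ] ((g₂ h.leg0, h.leg0) : TZ × P01) :=
      congrArg₂ (TensorProduct.tmul ℂ) (h.toIterated_one_sub_sq_mul _) (Prod.ext hg0.symm rfl)
    have t2 : toIterated (h.leftLegs 2) ⊗ₜ[ℂ] toIterated (h.rightLegs 2) =
        ((0, (1 - h.leg2 * h.leg2) * ((1 - h.leg0 * h.leg0) * h.leg1)) : TZ × P01) ⊗ₜ[ℂ]
          ((g₂ h.leg1, h.leg1) : TZ × P01) :=
      congrArg₂ (TensorProduct.tmul ℂ) (h.toIterated_one_sub_sq_mul _) (Prod.ext hg1.symm rfl)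
    rw [pullbackGlue_genU_of_add connTZ_genU hf h.connP01_genU, LinearMap.comp_apply,
      connSphere_genU, map_sum, Fin.sum_univ_three, ← t1, ← t2, ← add_assoc]
    rfl

/-! ### Linear independence of the legs -/

lemma sum_smul_coe {l : Fin 3 → Sphere} {c : Fin 3 → ℂ} (hc : ∑ i, c i • l i = 0) (j : Fin 3) :
    c 0 • proj j (l 0) + c 1 • proj j (l 1) + c 2 • proj j (l 2) = 0 := by
  rw [Fin.sum_univ_three] at hc
  have h1 := congrArg (fun x => (proj j).comp Sphere.val x) hc
  simp only [map_add, map_smul, map_zero] at h1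
  exact h1

/-- The family is triangular: component 2 sees only the first leg, then component 0 only the second,
then component 1 the third. The hypothesis also forces `1 - φ₂² ≠ 0`. -/
lemma linearIndependent_leftLegs (h : IsPhiPair φ₁ φ₂)
    (hne : (1 - φ₂ ^ 2) * (1 - φ₁ ^ 2) ≠ 0) : LinearIndependent ℂ h.leftLegs := by
  rw [Fintype.linearIndependent_iff]
  intro c hc
  have l0 : (h.leftLegs 0 : TZ3) = (φ₂ ⊗ₜ[ℂ] 1, φ₂ ⊗ₜ[ℂ] 1, uTZ) := rfl
  have h0 := sum_smul_coe hc 0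
  have h1 := sum_smul_coe hc 1
  have h2 := sum_smul_coe hc 2
  rw [l0, coe_leftLegs_one, coe_leftLegs_two] at h0 h1 h2
  have c0 : c 0 = 0 := by
    change c 0 • uTZ + c 1 • (0 : TZ) + c 2 • (0 : TZ) = 0 at h2
    rw [smul_zero, smul_zero, add_zero, add_zero] at h2
    exact (smul_eq_zero.1 h2).resolve_right uTZ_ne_zero
  have c1 : c 1 = 0 := by
    change c 0 • φ₂ ⊗ₜ[ℂ] (1 : CZ2) + c 1 • ((1 - φ₂ ^ 2) ⊗ₜ[ℂ] genU : TZ) + c 2 • (0 : TZ) = 0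
      at h0
    rw [c0, zero_smul, smul_zero, zero_add, add_zero] at h0
    refine (smul_eq_zero.1 h0).resolve_right fun e => hne ?_
    rw [tmul_genU_eq_zero e, zero_mul]
  have c2 : c 2 = 0 := by
    change c 0 • φ₂ ⊗ₜ[ℂ] (1 : CZ2) + c 1 • (((1 - φ₂ ^ 2) * φ₁) ⊗ₜ[ℂ] (1 : CZ2)) +
      c 2 • (((1 - φ₂ ^ 2) * (1 - φ₁ ^ 2)) ⊗ₜ[ℂ] genU : TZ) = 0 at h1
    rw [c0, c1, zero_smul, zero_smul, zero_add, zero_add] at h1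
    exact (smul_eq_zero.1 h1).resolve_right fun e => hne (tmul_genU_eq_zero e)
  rw [Fin.forall_fin_succ, Fin.forall_fin_two]
  exact ⟨c0, c1, c2⟩

lemma linearIndependent_rightLegs (h : IsPhiPair φ₁ φ₂) : LinearIndependent ℂ h.rightLegs := by
  rw [Fintype.linearIndependent_iff]
  intro c hc
  -- Component 0 alone already separates the legs.
  have h0 : c 0 • φ₂ ⊗ₜ[ℂ] (1 : CZ2) + c 1 • uTZ + c 2 • φ₁ ⊗ₜ[ℂ] (1 : CZ2) = 0 :=
    sum_smul_coe hc 0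
  obtain ⟨c1, c2, c0⟩ := h.eq_zero_of_combination (a := c 1) (b := c 2) (c := c 0)
    (by rw [← h0]; abel)
  rw [Fin.forall_fin_succ, Fin.forall_fin_two]
  exact ⟨c0, c1, c2⟩

lemma linearIndependent_leftLegs' (h : IsPhiPair φ₁ φ₂) : LinearIndependent ℂ h.leftLegs' := by
  rw [Fintype.linearIndependent_iff]
  intro c hc
  have h0 : c 0 • uTZ + c 1 • φ₁ ⊗ₜ[ℂ] (1 : CZ2) + c 2 • φ₂ ⊗ₜ[ℂ] (1 : CZ2) = 0 :=
    sum_smul_coe hc 0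
  rw [Fin.forall_fin_succ, Fin.forall_fin_two]
  exact h.eq_zero_of_combination h0

lemma linearIndependent_rightLegs' (h : IsPhiPair φ₁ φ₂)
    (hne : (1 - φ₁ ^ 2) * (1 - φ₂ ^ 2) ≠ 0) : LinearIndependent ℂ h.rightLegs' := by
  rw [Fintype.linearIndependent_iff]
  intro c hc
  have l2 : (h.rightLegs' 2 : TZ3) = (φ₂ ⊗ₜ[ℂ] 1, φ₂ ⊗ₜ[ℂ] 1, uTZ) := rfl
  have h0 := sum_smul_coe hc 0
  have h1 := sum_smul_coe hc 1
  have h2 := sum_smul_coe hc 2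
  rw [l2, coe_rightLegs'_zero, coe_rightLegs'_one] at h0 h1 h2
  have c2 : c 2 = 0 := by
    change c 0 • (0 : TZ) + c 1 • (0 : TZ) + c 2 • uTZ = 0 at h2
    rw [smul_zero, smul_zero, zero_add, zero_add] at h2
    exact (smul_eq_zero.1 h2).resolve_right uTZ_ne_zero
  have c1 : c 1 = 0 := by
    change c 0 • (0 : TZ) + c 1 • ((1 - φ₂ ^ 2) ⊗ₜ[ℂ] genU : TZ) + c 2 • φ₂ ⊗ₜ[ℂ] (1 : CZ2) = 0
      at h1
    rw [c2, zero_smul, smul_zero, zero_add, add_zero] at h1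
    refine (smul_eq_zero.1 h1).resolve_right fun e => hne ?_
    rw [tmul_genU_eq_zero e, mul_zero]
  have c0 : c 0 = 0 := by
    change c 0 • (((1 - φ₁ ^ 2) * (1 - φ₂ ^ 2)) ⊗ₜ[ℂ] genU : TZ) +
      c 1 • ((φ₁ * (1 - φ₂ ^ 2)) ⊗ₜ[ℂ] (1 : CZ2)) + c 2 • φ₂ ⊗ₜ[ℂ] (1 : CZ2) = 0 at h0
    rw [c2, c1, zero_smul, zero_smul, add_zero, add_zero] at h0
    exact (smul_eq_zero.1 h0).resolve_right fun e => hne (tmul_genU_eq_zero e)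
  rw [Fin.forall_fin_succ, Fin.forall_fin_two]
  exact ⟨c0, c1, c2⟩

end IsPhiPair

/-! ### Splittings of the projections -/

/-- The linear map on `span {1 ⊗ 1, 1 ⊗ u}` with `1 ⊗ 1 ↦ 1` and `1 ⊗ u ↦ g`. -/
def legMap (g : Sphere) : legSpan →ₗ[ℂ] Sphere :=
  -- The two characters take the values `1` and `-1` at `1 ⊗ u`, so half their sum and half their
  -- difference are the coordinates with respect to `1 ⊗ 1` and `1 ⊗ u`.
  (((1 / 2 : ℂ) • ((charTZ 1 1).toLinearMap + (charTZ 1 (-1)).toLinearMap)).smulRight 1 +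
    ((1 / 2 : ℂ) • ((charTZ 1 1).toLinearMap - (charTZ 1 (-1)).toLinearMap)).smulRight g) ∘ₗ
    legSpan.subtype

lemma legMap_legOne (g : Sphere) : legMap g legOne = 1 := by
  change ((1 / 2 : ℂ) • (charTZ 1 1 1 + charTZ 1 (-1) 1)) • (1 : Sphere) +
    ((1 / 2 : ℂ) • (charTZ 1 1 1 - charTZ 1 (-1) 1)) • g = 1
  rw [map_one, map_one]
  norm_num

lemma legMap_legU (g : Sphere) : legMap g legU = g := by
  change ((1 / 2 : ℂ) • (charTZ 1 1 uTZ + charTZ 1 (-1) uTZ)) • (1 : Sphere) +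
    ((1 / 2 : ℂ) • (charTZ 1 1 uTZ - charTZ 1 (-1) uTZ)) • g = g
  rw [charTZ_uTZ, charTZ_uTZ]
  norm_num

lemma exists_eq_legOne_legU (v : legSpan) : ∃ a b : ℂ, v = a • legOne + b • legU := by
  obtain ⟨a, b, hab⟩ := Submodule.mem_span_pair.1 v.2
  exact ⟨a, b, Subtype.ext hab.symm⟩

lemma proj_legMap {g : Sphere} {i : Fin 3} (hg : proj i g = uTZ) (v : legSpan) :
    proj i (legMap g v : TZ3) = v := by
  obtain ⟨a, b, rfl⟩ := exists_eq_legOne_legU v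
  rw [map_add, map_smul, map_smul, legMap_legOne, legMap_legU]
  change (proj i).comp Sphere.val (a • (1 : Sphere) + b • g) = a • (1 : TZ) + b • uTZ
  rw [map_add, map_smul, map_smul, map_one]
  exact congrArg (fun x => a • (1 : TZ) + b • x) hg

lemma isColinearOn_legMap {g : Sphere} (hg : negSphere g = -g) :
    IsColinearOn coactionTZ coactionSphere legSpan (legMap g) := by
  intro v
  obtain ⟨a, b, rfl⟩ := exists_eq_legOne_legU v
  -- The coaction of `𝒯 ⊗ C(ℤ₂)` on a combination of the group-like legs stays in the span and is
  -- written down explicitly.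
  refine ⟨a • (legOne ⊗ₜ[ℂ] 1) + b • (legU ⊗ₜ[ℂ] genU), ?_, ?_⟩
  · have e1 : coactionTZ.toAlgHom 1 = 1 ⊗ₜ[ℂ] 1 := involutionCoaction_one _ _
    have e2 : coactionTZ.toAlgHom uTZ = uTZ ⊗ₜ[ℂ] genU := involutionCoaction_odd _ _ _ negTZ_uTZ
    change _ = coactionTZ.toAlgHom (a • (1 : TZ) + b • uTZ)
    rw [map_add, map_smul, map_smul, map_add, map_smul, map_smul, e1, e2]
    rfl
  · have e1 : coactionSphere.toAlgHom 1 = 1 ⊗ₜ[ℂ] 1 := involutionCoaction_one _ _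
    have e2 : coactionSphere.toAlgHom g = g ⊗ₜ[ℂ] genU := involutionCoaction_odd _ _ _ hg
    rw [map_add, map_smul, map_smul, map_add, map_smul, map_smul, map_add, map_smul, map_smul,
      LinearMap.rTensor_tmul, LinearMap.rTensor_tmul, legMap_legOne, legMap_legU, e1, e2]

/-- The strong connection `connTZ` with values in the span of its legs. -/
def connLegSpan : CZ2 →ₗ[ℂ] legSpan ⊗[ℂ] legSpan :=
  ofOneGenU (legOne ⊗ₜ[ℂ] legOne) (legU ⊗ₜ[ℂ] legU)

lemma map_subtype_comp_connLegSpan :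
    TensorProduct.map legSpan.subtype legSpan.subtype ∘ₗ connLegSpan = connTZ := by
  apply CZ2.linearMap_ext
  · rw [LinearMap.comp_apply, connLegSpan, ofOneGenU_one, connTZ_one]
    rfl
  · rw [LinearMap.comp_apply, connLegSpan, ofOneGenU_genU, connTZ_genU]
    rfl

lemma map_legMap_connLegSpan_one (g : Sphere) :
    (TensorProduct.map (legMap g) (legMap g) ∘ₗ connLegSpan) 1 = 1 ⊗ₜ[ℂ] 1 := by
  rw [LinearMap.comp_apply, connLegSpan, ofOneGenU_one, TensorProduct.map_tmul, legMap_legOne]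

lemma map_legMap_connLegSpan_genU (g : Sphere) :
    (TensorProduct.map (legMap g) (legMap g) ∘ₗ connLegSpan) genU = g ⊗ₜ[ℂ] g := by
  rw [LinearMap.comp_apply, connLegSpan, ofOneGenU_genU, TensorProduct.map_tmul, legMap_legU]

/-! ### The strong connection given by the splittings. -/

namespace IsPhiPair

variable {φ₁ φ₂ : Toeplitz}

/-- The strong connection on the sphere obtained from the splittings of the projections. -/
def connSphere' (h : IsPhiPair φ₁ φ₂) : CZ2 →ₗ[ℂ] Sphere ⊗[ℂ] Sphere :=
  piecewiseGlue (List.ofFn fun i =>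
    TensorProduct.map (legMap (h.leftLegs' i)) (legMap (h.leftLegs' i)) ∘ₗ connLegSpan)

/-- A nonempty product of defects vanishes at `1`, so only the last summand, whose product is empty,
contributes. -/
lemma connSphere'_one (h : IsPhiPair φ₁ φ₂) : h.connSphere' 1 = 1 ⊗ₜ[ℂ] 1 := by
  rw [connSphere', List.ofFn_succ, List.ofFn_succ, List.ofFn_succ, List.ofFn_zero,
    piecewiseGlue_cons_one _ (map_legMap_connLegSpan_one _),
    piecewiseGlue_cons_one _ (map_legMap_connLegSpan_one _),
    piecewiseGlue_cons_one _ (map_legMap_connLegSpan_one _),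
    defectProd_cons_one _ (map_legMap_connLegSpan_one _),
    defectProd_cons_one _ (map_legMap_connLegSpan_one _), defectProd_nil_one]
  simp [piecewiseGlue]

lemma connSphere'_genU (h : IsPhiPair φ₁ φ₂) :
    h.connSphere' genU = ∑ i, h.leftLegs' i ⊗ₜ[ℂ] h.rightLegs' i := by
  rw [connSphere', List.ofFn_succ, List.ofFn_succ, List.ofFn_succ, List.ofFn_zero,
    piecewiseGlue_cons_genU _ (map_legMap_connLegSpan_genU _),
    piecewiseGlue_cons_genU _ (map_legMap_connLegSpan_genU _),
    piecewiseGlue_cons_genU _ (map_legMap_connLegSpan_genU _),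
    defectProd_cons_genU _ (map_legMap_connLegSpan_genU _),
    defectProd_cons_genU _ (map_legMap_connLegSpan_genU _), defectProd_nil_genU,
    Fin.sum_univ_three, mul_one, mul_one, piecewiseGlue, LinearMap.zero_apply, add_zero,
    ← add_assoc]
  rfl

lemma isStrongConnection_connSphere' (h : IsPhiPair φ₁ φ₂) :
    IsStrongConnection coactionSphere h.connSphere' :=
  isStrongConnection_of_odd negSphere negSphere_negSphere h.negSphere_leftLegs'
    h.negSphere_rightLegs' h.sum_leftLegs'_mul_rightLegs' h.connSphere'_one h.connSphere'_genU

lemma proj_leftLegs' (h : IsPhiPair φ₁ φ₂) (i : Fin 3) : proj i (h.leftLegs' i : TZ3) = uTZ := by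
  fin_cases i <;> rfl

end IsPhiPair

end QSphere

end

/-! ### Assembly of the theorem. -/

open QSphere in
theorem mainTheorem7 :
    -- elements `φ₁, φ₂` with the required properties exist
    (∃ φ₁ φ₂ : Toeplitz, IsPhiPair φ₁ φ₂ ∧ (1 - φ₂ ^ 2) * (1 - φ₁ ^ 2) ≠ 0 ∧
      (1 - φ₁ ^ 2) * (1 - φ₂ ^ 2) ≠ 0) ∧
    -- the strong connection `u ↦ (1 ⊗ u) ⊗ (1 ⊗ u)` on the pieces
    ∃ ℓT : CZ2 →ₗ[ℂ] TZ ⊗[ℂ] TZ, IsStrongConnection coactionTZ ℓT ∧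
      ℓT genU = (1 ⊗ₜ[ℂ] genU) ⊗ₜ[ℂ] (1 ⊗ₜ[ℂ] genU) ∧
    ∀ φ₁ φ₂ : Toeplitz, IsPhiPair φ₁ φ₂ →
      -- Method I
      (∃ l r : Fin 3 → Sphere,
        (l 0 : TZ3) = (φ₂ ⊗ₜ[ℂ] 1, φ₂ ⊗ₜ[ℂ] 1, 1 ⊗ₜ[ℂ] genU) ∧
        (r 0 : TZ3) = (φ₂ ⊗ₜ[ℂ] 1, φ₂ ⊗ₜ[ℂ] 1, 1 ⊗ₜ[ℂ] genU) ∧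
        (l 1 : TZ3) = ((1 - φ₂ ^ 2) ⊗ₜ[ℂ] genU, ((1 - φ₂ ^ 2) * φ₁) ⊗ₜ[ℂ] 1, 0) ∧
        (r 1 : TZ3) = (1 ⊗ₜ[ℂ] genU, φ₁ ⊗ₜ[ℂ] 1, φ₁ ⊗ₜ[ℂ] 1) ∧
        (l 2 : TZ3) = (0, ((1 - φ₂ ^ 2) * (1 - φ₁ ^ 2)) ⊗ₜ[ℂ] genU, 0) ∧
        (r 2 : TZ3) = (φ₁ ⊗ₜ[ℂ] 1, 1 ⊗ₜ[ℂ] genU, φ₂ ⊗ₜ[ℂ] 1) ∧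
        ∃ ℓ : CZ2 →ₗ[ℂ] Sphere ⊗[ℂ] Sphere, IsStrongConnection coactionSphere ℓ ∧
          ℓ genU = ∑ i, l i ⊗ₜ[ℂ] r i ∧
          -- it is obtained by iterating the gluing formula: first along `P01`, ...
          (∃ f₀₁ f₁₀ : TZ →ₗ[ℂ] TZ,
            IsGluingMap coactionTZ coactionTZ sigma1Id (Phi01.comp sigma1Id) f₀₁ ∧
            IsGluingMap coactionTZ coactionTZ (Phi01.comp sigma1Id) sigma1Id f₁₀ ∧
            f₀₁ (1 ⊗ₜ[ℂ] genU) = φ₁ ⊗ₜ[ℂ] 1 ∧ f₁₀ (1 ⊗ₜ[ℂ] genU) = φ₁ ⊗ₜ[ℂ] 1 ∧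
            ∃ ℓ₀₁ : CZ2 →ₗ[ℂ] P01 ⊗[ℂ] P01, IsStrongConnection coactionP01 ℓ₀₁ ∧
              TensorProduct.map P01.val.toLinearMap P01.val.toLinearMap ∘ₗ ℓ₀₁ =
                pullbackGlue ℓT ℓT f₀₁ f₁₀ ∧
              TensorProduct.map P01.val.toLinearMap P01.val.toLinearMap (ℓ₀₁ genU) =
                ((1 ⊗ₜ[ℂ] genU, φ₁ ⊗ₜ[ℂ] 1) : TZ2) ⊗ₜ[ℂ] ((1 ⊗ₜ[ℂ] genU, φ₁ ⊗ₜ[ℂ] 1) : TZ2) +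
                ((0, (1 - φ₁ ^ 2) ⊗ₜ[ℂ] genU) : TZ2) ⊗ₜ[ℂ]
                  ((φ₁ ⊗ₜ[ℂ] 1, 1 ⊗ₜ[ℂ] genU) : TZ2) ∧
              -- ... then along the iterated pullback of `β₁` and `β₂`
              ∃ (f₂ : TZ →ₗ[ℂ] P01) (g₂ : P01 →ₗ[ℂ] TZ),
                IsGluingMap coactionTZ coactionP01 beta1 beta2 f₂ ∧
                IsGluingMap coactionP01 coactionTZ beta2 beta1 g₂ ∧
                (f₂ (1 ⊗ₜ[ℂ] genU) : TZ2) = (φ₂ ⊗ₜ[ℂ] 1, φ₂ ⊗ₜ[ℂ] 1) ∧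
                (∃ x : P01, (x : TZ2) = (1 ⊗ₜ[ℂ] genU, φ₁ ⊗ₜ[ℂ] 1) ∧ g₂ x = φ₁ ⊗ₜ[ℂ] 1) ∧
                (∃ x : P01, (x : TZ2) = (φ₁ ⊗ₜ[ℂ] 1, 1 ⊗ₜ[ℂ] genU) ∧ g₂ x = φ₂ ⊗ₜ[ℂ] 1) ∧
                TensorProduct.map toIterated.toLinearMap toIterated.toLinearMap ∘ₗ ℓ =
                  pullbackGlue ℓT ℓ₀₁ f₂ g₂) ∧
          -- linear independence of the legs
          ((1 - φ₂ ^ 2) * (1 - φ₁ ^ 2) ≠ 0 → LinearIndependent ℂ l ∧ LinearIndependent ℂ r) ∧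
          -- the projector of the associated line bundle
          ∃ p : Matrix (Fin 3) (Fin 3) coactionSphere.coinvariants,
            (∀ i j, (p i j : Sphere) = r i * l j) ∧ p * p = p ∧
            Nonempty (coactionSphere.lineBundle genU ≃ₗ[coactionSphere.coinvariants]
              LinearMap.range p.vecMulLinear)) ∧
      -- Method II
      (∃ l r : Fin 3 → Sphere,
        (l 0 : TZ3) = (1 ⊗ₜ[ℂ] genU, φ₁ ⊗ₜ[ℂ] 1, φ₁ ⊗ₜ[ℂ] 1) ∧
        (r 0 : TZ3) = (((1 - φ₁ ^ 2) * (1 - φ₂ ^ 2)) ⊗ₜ[ℂ] genU, 0, 0) ∧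
        (l 1 : TZ3) = (φ₁ ⊗ₜ[ℂ] 1, 1 ⊗ₜ[ℂ] genU, φ₂ ⊗ₜ[ℂ] 1) ∧
        (r 1 : TZ3) = ((φ₁ * (1 - φ₂ ^ 2)) ⊗ₜ[ℂ] 1, (1 - φ₂ ^ 2) ⊗ₜ[ℂ] genU, 0) ∧
        (l 2 : TZ3) = (φ₂ ⊗ₜ[ℂ] 1, φ₂ ⊗ₜ[ℂ] 1, 1 ⊗ₜ[ℂ] genU) ∧
        (r 2 : TZ3) = (φ₂ ⊗ₜ[ℂ] 1, φ₂ ⊗ₜ[ℂ] 1, 1 ⊗ₜ[ℂ] genU) ∧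
        ∃ ℓ : CZ2 →ₗ[ℂ] Sphere ⊗[ℂ] Sphere, IsStrongConnection coactionSphere ℓ ∧
          ℓ genU = ∑ i, l i ⊗ₜ[ℂ] r i ∧
          -- it is given by the formula for piecewise principal comodule algebras
          (∃ (ℓV : CZ2 →ₗ[ℂ] legSpan ⊗[ℂ] legSpan) (α : Fin 3 → (legSpan →ₗ[ℂ] Sphere)),
            TensorProduct.map legSpan.subtype legSpan.subtype ∘ₗ ℓV = ℓT ∧
            (∀ i, α i legOne = 1 ∧ α i legU = l i ∧
              (∀ v, proj i (α i v : TZ3) = v) ∧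
              IsColinearOn coactionTZ coactionSphere legSpan (α i)) ∧
            ℓ = piecewiseGlue (List.ofFn fun i => TensorProduct.map (α i) (α i) ∘ₗ ℓV)) ∧
          -- linear independence of the legs
          LinearIndependent ℂ l ∧
          ((1 - φ₁ ^ 2) * (1 - φ₂ ^ 2) ≠ 0 → LinearIndependent ℂ r)) := by
  refine ⟨exists_isPhiPair_mul_ne_zero, connTZ, isStrongConnection_connTZ, connTZ_genU,
    fun φ₁ φ₂ h => ⟨⟨h.leftLegs, h.rightLegs, rfl, rfl, h.coe_leftLegs_one, rfl,
      h.coe_leftLegs_two, rfl, h.connSphere, h.isStrongConnection_connSphere, h.connSphere_genU,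
      ?_, fun hne => ⟨h.linearIndependent_leftLegs hne, h.linearIndependent_rightLegs⟩,
      exists_projector_lineBundle negSphere negSphere_negSphere h.negSphere_leftLegs
        h.negSphere_rightLegs h.sum_leftLegs_mul_rightLegs⟩,
    ⟨h.leftLegs', h.rightLegs', rfl, h.coe_rightLegs'_zero, rfl, h.coe_rightLegs'_one, rfl, rfl,
      h.connSphere', h.isStrongConnection_connSphere', h.connSphere'_genU,
      ⟨connLegSpan, fun i => legMap (h.leftLegs' i), map_subtype_comp_connLegSpan,
        fun i => ⟨legMap_legOne _, legMap_legU _, proj_legMap (h.proj_leftLegs' i),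
          isColinearOn_legMap (h.negSphere_leftLegs' i)⟩, rfl⟩,
      h.linearIndependent_leftLegs', h.linearIndependent_rightLegs'⟩⟩⟩
  -- It remains to exhibit the connection of Method I as the result of the two gluing steps.
  obtain ⟨f₀₁, f₁₀, hf, hg, hfu, hgu⟩ := h.exists_isGluingMap_pieces
  obtain ⟨f₂, g₂, hf₂, hg₂, hfu₂, hg0, hg1⟩ := h.exists_isGluingMap_iterated
  exact ⟨f₀₁, f₁₀, hf, hg, hfu, hgu, h.connP01, h.isStrongConnection_connP01,
    h.map_val_comp_connP01 hf.unital hfu hgu, h.map_val_connP01_genU, f₂, g₂, hf₂, hg₂,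
    congrArg Subtype.val hfu₂, ⟨h.leg0, rfl, hg0⟩, ⟨h.leg1, rfl, hg1⟩,
    h.map_toIterated_comp_connSphere hf₂.unital hfu₂ hg0 hg1⟩
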